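/- Let $\mathbb F\in\{\mathbb R,\mathbb C\}$, let $\mathcal G$ be an étale groupoid (not necessarily Hausdorff) with locally compact Hausdorff unit space $X$, with domain and range maps $d,r:\mathcal G\to X$, and let $\mathcal L=\bigsqcup_{\gamma}L_\gamma$ be a twist over $\mathcal G$, i.e. a Fell line bundle over $\mathcal G$ with fibres $L_\gamma\cong\mathbb F$. A bisection is an open set $U\subseteq\mathcal G$ on which $d$ and $r$ are homeomorphisms onto open sets; for open $U$ let $C_c(U,\mathcal L)$ be the space of continuous compactly supported sections over $U$, extended by zero, and let $\mathfrak C_c(\mathcal G,\mathcal L)$ be the linear span of all $C_c(U,\mathcal L)$ with $U$ a bisection, with the convolution product $(f*g)(\gamma)=\sum_{r(\eta)=r(\gamma)}f(\eta)\cdot g(\eta^{-1}\gamma)$. Note that $C_c(X)=C_c(X,\mathcal L)\subseteq\mathfrak C_c(\mathcal G,\mathcal L)$. Put \[ \|f\|_{d_*}=\sup_{x\in X}\sum_{d(\gamma)=x}|f(\gamma)|,\qquad \|f\|_{r_*}=\sup_{x\in X}\sum_{r(\gamma)=x}|f(\gamma)|,\qquad \|f\|_I=\max\{\|f\|_{d_*},\|f\|_{r_*}\}.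 \] Let $S$ be an inverse semigroup of bisections covering $\mathcal G$ (a family of bisections closed under products and inverses with union $\mathcal G$), and let $F^S(\mathcal G,\mathcal L)$ be the Banach algebra completion of $\mathfrak C_c(\mathcal G,\mathcal L)$ in the norm $\|f\|^S_{\max}=\inf\{\sum_{k=1}^n\|f_k\|_\infty: f=\sum_{k=1}^n f_k,\ f_k\in C_c(U_k,\mathcal L),\ U_k\in S\}$. A representation of $F^S(\mathcal G,\mathcal L)$ on a Banach space $E$ is a contractive algebra homomorphism $\psi:F^S(\mathcal G,\mathcal L)\to B(E)$. Let $p,q\in[1,\infty]$ with $1/p+1/q=1$, let $\mu$ be a measure and let $\psi:F^S(\mathcal G,\mathcal L)\to B(L^p(\mu))$ be a representation. Assume that at least one of the following holds: (a) $\mathbb F=\mathbb C$ and $\psi$ restricts to a representation of $C_0(X)$, i.e. $\|\psi(f)\|\le\|f\|_\infty$ for all $f\in C_c(X)$ (this is automatic if $X\in S$, for instance if $S$ consists of all bisections); (b) $p=2$; (c) for every $f\in C_c(X)$ the operator $\psi(f)$ is the operator of multiplication by a function in $L^\infty(\mu)$. Then for all $f\in\mathfrak C_c(\mathcal G,\mathcal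 L)$ \[ \|\psi(f)\|\le\|f\|_{d_*}^{1/p}\,\|f\|_{r_*}^{1/q}\le\|f\|_I . \] Moreover, if $\Omega$ is a locally compact Hausdorff space and $\psi:F^S(\mathcal G,\mathcal L)\to B(C_0(\Omega))$ is a representation such that either (a) holds, or for every $f\in C_c(X)$ the operator $\psi(f)$ is the operator of multiplication by a bounded continuous function on $\Omega$, then $\|\psi(f)\|\le\|f\|_{r_*}$ for all $f\in\mathfrak C_c(\mathcal G,\mathcal L)$. -/

import Mathlib

open Topology MeasureTheory Bundle UniformSpace
open scoped ENNReal ZeroAtInfty BoundedContinuousFunction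

set_option linter.unusedSectionVars false

noncomputable section

namespace TwistedGroupoid

universe u v w

/-! ### Étale groupoids and bisections -/

/-- An étale groupoid on the set of arrows `G`, with locally compact Hausdorff unit space.
`d` and `r` are the domain and range maps, viewed as maps into the set of units
`Set.range d ⊆ G`. The product `mul γ η` is meaningful only when `d γ = r η`; its values on other
pairs are irrelevant. The space `G` itself need not be Hausdorff. -/
structure EtaleGroupoid (G : Type u) [TopologicalSpace G] where
  d : G → G
  r : G → G
  inv : G → G
  mul : G → G → G
  d_d : ∀ γ, d (d γ) = d γ
  r_d : ∀ γ, r (d γ) = d γ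
  d_r : ∀ γ, d (r γ) = r γ
  r_r : ∀ γ, r (r γ) = r γ
  d_mul : ∀ γ η, d γ = r η → d (mul γ η) = d η
  r_mul : ∀ γ η, d γ = r η → r (mul γ η) = r γ
  mul_assoc : ∀ γ η ζ, d γ = r η → d η = r ζ → mul (mul γ η) ζ = mul γ (mul η ζ)
  mul_d : ∀ γ, mul γ (d γ) = γ
  r_mul_self : ∀ γ, mul (r γ) γ = γ
  d_inv : ∀ γ, d (inv γ) = r γ
  r_inv : ∀ γ, r (inv γ) = d γ
  mul_inv : ∀ γ, mul γ (inv γ) = r γ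
  inv_mul : ∀ γ, mul (inv γ) γ = d γ
  continuous_d : Continuous d
  continuous_r : Continuous r
  continuous_inv : Continuous inv
  continuousOn_mul : ContinuousOn (fun p : G × G => mul p.1 p.2) {p | d p.1 = r p.2}
  isLocalHomeomorph_d : IsLocalHomeomorph (fun γ => (⟨d γ, γ, rfl⟩ : Set.range d))
  isLocalHomeomorph_r : IsLocalHomeomorph (fun γ => (⟨r γ, r γ, d_r γ⟩ : Set.range d))
  t2Space_units : T2Space (Set.range d)
  locallyCompactSpace_units : LocallyCompactSpace (Set.range d)

namespace EtaleGroupoid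

variable {G : Type u} [TopologicalSpace G] (𝒢 : EtaleGroupoid G)

/-- The unit space `X ⊆ G`. -/
def units : Set G := Set.range 𝒢.d

/-- `γ` and `η` are composable with product `ζ`. -/
def Comp (γ η ζ : G) : Prop := 𝒢.d γ = 𝒢.r η ∧ 𝒢.mul γ η = ζ

/-- A bisection: an open set on which `r` and `d` are homeomorphisms onto open subsets of `G`. -/
def IsBisection (U : Set G) : Prop :=
  IsOpen U ∧ IsOpenEmbedding (U.domRestrict 𝒢.d) ∧ IsOpenEmbedding (U.domRestrict 𝒢.r)

/-- The product of bisections. -/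
def setMul (U V : Set G) : Set G := {ζ | ∃ γ ∈ U, ∃ η ∈ V, 𝒢.Comp γ η ζ}

/-- The inverse of a bisection. -/
def setInv (U : Set G) : Set G := 𝒢.inv '' U

/-- An inverse semigroup `S ⊆ Bis(G)` covering `G`: a family of bisections closed under products
and inverses whose union is `G`. -/
structure CoveringSemigroup where
  carrier : Set (Set G)
  isBisection : ∀ U ∈ carrier, 𝒢.IsBisection U
  mul_mem : ∀ U ∈ carrier, ∀ V ∈ carrier, 𝒢.setMul U V ∈ carrier
  inv_mem : ∀ U ∈ carrier, 𝒢.setInv U ∈ carrier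
  covers : ∀ γ, ∃ U ∈ carrier, γ ∈ U

variable {𝒢}

theorem d_eq_self {γ : G} (h : γ ∈ 𝒢.units) : 𝒢.d γ = γ := by
  obtain ⟨η, rfl⟩ := h
  exact 𝒢.d_d η

theorem isOpen_units : IsOpen 𝒢.units := by
  rw [isOpen_iff_mem_nhds]
  intro x hx
  obtain ⟨e, hxe, he⟩ := 𝒢.isLocalHomeomorph_d x
  have h1 : e.source ∈ 𝓝 x := e.open_source.mem_nhds hxe
  have h2 : 𝒢.d ⁻¹' e.source ∈ 𝓝 x := by
    apply 𝒢.continuous_d.continuousAt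
    rw [d_eq_self hx]
    exact h1
  filter_upwards [h1, h2] with γ hγ hdγ
  refine ⟨γ, e.injOn hdγ hγ ?_⟩
  rw [← he]
  exact Subtype.ext (𝒢.d_d γ)

theorem isOpenMap_d : IsOpenMap 𝒢.d :=
  (isOpen_units (𝒢 := 𝒢)).isOpenMap_subtype_val.comp 𝒢.isLocalHomeomorph_d.isOpenMap

theorem isOpenMap_r : IsOpenMap 𝒢.r :=
  (isOpen_units (𝒢 := 𝒢)).isOpenMap_subtype_val.comp 𝒢.isLocalHomeomorph_r.isOpenMap

theorem isBisection_iff {U : Set G} :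
    𝒢.IsBisection U ↔ IsOpen U ∧ Set.InjOn 𝒢.d U ∧ Set.InjOn 𝒢.r U := by
  constructor
  · rintro ⟨h, h1, h2⟩
    exact ⟨h, Set.injOn_iff_injective.2 h1.injective, Set.injOn_iff_injective.2 h2.injective⟩
  · rintro ⟨h, h1, h2⟩
    refine ⟨h, ?_, ?_⟩
    · exact .of_continuous_injective_isOpenMap (𝒢.continuous_d.comp continuous_subtype_val)
        (Set.injOn_iff_injective.1 h1) (isOpenMap_d.comp h.isOpenMap_subtype_val)
    · exact .of_continuous_injective_isOpenMap (𝒢.continuous_r.comp continuous_subtype_val)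
        (Set.injOn_iff_injective.1 h2) (isOpenMap_r.comp h.isOpenMap_subtype_val)

theorem Comp.r_eq {γ η ζ : G} (h : 𝒢.Comp γ η ζ) : 𝒢.r ζ = 𝒢.r γ := by
  rw [← h.2, 𝒢.r_mul _ _ h.1]

theorem Comp.d_eq {γ η ζ : G} (h : 𝒢.Comp γ η ζ) : 𝒢.d ζ = 𝒢.d η := by
  rw [← h.2, 𝒢.d_mul _ _ h.1]

theorem comp_div {η γ : G} (h : 𝒢.r η = 𝒢.r γ) :
    𝒢.Comp η (𝒢.mul (𝒢.inv η) γ) γ := by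
  have h0 : 𝒢.d (𝒢.inv η) = 𝒢.r γ := by rw [𝒢.d_inv, h]
  refine ⟨by rw [𝒢.r_mul _ _ h0, 𝒢.r_inv], ?_⟩
  rw [← 𝒢.mul_assoc _ _ _ (𝒢.r_inv η).symm h0, 𝒢.mul_inv, h, 𝒢.r_mul_self]

theorem Comp.eq_div {γ η ζ : G} (h : 𝒢.Comp γ η ζ) : 𝒢.mul (𝒢.inv γ) ζ = η := by
  rw [← h.2, ← 𝒢.mul_assoc _ _ _ (𝒢.d_inv γ) h.1, 𝒢.inv_mul, h.1, 𝒢.r_mul_self]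

theorem Comp.eq_right {γ η η' ζ : G} (h : 𝒢.Comp γ η ζ) (h' : 𝒢.Comp γ η' ζ) : η = η' := by
  rw [← h.eq_div, h'.eq_div]

theorem Comp.assoc {γ η ζ α ω : G} (h1 : 𝒢.Comp γ η α) (h2 : 𝒢.Comp α ζ ω) :
    𝒢.Comp η ζ (𝒢.mul η ζ) ∧ 𝒢.Comp γ (𝒢.mul η ζ) ω := by
  have h : 𝒢.d η = 𝒢.r ζ := by rw [← h1.d_eq, h2.1]
  refine ⟨⟨h, rfl⟩, ?_, ?_⟩
  · rw [𝒢.r_mul _ _ h, h1.1]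
  · rw [← 𝒢.mul_assoc _ _ _ h1.1 h, h1.2, h2.2]

/-- On `r⁻¹(r(U))` the unique factor in `U` depends continuously on the arrow. -/
theorem IsBisection.exists_factor {U : Set G} (hU : 𝒢.IsBisection U) :
    ∃ a : G → G, ContinuousOn a (𝒢.r ⁻¹' (𝒢.r '' U)) ∧
      ∀ γ ∈ 𝒢.r ⁻¹' (𝒢.r '' U), a γ ∈ U ∧ 𝒢.r (a γ) = 𝒢.r γ := by
  classical
  rcases U.eq_empty_or_nonempty with rfl | ⟨γ₀, hγ₀⟩
  · exact ⟨id, by simp, by simp⟩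
  have : Nonempty U := ⟨⟨γ₀, hγ₀⟩⟩
  let e := hU.2.2.toOpenPartialHomeomorph (U.domRestrict 𝒢.r)
  have hrange : e.target = 𝒢.r '' U := by
    simp [e, Set.range_domRestrict]
  refine ⟨fun γ => (e.symm (𝒢.r γ) : G), ?_, ?_⟩
  · refine continuous_subtype_val.comp_continuousOn ?_
    refine e.continuousOn_symm.comp 𝒢.continuous_r.continuousOn ?_
    intro γ hγ
    rw [hrange]
    exact hγ
  · intro γ hγ
    refine ⟨(e.symm (𝒢.r γ)).2, ?_⟩
    exact e.right_inv (by rw [hrange]; exact hγ)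

theorem IsBisection.isOpen_preimage {U : Set G} (hU : 𝒢.IsBisection U) :
    IsOpen (𝒢.r ⁻¹' (𝒢.r '' U)) :=
  (isOpenMap_r _ hU.1).preimage 𝒢.continuous_r

/-- A point of `U·V` factors continuously. -/
theorem IsBisection.exists_factors {U V : Set G} (hU : 𝒢.IsBisection U)
    (hV : 𝒢.IsBisection V) :
    IsOpen (𝒢.setMul U V) ∧ ∃ a b : G → G, ContinuousOn a (𝒢.setMul U V) ∧
      ContinuousOn b (𝒢.setMul U V) ∧
      ∀ ζ ∈ 𝒢.setMul U V, a ζ ∈ U ∧ b ζ ∈ V ∧ 𝒢.Comp (a ζ) (b ζ) ζ := by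
  obtain ⟨a, ha, haU⟩ := hU.exists_factor
  set W := 𝒢.r ⁻¹' (𝒢.r '' U) with hW
  have hb : ContinuousOn (fun γ => 𝒢.mul (𝒢.inv (a γ)) γ) W := by
    refine 𝒢.continuousOn_mul.comp
      ((𝒢.continuous_inv.comp_continuousOn ha).prodMk continuousOn_id) ?_
    intro γ hγ
    change 𝒢.d (𝒢.inv (a γ)) = 𝒢.r γ
    rw [𝒢.d_inv, (haU γ hγ).2]
  have hset : 𝒢.setMul U V = W ∩ (fun γ => 𝒢.mul (𝒢.inv (a γ)) γ) ⁻¹' V := by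
    ext ζ
    constructor
    · rintro ⟨γ, hγ, η, hη, h⟩
      have hζ : ζ ∈ W := ⟨γ, hγ, h.r_eq.symm⟩
      refine ⟨hζ, ?_⟩
      have : a ζ = γ := (isBisection_iff.1 hU).2.2 (haU ζ hζ).1 hγ
        ((haU ζ hζ).2.trans h.r_eq)
      simp only [Set.mem_preimage, this, h.eq_div]
      exact hη
    · rintro ⟨hζ, hζV⟩
      exact ⟨a ζ, (haU ζ hζ).1, _, hζV, comp_div (haU ζ hζ).2⟩
  refine ⟨?_, a, _, ha.mono ?_, hb.mono ?_, ?_⟩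
  · rw [hset]
    exact hb.isOpen_inter_preimage hU.isOpen_preimage hV.1
  · rw [hset]; exact Set.inter_subset_left
  · rw [hset]; exact Set.inter_subset_left
  · intro ζ hζ
    rw [hset] at hζ
    exact ⟨(haU ζ hζ.1).1, hζ.2, comp_div (haU ζ hζ.1).2⟩

theorem IsBisection.setMul {U V : Set G} (hU : 𝒢.IsBisection U) (hV : 𝒢.IsBisection V) :
    𝒢.IsBisection (𝒢.setMul U V) := by
  rw [isBisection_iff] at *
  refine ⟨((isBisection_iff.2 hU).exists_factors (isBisection_iff.2 hV)).1, ?_, ?_⟩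
  · rintro ζ ⟨γ, hγ, η, hη, h⟩ ζ' ⟨γ', hγ', η', hη', h'⟩ heq
    have e1 : η = η' := hV.2.1 hη hη' (by rw [← h.d_eq, ← h'.d_eq, heq])
    have e2 : γ = γ' := hU.2.1 hγ hγ' (by rw [h.1, h'.1, e1])
    rw [← h.2, ← h'.2, e1, e2]
  · rintro ζ ⟨γ, hγ, η, hη, h⟩ ζ' ⟨γ', hγ', η', hη', h'⟩ heq
    have e1 : γ = γ' := hU.2.2 hγ hγ' (by rw [← h.r_eq, ← h'.r_eq, heq])
    have e2 : η = η' := hV.2.2 hη hη' (by rw [← h.1, ← h'.1, e1])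
    rw [← h.2, ← h'.2, e1, e2]

theorem IsBisection.isOpenEmbedding_toUnits {U : Set G} (hU : 𝒢.IsBisection U) :
    IsOpenEmbedding (fun γ : U => (⟨𝒢.d γ, γ, rfl⟩ : Set.range 𝒢.d)) :=
  .of_continuous_injective_isOpenMap
    ((𝒢.continuous_d.comp continuous_subtype_val).subtype_mk _)
    (fun _ _ h => hU.2.1.injective (congrArg Subtype.val h))
    (𝒢.isLocalHomeomorph_d.isOpenMap.comp hU.1.isOpenMap_subtype_val)

theorem IsBisection.t2Space {U : Set G} (hU : 𝒢.IsBisection U) : T2Space U :=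
  have := 𝒢.t2Space_units
  hU.isOpenEmbedding_toUnits.isEmbedding.t2Space

theorem IsBisection.locallyCompactSpace {U : Set G} (hU : 𝒢.IsBisection U) :
    LocallyCompactSpace U :=
  have := 𝒢.locallyCompactSpace_units
  hU.isOpenEmbedding_toUnits.locallyCompactSpace

end EtaleGroupoid

/-! ### Line bundles and twists -/

section Bundle

variable (𝕜 : Type w) [RCLike 𝕜] {G : Type u} [TopologicalSpace G]
  (L : G → Type v) [∀ γ, NormedAddCommGroup (L γ)] [∀ γ, NormedSpace 𝕜 (L γ)]
  [TopologicalSpace (TotalSpace 𝕜 L)]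

/-- `L` is a line bundle over `G` with continuous norm: the fibres are one-dimensional normed
spaces and every point of `G` has an open neighbourhood `U` with a section `s` of norm one over
`U` such that `(γ, c) ↦ c • s γ` is a homeomorphism from `U × 𝕜` onto the open set of all elements
of the bundle lying over `U`. -/
structure IsLineBundle : Prop where
  finrank_eq_one : ∀ γ, Module.finrank 𝕜 (L γ) = 1
  locally_trivial : ∀ γ₀, ∃ U : Set G, IsOpen U ∧ γ₀ ∈ U ∧ ∃ s : ∀ γ, L γ,
    (∀ γ ∈ U, ‖s γ‖ = 1) ∧
    IsOpenEmbedding (fun p : U × 𝕜 => (⟨p.1, p.2 • s p.1⟩ : TotalSpace 𝕜 L))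

/-- A twist over `𝒢`: a Fell line bundle. The product `mul h : L γ × L η → L ζ` is indexed by a
proof `h` that `ζ` is the product of the composable arrows `γ` and `η`, and the involution
`star h : L γ → L η` by a proof `h` that `η = γ⁻¹`. The element `one h` is the unit of the
one-dimensional algebra over a unit arrow, through which this algebra is identified with `𝕜`. -/
structure Twist (𝒢 : EtaleGroupoid G) where
  isLineBundle : IsLineBundle 𝕜 L
  mul : ∀ {γ η ζ : G}, 𝒢.Comp γ η ζ → L γ →ₗ[𝕜] L η →ₗ[𝕜] L ζ
  norm_mul : ∀ {γ η ζ : G} (h : 𝒢.Comp γ η ζ) (z : L γ) (w : L η), ‖mul h z w‖ = ‖z‖ * ‖w‖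
  mul_assoc : ∀ {γ η ζ α β ω : G} (h₁ : 𝒢.Comp γ η α) (h₂ : 𝒢.Comp α ζ ω)
    (h₃ : 𝒢.Comp η ζ β) (h₄ : 𝒢.Comp γ β ω) (x : L γ) (y : L η) (z : L ζ),
    mul h₂ (mul h₁ x y) z = mul h₄ x (mul h₃ y z)
  continuous_mul : Continuous
    (fun p : {p : TotalSpace 𝕜 L × TotalSpace 𝕜 L // 𝒢.d p.1.proj = 𝒢.r p.2.proj} =>
      (⟨𝒢.mul p.1.1.proj p.1.2.proj, mul ⟨p.2, rfl⟩ p.1.1.snd p.1.2.snd⟩ : TotalSpace 𝕜 L))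
  one : ∀ {x : G}, x ∈ 𝒢.units → L x
  one_mul : ∀ {x γ : G} (hx : x ∈ 𝒢.units) (h : 𝒢.Comp x γ γ) (z : L γ), mul h (one hx) z = z
  mul_one : ∀ {x γ : G} (hx : x ∈ 𝒢.units) (h : 𝒢.Comp γ x γ) (z : L γ), mul h z (one hx) = z
  star : ∀ {γ η : G}, 𝒢.inv γ = η → L γ →ₛₗ[starRingEnd 𝕜] L η
  star_star : ∀ {γ η : G} (h : 𝒢.inv γ = η) (h' : 𝒢.inv η = γ) (z : L γ),
    star h' (star h z) = z
  norm_star : ∀ {γ η : G} (h : 𝒢.inv γ = η) (z : L γ), ‖star h z‖ = ‖z‖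
  star_mul : ∀ {γ η ζ γ' η' ζ' : G} (h : 𝒢.Comp γ η ζ) (h' : 𝒢.Comp η' γ' ζ')
    (hγ : 𝒢.inv γ = γ') (hη : 𝒢.inv η = η') (hζ : 𝒢.inv ζ = ζ') (z : L γ) (w : L η),
    star hζ (mul h z w) = mul h' (star hη w) (star hγ z)
  mul_star : ∀ {γ γ' x : G} (hx : x ∈ 𝒢.units) (h : 𝒢.Comp γ γ' x) (hγ : 𝒢.inv γ = γ')
    (z : L γ), mul h z (star hγ z) = ((‖z‖ : 𝕜) ^ 2) • one hx
  continuous_star : Continuous (fun z : TotalSpace 𝕜 L =>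
    (⟨𝒢.inv z.proj, star rfl z.snd⟩ : TotalSpace 𝕜 L))

variable {L}

/-- `C_c(U, L)`: the sections of `L` that are continuous on `U` and vanish outside a compact
subset of `U`. -/
def CcOn (U : Set G) : Set (∀ γ, L γ) :=
  {f | ContinuousOn (fun γ => (⟨γ, f γ⟩ : TotalSpace 𝕜 L)) U ∧
    ∃ K ⊆ U, IsCompact K ∧ ∀ γ, γ ∉ K → f γ = 0}

/-- The supremum norm of a section. -/
def supNorm (f : ∀ γ, L γ) : ℝ := ⨆ γ, ‖f γ‖

variable {𝕜}

theorem IsLineBundle.exists_smul_eq (hL : IsLineBundle 𝕜 L) {γ : G} {s : L γ} (hs : ‖s‖ = 1)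
    (z : L γ) : ∃ c : 𝕜, c • s = z :=
  (finrank_eq_one_iff_of_nonzero' s (by rintro rfl; simp at hs)).1 (hL.finrank_eq_one γ) z

/-- Every element of the bundle lies in the image of a local trivialization. -/
theorem IsLineBundle.exists_chart (hL : IsLineBundle 𝕜 L) (z : TotalSpace 𝕜 L) :
    ∃ (U : Set G) (s : ∀ γ, L γ), IsOpen U ∧ (∀ γ ∈ U, ‖s γ‖ = 1) ∧
      IsOpenEmbedding (fun p : U × 𝕜 => (⟨p.1, p.2 • s p.1⟩ : TotalSpace 𝕜 L)) ∧
      ∃ p : U × 𝕜, (⟨p.1, p.2 • s p.1⟩ : TotalSpace 𝕜 L) = z := by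
  obtain ⟨U, hU, hz, s, hs, he⟩ := hL.locally_trivial z.proj
  obtain ⟨c, hc⟩ := hL.exists_smul_eq (hs _ hz) z.snd
  refine ⟨U, s, hU, hs, he, (⟨z.proj, hz⟩, c), ?_⟩
  simp only [hc]

theorem IsLineBundle.continuous_proj (hL : IsLineBundle 𝕜 L) :
    Continuous (TotalSpace.proj : TotalSpace 𝕜 L → G) := by
  rw [continuous_iff_continuousAt]
  intro z
  obtain ⟨U, s, -, -, he, p, rfl⟩ := hL.exists_chart z
  exact he.continuousAt_iff.1 (continuous_subtype_val.comp continuous_fst).continuousAt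

theorem IsLineBundle.continuous_norm (hL : IsLineBundle 𝕜 L) :
    Continuous (fun z : TotalSpace 𝕜 L => ‖z.snd‖) := by
  rw [continuous_iff_continuousAt]
  intro z
  obtain ⟨U, s, -, hs, he, p, rfl⟩ := hL.exists_chart z
  refine he.continuousAt_iff.1 (Continuous.continuousAt ?_)
  have : (fun z : TotalSpace 𝕜 L => ‖z.snd‖) ∘
      (fun p : U × 𝕜 => (⟨p.1, p.2 • s p.1⟩ : TotalSpace 𝕜 L)) = fun p => ‖p.2‖ := by
    funext p
    simp [norm_smul, hs _ p.1.2]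
  rw [this]
  fun_prop

theorem IsLineBundle.continuous_smul (hL : IsLineBundle 𝕜 L) :
    Continuous (fun q : 𝕜 × TotalSpace 𝕜 L =>
      (⟨q.2.proj, q.1 • q.2.snd⟩ : TotalSpace 𝕜 L)) := by
  rw [continuous_iff_continuousAt]
  rintro ⟨c, z⟩
  obtain ⟨U, s, -, hs, he, p, rfl⟩ := hL.exists_chart z
  refine (IsOpenEmbedding.id.prodMap he).continuousAt_iff (x := (c, p)).1
    (Continuous.continuousAt ?_)
  have : (fun q : 𝕜 × TotalSpace 𝕜 L =>
      (⟨q.2.proj, q.1 • q.2.snd⟩ : TotalSpace 𝕜 L)) ∘ (Prod.map id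
      (fun p : U × 𝕜 => (⟨p.1, p.2 • s p.1⟩ : TotalSpace 𝕜 L))) =
      (fun p : U × 𝕜 => (⟨p.1, p.2 • s p.1⟩ : TotalSpace 𝕜 L)) ∘
        fun t : 𝕜 × (U × 𝕜) => (t.2.1, t.1 * t.2.2) := by
    funext t
    simp [mul_smul]
  rw [this]
  exact he.continuous.comp (by fun_prop)

theorem IsLineBundle.continuous_zero (hL : IsLineBundle 𝕜 L) :
    Continuous (fun γ : G => (⟨γ, 0⟩ : TotalSpace 𝕜 L)) := by
  rw [continuous_iff_continuousAt]
  intro γ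
  obtain ⟨U, hU, hz, s, hs, he⟩ := hL.locally_trivial γ
  refine hU.isOpenEmbedding_subtypeVal.continuousAt_iff (x := ⟨γ, hz⟩).1 ?_
  have : (fun γ : G => (⟨γ, 0⟩ : TotalSpace 𝕜 L)) ∘ (Subtype.val : U → G) =
      (fun p : U × 𝕜 => (⟨p.1, p.2 • s p.1⟩ : TotalSpace 𝕜 L)) ∘ fun x => (x, 0) := by
    funext x
    simp
  rw [this]
  exact (he.continuous.comp (by fun_prop)).continuousAt

theorem IsLineBundle.smul_continuousOn (hL : IsLineBundle 𝕜 L) {c : G → 𝕜} {f : ∀ γ, L γ}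
    {U : Set G} (hc : ContinuousOn c U)
    (hf : ContinuousOn (fun γ => (⟨γ, f γ⟩ : TotalSpace 𝕜 L)) U) :
    ContinuousOn (fun γ => (⟨γ, c γ • f γ⟩ : TotalSpace 𝕜 L)) U :=
  hL.continuous_smul.comp_continuousOn (hc.prodMk hf)

theorem IsLineBundle.smul_mem_CcOn (hL : IsLineBundle 𝕜 L) (c : 𝕜) {f : ∀ γ, L γ} {U : Set G}
    (hf : f ∈ CcOn 𝕜 U) : c • f ∈ CcOn 𝕜 U := by
  obtain ⟨h1, K, hK, hKc, h0⟩ := hf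
  exact ⟨hL.smul_continuousOn continuousOn_const h1, K, hK, hKc,
    fun γ hγ => by simp [h0 γ hγ]⟩

theorem IsLineBundle.zero_mem_CcOn (hL : IsLineBundle 𝕜 L) (U : Set G) :
    (0 : ∀ γ, L γ) ∈ CcOn 𝕜 U :=
  ⟨hL.continuous_zero.continuousOn, ∅, by simp, isCompact_empty, fun _ _ => rfl⟩

theorem CcOn.bddAbove (hL : IsLineBundle 𝕜 L) {f : ∀ γ, L γ} {U : Set G}
    (hf : f ∈ CcOn 𝕜 U) : BddAbove (Set.range fun γ => ‖f γ‖) := by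
  obtain ⟨h1, K, hK, hKc, h0⟩ := hf
  have hcont : ContinuousOn (fun γ => ‖f γ‖) K :=
    (hL.continuous_norm.comp_continuousOn h1).mono hK
  obtain ⟨C, hC⟩ := (hKc.image_of_continuousOn hcont).bddAbove
  refine ⟨max C 0, ?_⟩
  rintro _ ⟨γ, rfl⟩
  by_cases hγ : γ ∈ K
  · exact (hC ⟨γ, hγ, rfl⟩).trans (le_max_left _ _)
  · simp [h0 γ hγ]

theorem CcOn.norm_le (hL : IsLineBundle 𝕜 L) {f : ∀ γ, L γ} {U : Set G}
    (hf : f ∈ CcOn 𝕜 U) (γ : G) : ‖f γ‖ ≤ supNorm f :=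
  le_ciSup (CcOn.bddAbove hL hf) γ

theorem supNorm_nonneg (f : ∀ γ, L γ) : 0 ≤ supNorm f :=
  Real.iSup_nonneg fun _ => norm_nonneg _

theorem supNorm_le {f : ∀ γ, L γ} {C : ℝ} (hC : 0 ≤ C) (h : ∀ γ, ‖f γ‖ ≤ C) : supNorm f ≤ C :=
  Real.iSup_le h hC

theorem supNorm_smul (c : 𝕜) (f : ∀ γ, L γ) : supNorm (c • f) = ‖c‖ * supNorm f := by
  simp only [supNorm, Pi.smul_apply, norm_smul]
  exact (Real.mul_iSup_of_nonneg (norm_nonneg c) _).symm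

theorem CcOn.support_subset {f : ∀ γ, L γ} {U : Set G} (hf : f ∈ CcOn 𝕜 U) {γ : G}
    (hγ : f γ ≠ 0) : γ ∈ U := by
  obtain ⟨-, K, hK, -, h0⟩ := hf
  by_contra h
  exact hγ (h0 γ fun h' => h (hK h'))

end Bundle

/-! ### The convolution algebra -/

section Convolution

variable {𝕜 : Type w} [RCLike 𝕜] {G : Type u} [TopologicalSpace G] {𝒢 : EtaleGroupoid G}
  {L : G → Type v} [∀ γ, NormedAddCommGroup (L γ)] [∀ γ, NormedSpace 𝕜 (L γ)]
  [TopologicalSpace (TotalSpace 𝕜 L)]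

/-- The space `𝔠_c(𝒢, L)` of quasi-continuous compactly supported sections: the linear span of
the spaces `C_c(U, L)` for all bisections `U`. -/
def Cc (_T : Twist 𝕜 L 𝒢) : Submodule 𝕜 (∀ γ, L γ) :=
  Submodule.span 𝕜 {f | ∃ U, 𝒢.IsBisection U ∧ f ∈ CcOn 𝕜 U}

/-- The convolution `(f * g)(γ) = ∑_{r(η) = r(γ)} f(η) g(η⁻¹ γ)`. For `f ∈ 𝔠_c(𝒢, L)` only finitely
many terms are non-zero. -/
def conv (T : Twist 𝕜 L 𝒢) (f g : ∀ γ, L γ) : ∀ γ, L γ := fun γ =>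
  ∑ᶠ η : {η // 𝒢.r η = 𝒢.r γ},
    T.mul (EtaleGroupoid.comp_div η.2) (f η) (g (𝒢.mul (𝒢.inv η) γ))

variable (T : Twist 𝕜 L 𝒢)

theorem CcOn.mem_Cc {f : ∀ γ, L γ} {U : Set G} (hU : 𝒢.IsBisection U) (hf : f ∈ CcOn 𝕜 U) :
    f ∈ Cc T :=
  Submodule.subset_span ⟨U, hU, hf⟩

theorem conv_eq_of_comp {f g : ∀ γ, L γ} {U : Set G} (hU : Set.InjOn 𝒢.r U)
    (hf : ∀ γ, f γ ≠ 0 → γ ∈ U) {η β γ : G} (hη : η ∈ U) (h : 𝒢.Comp η β γ) :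
    conv T f g γ = T.mul h (f η) (g β) := by
  obtain rfl := h.eq_div
  have hr : 𝒢.r η = 𝒢.r γ := h.r_eq.symm
  refine finsum_eq_single _ (⟨η, hr⟩ : {η // 𝒢.r η = 𝒢.r γ}) ?_
  rintro ⟨x, hx⟩ hne
  have : f x = 0 := by
    by_contra h0
    exact hne (Subtype.ext (hU (hf x h0) hη (hx.trans hr.symm)))
  simp [this]

theorem conv_eq_zero {f g : ∀ γ, L γ} {U : Set G}
    (hf : ∀ γ, f γ ≠ 0 → γ ∈ U) {γ : G} (hγ : ∀ η ∈ U, 𝒢.r η ≠ 𝒢.r γ) :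
    conv T f g γ = 0 := by
  refine finsum_eq_zero_of_forall_eq_zero ?_
  rintro ⟨x, hx⟩
  have : f x = 0 := by
    by_contra h0
    exact hγ x (hf x h0) hx
  simp [this]

theorem isClosed_composable : IsClosed {p : G × G | 𝒢.d p.1 = 𝒢.r p.2} := by
  have := 𝒢.t2Space_units
  have h : IsClosed {p : G × G | (⟨𝒢.d p.1, p.1, rfl⟩ : Set.range 𝒢.d) =
      ⟨𝒢.r p.2, 𝒢.r p.2, 𝒢.d_r p.2⟩} :=
    isClosed_eq ((𝒢.continuous_d.comp continuous_fst).subtype_mk _)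
      ((𝒢.continuous_r.comp continuous_snd).subtype_mk _)
  convert h using 1
  ext p
  exact (Subtype.mk_eq_mk (p := (· ∈ Set.range 𝒢.d))).symm

theorem mk_mul_eq {γ η ζ : G} (h : 𝒢.Comp γ η ζ) (z : L γ) (x : L η) :
    (⟨𝒢.mul γ η, T.mul ⟨h.1, rfl⟩ z x⟩ : TotalSpace 𝕜 L) = ⟨ζ, T.mul h z x⟩ := by
  obtain ⟨h1, rfl⟩ := h
  rfl

/-- `C_c(U, L) * C_c(V, L) ⊆ C_c(UV, L)`. -/
theorem conv_mem_CcOn {f g : ∀ γ, L γ} {U V : Set G} (hU : 𝒢.IsBisection U)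
    (hV : 𝒢.IsBisection V) (hf : f ∈ CcOn 𝕜 U) (hg : g ∈ CcOn 𝕜 V) :
    conv T f g ∈ CcOn 𝕜 (𝒢.setMul U V) := by
  have hUr := (EtaleGroupoid.isBisection_iff.1 hU).2.2
  have hfU : ∀ γ, f γ ≠ 0 → γ ∈ U := fun γ => CcOn.support_subset hf
  refine ⟨?_, ?_⟩
  · obtain ⟨-, a, b, ha, hb, hab⟩ := hU.exists_factors hV
    rw [continuousOn_iff_continuous_domRestrict]
    have h1 : Continuous (fun ζ : 𝒢.setMul U V => (⟨a ζ, f (a ζ)⟩ : TotalSpace 𝕜 L)) :=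
      hf.1.comp_continuous (continuousOn_iff_continuous_domRestrict.1 ha)
        fun ζ => (hab ζ ζ.2).1
    have h2 : Continuous (fun ζ : 𝒢.setMul U V => (⟨b ζ, g (b ζ)⟩ : TotalSpace 𝕜 L)) :=
      hg.1.comp_continuous (continuousOn_iff_continuous_domRestrict.1 hb)
        fun ζ => (hab ζ ζ.2).2.1
    refine (T.continuous_mul.comp ((h1.prodMk h2).subtype_mk
      fun ζ => (hab ζ ζ.2).2.2.1)).congr fun ζ => ?_
    obtain ⟨haU, -, h⟩ := hab ζ ζ.2
    refine (mk_mul_eq T h (f (a ζ)) (g (b ζ))).trans ?_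
    rw [← conv_eq_of_comp T hUr hfU haU h]
    rfl
  · obtain ⟨-, K, hKU, hK, hK0⟩ := hf
    obtain ⟨-, K', hKV, hK', hK0'⟩ := hg
    refine ⟨(fun p : G × G => 𝒢.mul p.1 p.2) '' ((K ×ˢ K') ∩ {p | 𝒢.d p.1 = 𝒢.r p.2}), ?_,
      ((hK.prod hK').inter_right isClosed_composable).image_of_continuousOn
        (𝒢.continuousOn_mul.mono Set.inter_subset_right), ?_⟩
    · rintro _ ⟨⟨γ, η⟩, ⟨⟨h1, h2⟩, h3⟩, rfl⟩
      exact ⟨γ, hKU h1, η, hKV h2, h3, rfl⟩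
    · intro γ hγ
      refine finsum_eq_zero_of_forall_eq_zero ?_
      rintro ⟨η, hη⟩
      have hc := EtaleGroupoid.comp_div hη
      by_cases h1 : η ∈ K
      · by_cases h2 : 𝒢.mul (𝒢.inv η) γ ∈ K'
        · exact (hγ ⟨(η, 𝒢.mul (𝒢.inv η) γ), ⟨⟨h1, h2⟩, hc.1⟩, hc.2⟩).elim
        · simp [hK0' _ h2]
      · simp [hK0 _ h1]

theorem supNorm_conv_le {f g : ∀ γ, L γ} {U V : Set G} (hU : 𝒢.IsBisection U)
    (hf : f ∈ CcOn 𝕜 U) (hg : g ∈ CcOn 𝕜 V) :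
    supNorm (conv T f g) ≤ supNorm f * supNorm g := by
  refine supNorm_le (mul_nonneg (supNorm_nonneg f) (supNorm_nonneg g)) fun γ => ?_
  have hfU : ∀ γ, f γ ≠ 0 → γ ∈ U := fun γ => CcOn.support_subset hf
  by_cases h : ∃ η ∈ U, 𝒢.r η = 𝒢.r γ
  · obtain ⟨η, hη, hr⟩ := h
    rw [conv_eq_of_comp T (EtaleGroupoid.isBisection_iff.1 hU).2.2 hfU hη
      (EtaleGroupoid.comp_div hr), T.norm_mul]
    exact mul_le_mul (CcOn.norm_le T.isLineBundle hf _) (CcOn.norm_le T.isLineBundle hg _)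
      (norm_nonneg _) (supNorm_nonneg f)
  · push Not at h
    rw [conv_eq_zero T hfU h, norm_zero]
    exact mul_nonneg (supNorm_nonneg f) (supNorm_nonneg g)

theorem Cc.finite_support {f : ∀ γ, L γ} (hf : f ∈ Cc T) (x : G) :
    {η | 𝒢.r η = x ∧ f η ≠ 0}.Finite := by
  induction hf using Submodule.span_induction with
  | mem f hf =>
    obtain ⟨U, hU, hf⟩ := hf
    refine Set.Subsingleton.finite ?_
    rintro η ⟨h1, h2⟩ η' ⟨h1', h2'⟩
    exact (EtaleGroupoid.isBisection_iff.1 hU).2.2 (CcOn.support_subset hf h2)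
      (CcOn.support_subset hf h2') (h1.trans h1'.symm)
  | zero => simp
  | add f g _ _ h1 h2 =>
    refine (h1.union h2).subset ?_
    rintro η ⟨h, h'⟩
    by_cases h0 : f η = 0
    · exact Or.inr ⟨h, fun h3 => h' (by simp [h0, h3])⟩
    · exact Or.inl ⟨h, h0⟩
  | smul c f _ h1 =>
    refine h1.subset ?_
    rintro η ⟨h, h'⟩
    exact ⟨h, fun h3 => h' (by simp [h3])⟩

theorem Cc.finite_support_conv {f : ∀ γ, L γ} (hf : f ∈ Cc T) (g : ∀ γ, L γ) (γ : G) :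
    Function.HasFiniteSupport (fun η : {η // 𝒢.r η = 𝒢.r γ} =>
      T.mul (EtaleGroupoid.comp_div η.2) (f η) (g (𝒢.mul (𝒢.inv η) γ))) := by
  have h := (Cc.finite_support T hf (𝒢.r γ)).preimage
    (Subtype.val_injective (p := fun η => 𝒢.r η = 𝒢.r γ)).injOn
  refine h.subset ?_
  rintro ⟨η, hη⟩ h0
  refine ⟨hη, fun h1 => h0 ?_⟩
  change f η = 0 at h1
  simp [h1]

theorem conv_add_left {f f' : ∀ γ, L γ} (hf : f ∈ Cc T) (hf' : f' ∈ Cc T) (g : ∀ γ, L γ) :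
    conv T (f + f') g = conv T f g + conv T f' g := by
  funext γ
  simp only [conv, Pi.add_apply, map_add, LinearMap.add_apply]
  exact finsum_add_distrib (Cc.finite_support_conv T hf g γ) (Cc.finite_support_conv T hf' g γ)

theorem conv_add_right {f : ∀ γ, L γ} (hf : f ∈ Cc T) (g g' : ∀ γ, L γ) :
    conv T f (g + g') = conv T f g + conv T f g' := by
  funext γ
  simp only [conv, Pi.add_apply, map_add]
  exact finsum_add_distrib (Cc.finite_support_conv T hf g γ) (Cc.finite_support_conv T hf g' γ)

theorem conv_smul_left (c : 𝕜) (f g : ∀ γ, L γ) :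
    conv T (c • f) g = c • conv T f g := by
  funext γ
  simp only [conv, Pi.smul_apply, map_smul, LinearMap.smul_apply]
  exact (smul_finsum c _).symm

theorem conv_smul_right (c : 𝕜) (f g : ∀ γ, L γ) :
    conv T f (c • g) = c • conv T f g := by
  funext γ
  simp only [conv, Pi.smul_apply, map_smul]
  exact (smul_finsum c _).symm

theorem conv_zero_left (g : ∀ γ, L γ) : conv T 0 g = 0 := by
  simpa using conv_smul_left T 0 0 g

theorem conv_zero_right (f : ∀ γ, L γ) : conv T f 0 = 0 := by
  simpa using conv_smul_right T 0 f 0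

theorem conv_mem_Cc {f g : ∀ γ, L γ} (hf : f ∈ Cc T) (hg : g ∈ Cc T) : conv T f g ∈ Cc T := by
  induction hf using Submodule.span_induction with
  | mem f hf =>
    obtain ⟨U, hU, hf⟩ := hf
    have hf' := CcOn.mem_Cc T hU hf
    induction hg using Submodule.span_induction with
    | mem g hg =>
      obtain ⟨V, hV, hg⟩ := hg
      exact CcOn.mem_Cc T (hU.setMul hV) (conv_mem_CcOn T hU hV hf hg)
    | zero => rw [conv_zero_right]; exact zero_mem _
    | add g g' _ _ h1 h2 => rw [conv_add_right T hf']; exact add_mem h1 h2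
    | smul c g _ h => rw [conv_smul_right]; exact Submodule.smul_mem _ _ h
  | zero => rw [conv_zero_left]; exact zero_mem _
  | add f f' hf hf' h1 h2 => rw [conv_add_left T hf hf']; exact add_mem h1 h2
  | smul c f _ h => rw [conv_smul_left]; exact Submodule.smul_mem _ _ h

theorem conv_assoc {f g : ∀ γ, L γ} (hf : f ∈ Cc T) (hg : g ∈ Cc T) (k : ∀ γ, L γ) :
    conv T (conv T f g) k = conv T f (conv T g k) := by
  induction hf using Submodule.span_induction with
  | mem f hf =>
    obtain ⟨U, hU, hf⟩ := hf
    have hf' := CcOn.mem_Cc T hU hf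
    induction hg using Submodule.span_induction with
    | mem g hg =>
      obtain ⟨V, hV, hg⟩ := hg
      have hUr := (EtaleGroupoid.isBisection_iff.1 hU).2.2
      have hVr := (EtaleGroupoid.isBisection_iff.1 hV).2.2
      have hWr := (EtaleGroupoid.isBisection_iff.1 (hU.setMul hV)).2.2
      have hfU : ∀ γ, f γ ≠ 0 → γ ∈ U := fun γ => CcOn.support_subset hf
      have hgV : ∀ γ, g γ ≠ 0 → γ ∈ V := fun γ => CcOn.support_subset hg
      have hfg : ∀ γ, conv T f g γ ≠ 0 → γ ∈ 𝒢.setMul U V :=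
        fun γ => CcOn.support_subset (conv_mem_CcOn T hU hV hf hg)
      funext γ
      by_cases h : ∃ η ∈ U, 𝒢.r η = 𝒢.r γ
      · obtain ⟨η, hη, hr⟩ := h
        have hc := EtaleGroupoid.comp_div hr
        rw [conv_eq_of_comp T hUr hfU hη hc]
        by_cases h' : ∃ β ∈ V, 𝒢.r β = 𝒢.r (𝒢.mul (𝒢.inv η) γ)
        · obtain ⟨β, hβ, hrβ⟩ := h'
          have hc' := EtaleGroupoid.comp_div hrβ
          have hηβ : 𝒢.Comp η β (𝒢.mul η β) := ⟨by rw [hc.1, hrβ], rfl⟩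
          have hmem : 𝒢.mul η β ∈ 𝒢.setMul U V := ⟨η, hη, β, hβ, hηβ⟩
          have hlast : 𝒢.Comp (𝒢.mul η β) (𝒢.mul (𝒢.inv β) (𝒢.mul (𝒢.inv η) γ)) γ := by
            refine ⟨by rw [hηβ.d_eq, hc'.1], ?_⟩
            rw [𝒢.mul_assoc _ _ _ hηβ.1 hc'.1, hc'.2, hc.2]
          rw [conv_eq_of_comp T hVr hgV hβ hc', conv_eq_of_comp T hWr hfg hmem hlast,
            conv_eq_of_comp T hUr hfU hη hηβ]
          exact T.mul_assoc hηβ hlast hc' hc _ _ _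
        · push Not at h'
          rw [conv_eq_zero T hgV h', map_zero]
          refine conv_eq_zero T hfg ?_
          rintro ω ⟨η', hη', β, hβ, hω⟩ hr'
          have : η' = η := hUr hη' hη (by rw [← hω.r_eq, hr', hr])
          subst this
          exact h' β hβ (by rw [← hω.1, hc.1])
      · push Not at h
        rw [conv_eq_zero T hfU h]
        refine conv_eq_zero T hfg ?_
        rintro ω ⟨η', hη', β, hβ, hω⟩ hr'
        exact h η' hη' (by rw [← hω.r_eq, hr'])
    | zero => simp only [conv_zero_right, conv_zero_left]
    | add g g' hg hg' h1 h2 =>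
      rw [conv_add_right T hf', conv_add_left T (conv_mem_Cc T hf' hg) (conv_mem_Cc T hf' hg'),
        h1, h2, conv_add_left T hg hg', conv_add_right T hf']
    | smul c g _ h =>
      rw [conv_smul_right, conv_smul_left, h, conv_smul_left, conv_smul_right]
  | zero => simp only [conv_zero_left]
  | add f f' hf hf' h1 h2 =>
    rw [conv_add_left T hf hf', conv_add_left T (conv_mem_Cc T hf hg) (conv_mem_Cc T hf' hg),
      h1, h2, conv_add_left T hf hf']
  | smul c f _ h => rw [conv_smul_left, conv_smul_left, conv_smul_left, h]

end Convolution

/-! ### The norms and the Banach algebra `F^S(𝒢, L)` -/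

section Norms

variable {𝕜 : Type w} [RCLike 𝕜] {G : Type u} [TopologicalSpace G] {𝒢 : EtaleGroupoid G}
  {L : G → Type v} [∀ γ, NormedAddCommGroup (L γ)] [∀ γ, NormedSpace 𝕜 (L γ)]
  [TopologicalSpace (TotalSpace 𝕜 L)]

/-- `‖f‖_{d*} = sup_{x ∈ X} ∑_{d(γ) = x} |f(γ)|`. -/
def dNorm (𝒢 : EtaleGroupoid G) (f : ∀ γ, L γ) : ℝ :=
  ⨆ x : 𝒢.units, ∑' γ : {γ // 𝒢.d γ = x}, ‖f γ‖

/-- `‖f‖_{r*} = sup_{x ∈ X} ∑_{r(γ) = x} |f(γ)|`. -/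
def rNorm (𝒢 : EtaleGroupoid G) (f : ∀ γ, L γ) : ℝ :=
  ⨆ x : 𝒢.units, ∑' γ : {γ // 𝒢.r γ = x}, ‖f γ‖

/-- Hahn's `I`-norm. -/
def INorm (𝒢 : EtaleGroupoid G) (f : ∀ γ, L γ) : ℝ := max (dNorm 𝒢 f) (rNorm 𝒢 f)

/-- The norm `‖f‖_max^S`: the infimum of `∑ₖ ‖fₖ‖_∞` over all finite decompositions `f = ∑ₖ fₖ`
with `fₖ ∈ C_c(Uₖ, L)` and `Uₖ ∈ S`. -/
def maxNorm (𝕜 : Type w) [TopologicalSpace (TotalSpace 𝕜 L)]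
    (S : 𝒢.CoveringSemigroup) (f : ∀ γ, L γ) : ℝ :=
  sInf {t | ∃ (n : ℕ) (F : Fin n → ∀ γ, L γ), (∀ k, ∃ U ∈ S.carrier, F k ∈ CcOn 𝕜 U) ∧
    f = ∑ k, F k ∧ t = ∑ k, supNorm (F k)}

variable (T : Twist 𝕜 L 𝒢) (S : 𝒢.CoveringSemigroup)

theorem maxNorm_nonneg (f : ∀ γ, L γ) : 0 ≤ maxNorm 𝕜 S f := by
  refine Real.sInf_nonneg ?_
  rintro _ ⟨n, F, -, -, rfl⟩
  exact Finset.sum_nonneg fun k _ => supNorm_nonneg _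

theorem maxNorm_le {ι : Type*} [Fintype ι] (F : ι → ∀ γ, L γ)
    (hF : ∀ k, ∃ U ∈ S.carrier, F k ∈ CcOn 𝕜 U) :
    maxNorm 𝕜 S (∑ k, F k) ≤ ∑ k, supNorm (F k) := by
  refine csInf_le ⟨0, ?_⟩ ⟨Fintype.card ι, fun k => F ((Fintype.equivFin ι).symm k),
    fun k => hF _, ?_, ?_⟩
  · rintro _ ⟨n, F, -, -, rfl⟩
    exact Finset.sum_nonneg fun k _ => supNorm_nonneg _
  · exact ((Fintype.equivFin ι).symm.sum_comp F).symm
  · exact ((Fintype.equivFin ι).symm.sum_comp fun i => supNorm (F i)).symm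

/-- A section that vanishes off a compact set `K ⊆ U ∩ V` and is continuous on `U` belongs to
`C_c(V, L)`. -/
theorem mem_CcOn_of_inter {f : ∀ γ, L γ} {U V K : Set G} (hU : IsOpen U)
    (hV : 𝒢.IsBisection V) (hK : IsCompact K) (hKU : K ⊆ U) (hKV : K ⊆ V)
    (hf : ContinuousOn (fun γ => (⟨γ, f γ⟩ : TotalSpace 𝕜 L)) U)
    (h0 : ∀ γ, γ ∉ K → f γ = 0) (hL : IsLineBundle 𝕜 L) : f ∈ CcOn 𝕜 V := by
  refine ⟨?_, K, hKV, hK, h0⟩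
  intro γ hγ
  by_cases hγU : γ ∈ U
  · exact (hf.continuousAt (hU.mem_nhds hγU)).continuousWithinAt
  · have := hV.t2Space
    have hK' : IsCompact ((Subtype.val : V → G) ⁻¹' K) :=
      (IsInducing.subtypeVal.isCompact_preimage_iff (by simpa using hKV)).2 hK
    have hopen : IsOpen ((Subtype.val : V → G) '' ((Subtype.val : V → G) ⁻¹' K)ᶜ) :=
      hV.1.isOpenMap_subtype_val _ hK'.isClosed.isOpen_compl
    have hmem : γ ∈ ((Subtype.val : V → G) '' ((Subtype.val : V → G) ⁻¹' K)ᶜ) :=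
      ⟨⟨γ, hγ⟩, fun h => hγU (hKU h), rfl⟩
    refine ContinuousAt.continuousWithinAt ?_
    refine hL.continuous_zero.continuousAt.congr ?_
    filter_upwards [hopen.mem_nhds hmem]
    rintro _ ⟨x, hx, rfl⟩
    rw [h0 x hx]

theorem exists_decomposition_CcOn (hL : IsLineBundle 𝕜 L) {f : ∀ γ, L γ} {U : Set G}
    (hU : 𝒢.IsBisection U) (hf : f ∈ CcOn 𝕜 U) :
    ∃ (n : ℕ) (F : Fin n → ∀ γ, L γ), (∀ k, ∃ V ∈ S.carrier, F k ∈ CcOn 𝕜 V) ∧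
      f = ∑ k, F k := by
  classical
  obtain ⟨hfc, K, hKU, hK, h0⟩ := hf
  choose V hVS hV using S.covers
  obtain ⟨t, ht⟩ := hK.elim_finite_subcover V (fun γ => (S.isBisection _ (hVS γ)).1)
    (fun γ _ => Set.mem_iUnion.2 ⟨γ, hV γ⟩)
  have := hU.t2Space
  have := hU.locallyCompactSpace
  have hK' : IsCompact ((Subtype.val : U → G) ⁻¹' K) :=
    (IsInducing.subtypeVal.isCompact_preimage_iff (by simpa using hKU)).2 hK
  let e := t.equivFin
  let W : Fin t.card → Set G := fun k => V (e.symm k)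
  obtain ⟨φ, hφ1, hφ2, -, hφ4⟩ := exists_continuous_sum_one_of_isOpen_isCompact
    (s := fun k => (Subtype.val : U → G) ⁻¹' W k)
    (fun k => (S.isBisection _ (hVS _)).1.preimage continuous_subtype_val) hK' (by
      rintro x hx
      obtain ⟨i, hi⟩ := Set.mem_iUnion.1 (ht hx)
      obtain ⟨hit, hi⟩ := Set.mem_iUnion.1 hi
      exact Set.mem_iUnion.2 ⟨e ⟨i, hit⟩, by simpa [W] using hi⟩)
  let c : Fin t.card → G → 𝕜 := fun k γ => if h : γ ∈ U then ((φ k ⟨γ, h⟩ : ℝ) : 𝕜) else 0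
  refine ⟨t.card, fun k γ => c k γ • f γ, fun k => ⟨W k, hVS _, ?_⟩, ?_⟩
  · refine mem_CcOn_of_inter hU.1 (S.isBisection _ (hVS _))
      ((hφ4 k).isCompact.image continuous_subtype_val) ?_ ?_ ?_ ?_ hL
    · rintro _ ⟨x, -, rfl⟩
      exact x.2
    · rintro _ ⟨x, hx, rfl⟩
      exact hφ1 k hx
    · refine hL.smul_continuousOn ?_ hfc
      rw [continuousOn_iff_continuous_domRestrict]
      have : U.domRestrict (c k) = fun x => ((φ k x : ℝ) : 𝕜) := by
        funext x
        simp [c, Set.domRestrict]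
      rw [this]
      exact RCLike.continuous_ofReal.comp (φ k).continuous
    · intro γ hγ
      by_cases h : γ ∈ U
      · have : φ k ⟨γ, h⟩ = 0 := by
          by_contra h1
          exact hγ ⟨⟨γ, h⟩, subset_tsupport _ h1, rfl⟩
        simp [c, h, this]
      · simp [c, h]
  · funext γ
    rw [Finset.sum_apply]
    by_cases hγ : γ ∈ K
    · have h1 := hφ2 (x := ⟨γ, hKU hγ⟩) hγ
      have h2 : ∑ k, c k γ = 1 := by
        simp only [Finset.sum_apply, Pi.one_apply] at h1
        simp only [c, hKU hγ, dif_pos]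
        exact_mod_cast h1
      rw [← Finset.sum_smul, h2, one_smul]
    · simp [h0 γ hγ]

theorem exists_decomposition {f : ∀ γ, L γ} (hf : f ∈ Cc T) :
    ∃ (n : ℕ) (F : Fin n → ∀ γ, L γ), (∀ k, ∃ V ∈ S.carrier, F k ∈ CcOn 𝕜 V) ∧
      f = ∑ k, F k := by
  induction hf using Submodule.span_induction with
  | mem f hf =>
    obtain ⟨U, hU, hf⟩ := hf
    exact exists_decomposition_CcOn S T.isLineBundle hU hf
  | zero => exact ⟨0, fun _ => 0, fun k => k.elim0, by simp⟩
  | add f g _ _ h1 h2 =>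
    obtain ⟨n, F, hF, rfl⟩ := h1
    obtain ⟨m, F', hF', rfl⟩ := h2
    refine ⟨n + m, Fin.append F F', fun k => ?_, ?_⟩
    · refine Fin.addCases (fun i => ?_) (fun i => ?_) k
      · simpa using hF i
      · simpa using hF' i
    · simp [Fin.sum_univ_add]
  | smul c f _ h =>
    obtain ⟨n, F, hF, rfl⟩ := h
    refine ⟨n, fun k => c • F k, fun k => ?_, Finset.smul_sum⟩
    obtain ⟨V, hV, h⟩ := hF k
    exact ⟨V, hV, T.isLineBundle.smul_mem_CcOn c h⟩

theorem exists_decomposition_lt {f : ∀ γ, L γ} (hf : f ∈ Cc T) {a : ℝ}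
    (ha : maxNorm 𝕜 S f < a) :
    ∃ (n : ℕ) (F : Fin n → ∀ γ, L γ), (∀ k, ∃ V ∈ S.carrier, F k ∈ CcOn 𝕜 V) ∧
      f = ∑ k, F k ∧ ∑ k, supNorm (F k) < a := by
  obtain ⟨n, F, hF, h⟩ := exists_decomposition T S hf
  rw [maxNorm] at ha
  obtain ⟨_, ⟨n, F, hF, h, rfl⟩, hlt⟩ := exists_lt_of_csInf_lt
    (by exact ⟨_, n, F, hF, h, rfl⟩) ha
  exact ⟨n, F, hF, h, hlt⟩

theorem maxNorm_add_le {f g : ∀ γ, L γ} (hf : f ∈ Cc T) (hg : g ∈ Cc T) :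
    maxNorm 𝕜 S (f + g) ≤ maxNorm 𝕜 S f + maxNorm 𝕜 S g := by
  refine le_of_forall_pos_lt_add fun ε hε => ?_
  obtain ⟨n, F, hF, h, hlt⟩ :=
    exists_decomposition_lt T S hf (lt_add_of_pos_right (maxNorm 𝕜 S f) (half_pos hε))
  obtain ⟨m, F', hF', h', hlt'⟩ :=
    exists_decomposition_lt T S hg (lt_add_of_pos_right (maxNorm 𝕜 S g) (half_pos hε))
  have hle := maxNorm_le (𝕜 := 𝕜) S (Sum.elim F F')
    (by rintro (k | k) <;> simp [hF, hF'])
  simp only [Fintype.sum_sum_type, Sum.elim_inl, Sum.elim_inr, ← h, ← h'] at hle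
  linarith

theorem maxNorm_smul_le (c : 𝕜) {f : ∀ γ, L γ} (hf : f ∈ Cc T) :
    maxNorm 𝕜 S (c • f) ≤ ‖c‖ * maxNorm 𝕜 S f := by
  have key : ∀ ε > 0, maxNorm 𝕜 S (c • f) ≤ ‖c‖ * (maxNorm 𝕜 S f + ε) := by
    intro ε hε
    obtain ⟨n, F, hF, h, hlt⟩ :=
      exists_decomposition_lt T S hf (lt_add_of_pos_right (maxNorm 𝕜 S f) hε)
    have hle := maxNorm_le (𝕜 := 𝕜) S (fun k => c • F k) (fun k => by
      obtain ⟨V, hV, h⟩ := hF k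
      exact ⟨V, hV, T.isLineBundle.smul_mem_CcOn c h⟩)
    rw [← Finset.smul_sum, ← h] at hle
    refine hle.trans ?_
    simp only [supNorm_smul, ← Finset.mul_sum]
    exact mul_le_mul_of_nonneg_left hlt.le (norm_nonneg c)
  have ht : Filter.Tendsto (fun ε : ℝ => ‖c‖ * (maxNorm 𝕜 S f + ε)) (𝓝[>] 0)
      (𝓝 (‖c‖ * (maxNorm 𝕜 S f + 0))) :=
    ((continuous_const.mul (continuous_const.add continuous_id)).tendsto 0).mono_left
      nhdsWithin_le_nhds
  rw [add_zero] at ht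
  exact ge_of_tendsto ht (eventually_nhdsWithin_of_forall fun ε hε => key ε hε)

theorem maxNorm_smul (c : 𝕜) {f : ∀ γ, L γ} (hf : f ∈ Cc T) :
    maxNorm 𝕜 S (c • f) = ‖c‖ * maxNorm 𝕜 S f := by
  refine le_antisymm (maxNorm_smul_le T S c hf) ?_
  by_cases hc : c = 0
  · simp [hc, maxNorm_nonneg]
  · have h := maxNorm_smul_le T S c⁻¹ ((Cc T).smul_mem c hf)
    rw [smul_smul, inv_mul_cancel₀ hc, one_smul, norm_inv] at h
    rwa [inv_mul_eq_div, le_div_iff₀ (norm_pos_iff.2 hc), mul_comm] at h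

theorem conv_sum_sum {m n : ℕ} (F : Fin n → ∀ γ, L γ) (F' : Fin m → ∀ γ, L γ)
    (hF : ∀ k, F k ∈ Cc T) :
    conv T (∑ k, F k) (∑ l, F' l) = ∑ p : Fin n × Fin m, conv T (F p.1) (F' p.2) := by
  have h1 : ∀ (s : Finset (Fin n)) (g : ∀ γ, L γ),
      conv T (∑ k ∈ s, F k) g = ∑ k ∈ s, conv T (F k) g := by
    intro s g
    induction s using Finset.cons_induction with
    | empty => simp [conv_zero_left]
    | cons a s ha ih =>
      rw [Finset.sum_cons, Finset.sum_cons,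
        conv_add_left T (hF a) (sum_mem fun k _ => hF k), ih]
  have h2 : ∀ (s : Finset (Fin m)) (k : Fin n),
      conv T (F k) (∑ l ∈ s, F' l) = ∑ l ∈ s, conv T (F k) (F' l) := by
    intro s k
    induction s using Finset.cons_induction with
    | empty => simp [conv_zero_right]
    | cons a s ha ih => rw [Finset.sum_cons, Finset.sum_cons, conv_add_right T (hF k), ih]
  rw [h1, Fintype.sum_prod_type]
  exact Finset.sum_congr rfl fun k _ => h2 _ k

theorem maxNorm_conv_le {f g : ∀ γ, L γ} (hf : f ∈ Cc T) (hg : g ∈ Cc T) :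
    maxNorm 𝕜 S (conv T f g) ≤ maxNorm 𝕜 S f * maxNorm 𝕜 S g := by
  have key : ∀ ε > 0, maxNorm 𝕜 S (conv T f g) ≤
      (maxNorm 𝕜 S f + ε) * (maxNorm 𝕜 S g + ε) := by
    intro ε hε
    obtain ⟨n, F, hF, h, hlt⟩ :=
      exists_decomposition_lt T S hf (lt_add_of_pos_right (maxNorm 𝕜 S f) hε)
    obtain ⟨m, F', hF', h', hlt'⟩ :=
      exists_decomposition_lt T S hg (lt_add_of_pos_right (maxNorm 𝕜 S g) hε)
    choose U hU hFU using hF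
    choose V hV hFV using hF'
    have hle := maxNorm_le (𝕜 := 𝕜) S (fun p : Fin n × Fin m => conv T (F p.1) (F' p.2))
      (fun p => ⟨_, S.mul_mem _ (hU p.1) _ (hV p.2), conv_mem_CcOn T (S.isBisection _ (hU _))
        (S.isBisection _ (hV _)) (hFU _) (hFV _)⟩)
    rw [← conv_sum_sum T F F' (fun k => CcOn.mem_Cc T (S.isBisection _ (hU k)) (hFU k)), ← h,
      ← h'] at hle
    calc maxNorm 𝕜 S (conv T f g)
        ≤ ∑ p : Fin n × Fin m, supNorm (conv T (F p.1) (F' p.2)) := hle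
      _ ≤ ∑ p : Fin n × Fin m, supNorm (F p.1) * supNorm (F' p.2) :=
          Finset.sum_le_sum fun p _ =>
            supNorm_conv_le T (S.isBisection _ (hU _)) (hFU _) (hFV _)
      _ = (∑ k, supNorm (F k)) * ∑ l, supNorm (F' l) := by
          rw [Fintype.sum_prod_type, Finset.sum_mul_sum]
      _ ≤ (maxNorm 𝕜 S f + ε) * (maxNorm 𝕜 S g + ε) :=
          mul_le_mul hlt.le hlt'.le (Finset.sum_nonneg fun l _ => supNorm_nonneg _)
            (add_nonneg (maxNorm_nonneg S f) hε.le)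
  have ht : Filter.Tendsto (fun ε : ℝ => (maxNorm 𝕜 S f + ε) * (maxNorm 𝕜 S g + ε)) (𝓝[>] 0)
      (𝓝 ((maxNorm 𝕜 S f + 0) * (maxNorm 𝕜 S g + 0))) :=
    (((continuous_const.add continuous_id).mul
      (continuous_const.add continuous_id)).tendsto 0).mono_left nhdsWithin_le_nhds
  rw [add_zero, add_zero] at ht
  exact ge_of_tendsto ht (eventually_nhdsWithin_of_forall fun ε hε => key ε hε)

/-- The convolution algebra `𝔠_c(𝒢, L)`, to be equipped with the norm `‖·‖_max^S`. -/
def CcAlg (T : Twist 𝕜 L 𝒢) (_S : 𝒢.CoveringSemigroup) : Type (max u v) := Cc T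

instance : AddCommGroup (CcAlg T S) := inferInstanceAs (AddCommGroup (Cc T))

instance : Module 𝕜 (CcAlg T S) := inferInstanceAs (Module 𝕜 (Cc T))

instance : Norm (CcAlg T S) := ⟨fun f => maxNorm 𝕜 S f.1⟩

theorem CcAlg.core : SeminormedSpace.Core 𝕜 (CcAlg T S) where
  norm_nonneg f := maxNorm_nonneg S f.1
  norm_smul c f := maxNorm_smul T S c f.2
  norm_triangle f g := maxNorm_add_le T S f.2 g.2

instance : NonUnitalSeminormedRing (CcAlg T S) where
  __ := SeminormedAddCommGroup.ofCore (CcAlg.core T S)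
  mul f g := ⟨conv T f.1 g.1, conv_mem_Cc T f.2 g.2⟩
  left_distrib f g k := Subtype.ext (conv_add_right T f.2 g.1 k.1)
  right_distrib f g k := Subtype.ext (conv_add_left T f.2 g.2 k.1)
  zero_mul f := Subtype.ext (conv_zero_left T f.1)
  mul_zero f := Subtype.ext (conv_zero_right T f.1)
  mul_assoc f g k := Subtype.ext (conv_assoc T f.2 g.2 k.1)
  norm_mul_le f g := maxNorm_conv_le T S f.2 g.2

instance : NormedSpace 𝕜 (CcAlg T S) where
  norm_smul_le c f := (maxNorm_smul T S c f.2).le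

/-- The Banach algebra `F^S(𝒢, L)`: the completion of `𝔠_c(𝒢, L)` in the norm `‖·‖_max^S`. -/
def FAlg (T : Twist 𝕜 L 𝒢) (S : 𝒢.CoveringSemigroup) : Type (max u v) := Completion (CcAlg T S)

instance : NormedAddCommGroup (FAlg T S) := inferInstanceAs (NormedAddCommGroup (Completion _))

instance : NormedSpace 𝕜 (FAlg T S) := inferInstanceAs (NormedSpace 𝕜 (Completion (CcAlg T S)))

instance : CompleteSpace (FAlg T S) := inferInstanceAs (CompleteSpace (Completion _))

/-- The product of `F^S(𝒢, L)` is the continuous extension of the convolution. -/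
instance : Mul (FAlg T S) :=
  ⟨Function.curry <| (Completion.isDenseInducing_coe.prodMap
    Completion.isDenseInducing_coe).extend
    ((fun a : CcAlg T S => (a : Completion (CcAlg T S))) ∘ Function.uncurry (· * ·))⟩

/-- The canonical map of the convolution algebra into its completion. -/
def CcAlg.toFAlg (a : CcAlg T S) : FAlg T S := (a : Completion (CcAlg T S))

theorem CcAlg.toFAlg_mul (a b : CcAlg T S) : (a * b).toFAlg = a.toFAlg * b.toFAlg :=
  ((Completion.isDenseInducing_coe.prodMap Completion.isDenseInducing_coe).extend_eq
    ((Completion.continuous_coe (CcAlg T S)).comp continuous_mul) (a, b)).symm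

theorem CcAlg.toFAlg_add (a b : CcAlg T S) : (a + b).toFAlg = a.toFAlg + b.toFAlg :=
  Completion.coe_add a b

theorem CcAlg.toFAlg_smul (c : 𝕜) (a : CcAlg T S) : (c • a).toFAlg = c • a.toFAlg :=
  Completion.coe_smul c a

theorem CcAlg.norm_toFAlg (a : CcAlg T S) : ‖a.toFAlg‖ = ‖a‖ := Completion.norm_coe a

theorem CcAlg.denseRange_toFAlg : DenseRange (CcAlg.toFAlg T S) :=
  Completion.denseRange_coe

theorem CcAlg.continuous_toFAlg : Continuous (CcAlg.toFAlg T S) :=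
  Completion.continuous_coe _

instance : ContinuousMul (FAlg T S) where
  continuous_mul := by
    let m := (AddMonoidHom.mul : CcAlg T S →+ CcAlg T S →+ CcAlg T S).compr₂ Completion.toCompl
    have h : Continuous fun p : CcAlg T S × CcAlg T S => m p.1 p.2 :=
      (Completion.continuous_coe (CcAlg T S)).comp continuous_mul
    have di : IsDenseInducing (Completion.toCompl : CcAlg T S → Completion (CcAlg T S)) :=
      Completion.isDenseInducing_coe
    exact (di.extend_Z_bilin di h :)

instance : NonUnitalNormedRing (FAlg T S) where
  __ := (inferInstance : NormedAddCommGroup (FAlg T S))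
  __ := (inferInstance : Mul (FAlg T S))
  zero_mul a := by
    refine (CcAlg.denseRange_toFAlg T S).induction_on a
      (isClosed_eq (by fun_prop) continuous_const) fun a => ?_
    have h := CcAlg.toFAlg_mul T S 0 a
    rw [zero_mul] at h
    exact h.symm
  mul_zero a := by
    refine (CcAlg.denseRange_toFAlg T S).induction_on a
      (isClosed_eq (by fun_prop) continuous_const) fun a => ?_
    have h := CcAlg.toFAlg_mul T S a 0
    rw [mul_zero] at h
    exact h.symm
  mul_assoc a b c := by
    refine (CcAlg.denseRange_toFAlg T S).induction_on₃
      (p := fun a b c => a * b * c = a * (b * c))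
      (isClosed_eq (by fun_prop) (by fun_prop)) (fun a b c => ?_) a b c
    simp only [← CcAlg.toFAlg_mul, mul_assoc]
  left_distrib a b c := by
    refine (CcAlg.denseRange_toFAlg T S).induction_on₃
      (p := fun a b c => a * (b + c) = a * b + a * c)
      (isClosed_eq (by fun_prop) (by fun_prop)) (fun a b c => ?_) a b c
    simp only [← CcAlg.toFAlg_mul, ← CcAlg.toFAlg_add, mul_add]
  right_distrib a b c := by
    refine (CcAlg.denseRange_toFAlg T S).induction_on₃
      (p := fun a b c => (a + b) * c = a * c + b * c)
      (isClosed_eq (by fun_prop) (by fun_prop)) (fun a b c => ?_) a b c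
    simp only [← CcAlg.toFAlg_mul, ← CcAlg.toFAlg_add, add_mul]
  norm_mul_le a b := by
    refine (CcAlg.denseRange_toFAlg T S).induction_on₂
      (p := fun a b => ‖a * b‖ ≤ ‖a‖ * ‖b‖)
      (isClosed_le (by fun_prop) (by fun_prop)) (fun a b => ?_) a b
    rw [← CcAlg.toFAlg_mul, CcAlg.norm_toFAlg, CcAlg.norm_toFAlg, CcAlg.norm_toFAlg]
    exact norm_mul_le a b

/-- The canonical map of `𝔠_c(𝒢, L)` into `F^S(𝒢, L)`. -/
def toF (f : Cc T) : FAlg T S := CcAlg.toFAlg T S f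

end Norms

/-! ### Representations -/

section Representations

variable {𝕜 : Type w} [RCLike 𝕜] {G : Type u} [TopologicalSpace G] {𝒢 : EtaleGroupoid G}
  {L : G → Type v} [∀ γ, NormedAddCommGroup (L γ)] [∀ γ, NormedSpace 𝕜 (L γ)]
  [TopologicalSpace (TotalSpace 𝕜 L)]

/-- A representation of `F^S(𝒢, L)` on the Banach space `E`: a contractive algebra homomorphism
`F^S(𝒢, L) → B(E)`. -/
structure BanachRep (T : Twist 𝕜 L 𝒢) (S : 𝒢.CoveringSemigroup) (E : Type*)
    [NormedAddCommGroup E] [NormedSpace 𝕜 E] extends FAlg T S →ₙₐ[𝕜] (E →L[𝕜] E) where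
  contractive : ∀ a, ‖toFun a‖ ≤ ‖a‖

namespace BanachRep

variable {T : Twist 𝕜 L 𝒢} {S : 𝒢.CoveringSemigroup} {E : Type*} [NormedAddCommGroup E]
  [NormedSpace 𝕜 E]

/-- The operator `ψ(f)` for a section `f ∈ 𝔠_c(𝒢, L)`. -/
def onCc (ψ : BanachRep T S E) (f : Cc T) : E →L[𝕜] E := ψ.toNonUnitalAlgHom (toF T S f)

/-- `ψ` restricts to a representation of `C_0(X)`: on the sections in `C_c(X, L) = C_c(X)` it is
contractive for the supremum norm. This is automatic if `X ∈ S`. -/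
def ContractiveOnUnits (ψ : BanachRep T S E) : Prop :=
  ∀ f : Cc T, f.1 ∈ CcOn 𝕜 𝒢.units → ‖ψ.onCc f‖ ≤ supNorm f.1

/-- Every operator in the image of `C_c(X, L) = C_c(X)` satisfies `P`. -/
def UnitsSatisfy (ψ : BanachRep T S E) (P : (E →L[𝕜] E) → Prop) : Prop :=
  ∀ f : Cc T, f.1 ∈ CcOn 𝕜 𝒢.units → P (ψ.onCc f)

end BanachRep

/-- `A` is the operator of multiplication by a function in `L^∞(μ)`. -/
def IsLpMultiplication {Ω : Type*} [MeasurableSpace Ω] {μ : Measure Ω} {p : ℝ≥0∞}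
    [Fact (1 ≤ p)] (A : Lp 𝕜 p μ →L[𝕜] Lp 𝕜 p μ) : Prop :=
  ∃ h : Lp 𝕜 ∞ μ, ∀ ξ : Lp 𝕜 p μ, A ξ =ᵐ[μ] fun x => h x * ξ x

/-- `A` is the operator of multiplication by a bounded continuous function. -/
def IsC0Multiplication {Ω : Type*} [TopologicalSpace Ω]
    (A : C₀(Ω, 𝕜) →L[𝕜] C₀(Ω, 𝕜)) : Prop :=
  ∃ h : Ω →ᵇ 𝕜, ∀ (ξ : C₀(Ω, 𝕜)) (x : Ω), A ξ x = h x * ξ x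

/-- The scalar field `𝕜`, which is `ℝ` or `ℂ`, is `ℂ`. -/
def IsComplexField (𝕜 : Type*) [RCLike 𝕜] : Prop := (RCLike.I : 𝕜) ≠ 0

end Representations

end TwistedGroupoid

end

open TwistedGroupoid

set_option linter.unusedSectionVars false

noncomputable section

namespace TwistedGroupoid

open scoped CompactlySupported

/-! ### Test functions and the measure dominating a vector-valued functional -/

/-! Write `ρ(a)` for the operator of a function `a` on the unit space `X`. Fix a vector `ξ` and a
functional `φ`. For `1 < p < ∞` the pair is replaced by two finite regular measures on `X`: `m` with
`‖ρ(a)ξ‖^p ≤ m(supp a)` and `m(X) ≤ ‖ξ‖^p`, and `n` with `‖φ ∘ ρ(b)‖^q ≤ n(supp b)` and `n(X) ≤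
‖φ‖^q`, for test functions `a`, `b` with values in `[0, 1]` and support in the domain of a member of
`S`.

Let `g` be a section over a member of `S`, bounded by `c` and vanishing off a compact set `K`. Local
units around `d(K)` and `r(K)` give `ψ(g) = ρ(b) ψ(g) ρ(a)`, so contractivity, Young's inequality
and regularity yield `|φ(ψ(g)ξ)| ≤ c (m(d(K))/p + n(r(K))/q)`. Slicing `g` along the levels of `|g|`
turns this into a bound by integrals of fibre sums, and separating finitely many bisections at small
cost extends it to all `f`: `|φ(ψ(f)ξ)| ≤ ‖f‖_{d*} m(X)/p + ‖f‖_{r*} n(X)/q`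
(`IsSupportBounded.enorm_le`). Passing to `(tξ, t⁻¹φ)` and optimizing over `t` gives the product of
powers. For `p = 1` only `m` is needed, for `L^∞` and `C₀` only `n`.

The measures come from a content (`HasDisjointBound.exists_measure`). The mass of an open set is the
supremum of sums of `s`-th powers over disjoint families of test functions inside it.
Superadditivity is clear; subadditivity holds because a family can be cut along one of many disjoint
layers, one of which must be thin.

The hypotheses on `ψ` enter only through `ℓ^p`-type estimates for disjoint test functions. For `p =
2`, contractions with suitable local units have orthogonal ranges. Multiplication operators have
ranges with disjoint supports. In the complex contractive case all `ρ(v) + zρ(w)` with `|z| = 1` and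
`v`, `w` disjoint are contractions; for finite `p ≠ 2` a second-order variation then forces disjoint
supports (`ae_eq_zero_or_eq_zero_of_rotations`), and for the supremum norm an averaging argument
gives the `ℓ^∞`-estimate directly (`norm_add_le_of_rotations`). -/

section TestFunctions

variable {X : Type*} [TopologicalSpace X]

/-- A compactly supported function with values in `[0, 1]`, supported in a member of `𝒱`. -/
structure IsTest (𝒱 : Set (Set X)) (a : C_c(X, ℝ)) : Prop where
  nonneg : ∀ x, 0 ≤ a x
  le_one : ∀ x, a x ≤ 1
  exists_subset : ∃ V ∈ 𝒱, tsupport a ⊆ V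

/-- A family of test functions with pairwise disjoint supports. -/
structure DisjointTests (𝒱 : Set (Set X)) {ι : Type*} (a : ι → C_c(X, ℝ)) : Prop where
  isTest : ∀ i, IsTest 𝒱 (a i)
  disjoint : Pairwise fun i j => Disjoint (tsupport (a i)) (tsupport (a j))

theorem tsupport_smul_subset (χ : C(X, ℝ)) (a : C_c(X, ℝ)) :
    tsupport (χ • a : C_c(X, ℝ)) ⊆ tsupport a :=
  closure_mono fun x hx h0 => hx (by simp [CompactlySupportedContinuousMap.smulc_apply, h0])

theorem tsupport_smul_subset_left (χ : C(X, ℝ)) (a : C_c(X, ℝ)) {s : Set X} (hs : IsClosed s)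
    (h : ∀ x, χ x ≠ 0 → x ∈ s) : tsupport (χ • a : C_c(X, ℝ)) ⊆ s :=
  closure_minimal (fun x hx => h x fun h0 =>
    hx (by simp [CompactlySupportedContinuousMap.smulc_apply, h0])) hs

theorem IsTest.smul {𝒱 : Set (Set X)} {a : C_c(X, ℝ)} (ha : IsTest 𝒱 a) {χ : C(X, ℝ)}
    (h0 : ∀ x, 0 ≤ χ x) (h1 : ∀ x, χ x ≤ 1) : IsTest 𝒱 (χ • a) where
  nonneg x := by
    simpa [CompactlySupportedContinuousMap.smulc_apply] using mul_nonneg (h0 x) (ha.nonneg x)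
  le_one x := by
    simpa [CompactlySupportedContinuousMap.smulc_apply] using
      mul_le_one₀ (h1 x) (ha.nonneg x) (ha.le_one x)
  exists_subset := by
    obtain ⟨V, hV, h⟩ := ha.exists_subset
    exact ⟨V, hV, (tsupport_smul_subset χ a).trans h⟩

theorem DisjointTests.comp {𝒱 : Set (Set X)} {ι κ : Type*} {a : ι → C_c(X, ℝ)}
    (ha : DisjointTests 𝒱 a) {e : κ → ι} (he : Function.Injective e) :
    DisjointTests 𝒱 (a ∘ e) where
  isTest _ := ha.isTest _
  disjoint _ _ hij := ha.disjoint (he.ne hij)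

variable [T2Space X] [LocallyCompactSpace X]

/-- A compact set contained in an open set has a compactly supported bump function. -/
theorem exists_bump {K V : Set X} (hK : IsCompact K) (hV : IsOpen V) (hKV : K ⊆ V) :
    ∃ a : C_c(X, ℝ), (∀ x, 0 ≤ a x) ∧ (∀ x, a x ≤ 1) ∧ tsupport a ⊆ V ∧ ∀ x ∈ K, a x = 1 := by
  obtain ⟨L, hL, hKL, hLV⟩ := exists_compact_between hK hV hKV
  obtain ⟨f, hf1, hf0, hfc, hf⟩ := exists_continuous_one_zero_of_isCompact hK
    (isOpen_interior (s := L)).isClosed_compl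
    (Set.disjoint_compl_right_iff_subset.2 hKL)
  refine ⟨⟨f, hfc⟩, fun x => (hf x).1, fun x => (hf x).2, ?_, fun x hx => hf1 hx⟩
  refine (closure_minimal (t := L) ?_ hL.isClosed).trans hLV
  intro x hx
  by_contra h
  exact hx (hf0 fun h' => h (interior_subset h'))

theorem exists_disjoint_open_nhds {ι : Type*} [Finite ι] {K : ι → Set X}
    (hK : ∀ i, IsCompact (K i)) (hd : Pairwise fun i j => Disjoint (K i) (K j)) :
    ∃ W : ι → Set X, (∀ i, IsOpen (W i)) ∧ (∀ i, K i ⊆ W i) ∧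
      Pairwise fun i j => Disjoint (W i) (W j) := by
  have h : ∀ i j, ∃ A B : Set X, i ≠ j →
      IsOpen A ∧ IsOpen B ∧ K i ⊆ A ∧ K j ⊆ B ∧ Disjoint A B := by
    intro i j
    by_cases hij : i = j
    · exact ⟨∅, ∅, fun h => (h hij).elim⟩
    · obtain ⟨A, B, h⟩ := SeparatedNhds.of_isCompact_isCompact (hK i) (hK j) (hd hij)
      exact ⟨A, B, fun _ => h⟩
  choose A B h using h
  refine ⟨fun i => ⋂ j, ⋂ _ : i ≠ j, A i j ∩ B j i, fun i => ?_, fun i => ?_, fun i j hij => ?_⟩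
  · exact isOpen_iInter_of_finite fun j => isOpen_iInter_of_finite fun hij =>
      (h i j hij).1.inter (h j i hij.symm).2.1
  · exact Set.subset_iInter₂ fun j hij =>
      Set.subset_inter (h i j hij).2.2.1 (h j i hij.symm).2.2.2.1
  · refine (h i j hij).2.2.2.2.mono ?_ ?_
    · exact (Set.iInter₂_subset j hij).trans Set.inter_subset_left
    · exact (Set.iInter₂_subset i hij.symm).trans Set.inter_subset_right

/-- A disjoint family of test functions admits a disjoint family of local units. -/
theorem DisjointTests.exists_units {𝒱 : Set (Set X)} (h𝒱 : ∀ V ∈ 𝒱, IsOpen V)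
    {ι : Type*} [Finite ι] {a : ι → C_c(X, ℝ)} (ha : DisjointTests 𝒱 a) :
    ∃ v : ι → C_c(X, ℝ), DisjointTests 𝒱 v ∧ ∀ i, ∀ x ∈ tsupport (a i), v i x = 1 := by
  have hc : ∀ i, IsCompact (tsupport (a i)) := fun i => (a i).hasCompactSupport
  obtain ⟨W, hWo, hW, hWd⟩ := exists_disjoint_open_nhds hc ha.disjoint
  choose V hV haV using fun i => (ha.isTest i).exists_subset
  choose v hv0 hv1 hvs hv using fun i => exists_bump (hc i) ((hWo i).inter (h𝒱 _ (hV i)))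
    (Set.subset_inter (hW i) (haV i))
  exact ⟨v, ⟨fun i => ⟨hv0 i, hv1 i, V i, hV i, (hvs i).trans Set.inter_subset_right⟩,
    fun i j hij => (hWd hij).mono ((hvs i).trans Set.inter_subset_left)
      ((hvs j).trans Set.inter_subset_left)⟩, hv⟩

end TestFunctions

/-! ### From `ℓ^s`-bounds on disjoint families to a content and a regular measure. -/

section Mass

variable {X : Type*} [TopologicalSpace X] [T2Space X] [LocallyCompactSpace X]
  {𝒱 : Set (Set X)} {Y : Type*} [SeminormedAddCommGroup Y] {Z : C_c(X, ℝ) →+ Y} {s C : ℝ}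

/-- Estimates of `ℓ^s` type for an additive map on disjoint families of test functions. -/
structure HasDisjointBound (𝒱 : Set (Set X)) (Z : C_c(X, ℝ) →+ Y) (s C : ℝ) : Prop where
  one_le : 1 ≤ s
  sum_le : ∀ (n : ℕ) (a : Fin n → C_c(X, ℝ)), DisjointTests 𝒱 a → ∑ i, ‖Z (a i)‖ ^ s ≤ C
  add_le : ∀ a b, IsTest 𝒱 a → IsTest 𝒱 b → Disjoint (tsupport a) (tsupport b) →
    ‖Z (a + b)‖ ^ s ≤ ‖Z a‖ ^ s + ‖Z b‖ ^ s

/-- The supremum of `∑ ‖Z aᵢ‖ ^ s` over the disjoint families of test functions in `V`. -/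
def mass (𝒱 : Set (Set X)) (Z : C_c(X, ℝ) →+ Y) (s : ℝ) (V : Set X) : ℝ :=
  sSup {t | ∃ (n : ℕ) (a : Fin n → C_c(X, ℝ)), DisjointTests 𝒱 a ∧ (∀ i, tsupport (a i) ⊆ V) ∧
    t = ∑ i, ‖Z (a i)‖ ^ s}

namespace HasDisjointBound

theorem sum_le_mass (h : HasDisjointBound 𝒱 Z s C) {ι : Type*} [Fintype ι]
    {a : ι → C_c(X, ℝ)} (ha : DisjointTests 𝒱 a) {V : Set X} (hV : ∀ i, tsupport (a i) ⊆ V) :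
    ∑ i, ‖Z (a i)‖ ^ s ≤ mass 𝒱 Z s V := by
  refine le_csSup ⟨C, ?_⟩ ⟨Fintype.card ι, a ∘ (Fintype.equivFin ι).symm,
    ha.comp (Equiv.injective _), fun i => hV _, ?_⟩
  · rintro _ ⟨n, a, ha, -, rfl⟩
    exact h.sum_le n a ha
  · exact ((Fintype.equivFin ι).symm.sum_comp fun i => ‖Z (a i)‖ ^ s).symm

theorem mass_le_of (_h : HasDisjointBound 𝒱 Z s C) {V : Set X} {t : ℝ}
    (ht : ∀ (n : ℕ) (a : Fin n → C_c(X, ℝ)), DisjointTests 𝒱 a → (∀ i, tsupport (a i) ⊆ V) →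
      ∑ i, ‖Z (a i)‖ ^ s ≤ t) : mass 𝒱 Z s V ≤ t := by
  refine csSup_le ⟨0, 0, fun i => i.elim0, ⟨fun i => i.elim0, fun i => i.elim0⟩,
    fun i => i.elim0, by simp⟩ ?_
  rintro _ ⟨n, a, ha, haV, rfl⟩
  exact ht n a ha haV

theorem mass_le (h : HasDisjointBound 𝒱 Z s C) (V : Set X) : mass 𝒱 Z s V ≤ C :=
  h.mass_le_of fun n a ha _ => h.sum_le n a ha

theorem mass_nonneg (h : HasDisjointBound 𝒱 Z s C) (V : Set X) : 0 ≤ mass 𝒱 Z s V := by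
  simpa using h.sum_le_mass (ι := Fin 0) (a := fun i => i.elim0)
    ⟨fun i => i.elim0, fun i => i.elim0⟩ (V := V) fun i => i.elim0

theorem mass_mono (h : HasDisjointBound 𝒱 Z s C) {V W : Set X} (hVW : V ⊆ W) :
    mass 𝒱 Z s V ≤ mass 𝒱 Z s W :=
  h.mass_le_of fun _ _ ha haV => h.sum_le_mass ha fun i => (haV i).trans hVW

/-- A disjoint family in `V` and one in `W` together form a disjoint family in the union. The two
suprema are taken one after the other, the remaining term being moved across the inequality. -/
theorem mass_add_le (h : HasDisjointBound 𝒱 Z s C) {V W : Set X} (hVW : Disjoint V W) :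
    mass 𝒱 Z s V + mass 𝒱 Z s W ≤ mass 𝒱 Z s (V ∪ W) := by
  rw [← le_sub_iff_add_le]
  refine h.mass_le_of fun n a ha haV => ?_
  rw [le_sub_comm]
  refine h.mass_le_of fun m b hb hbW => ?_
  rw [le_sub_iff_add_le']
  have hd : DisjointTests 𝒱 (Sum.elim a b) := by
    refine ⟨?_, ?_⟩
    · rintro (i | i)
      · exact ha.isTest i
      · exact hb.isTest i
    · rintro (i | i) (j | j) hij
      · exact ha.disjoint fun h => hij (h ▸ rfl)
      · exact hVW.mono (haV i) (hbW j)
      · exact (hVW.mono (haV j) (hbW i)).symm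
      · exact hb.disjoint fun h => hij (h ▸ rfl)
  have := h.sum_le_mass hd (V := V ∪ W) (by
    rintro (i | i)
    · exact (haV i).trans Set.subset_union_left
    · exact (hbW i).trans Set.subset_union_right)
  simpa [Fintype.sum_sum_type] using this

/-- A test function split by a cut-off at one of `N` levels, together with the thin layer at that
level. -/
theorem exists_cut {θ : C(X, ℝ)} {N : ℕ} :
    ∃ α β σ : Fin N → C(X, ℝ),
      (∀ j x, 0 ≤ α j x ∧ α j x ≤ 1 ∧ 0 ≤ β j x ∧ β j x ≤ 1 ∧ 0 ≤ σ j x ∧ σ j x ≤ 1) ∧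
      (∀ j x, α j x + β j x + σ j x = 1) ∧
      (∀ j x, α j x ≠ 0 → 4 * j + 2 ≤ 4 * N * θ x) ∧
      (∀ j x, β j x ≠ 0 → 4 * N * θ x ≤ 4 * j + 1) ∧
      (∀ j x, σ j x ≠ 0 → 4 * j ≤ 4 * N * θ x ∧ 4 * N * θ x ≤ 4 * j + 3) := by
  -- With the scale `4Nθ`, the layer of index `j` occupies `[4j, 4j+3]`. Different layers are then a
  -- unit apart, and so are the upper part (from `4j+2`) and the lower part (up to `4j+1`), which
  -- keeps the closed supports disjoint.
  let A : Fin N → X → ℝ := fun j x => max 0 (min 1 (4 * N * θ x - (4 * j + 2)))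
  let B : Fin N → X → ℝ := fun j x => max 0 (min 1 (4 * j + 1 - 4 * N * θ x))
  have hA : ∀ j, Continuous (A j) := fun j => by fun_prop
  have hB : ∀ j, Continuous (B j) := fun j => by fun_prop
  refine ⟨fun j => ⟨A j, hA j⟩, fun j => ⟨B j, hB j⟩,
    fun j => ⟨fun x => 1 - A j x - B j x, by fun_prop⟩, ?_, ?_, ?_, ?_, ?_⟩
  all_goals
    intro j x
    simp only [ContinuousMap.coe_mk, A, B]
    generalize 4 * (N : ℝ) * θ x = y
    generalize (j : ℝ) = k
    grind

/-- A function supported in `V ∪ W` cannot be cut into disjoint pieces in `V` and `W` without a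
transition layer. There are `N` disjoint candidates for this layer, of total `s`-mass at most `C`,
so one costs at most `C / N`; then `N → ∞`. -/
theorem mass_union_le (h : HasDisjointBound 𝒱 Z s C) {V W : Set X} (hV : IsOpen V)
    (hW : IsOpen W) : mass 𝒱 Z s (V ∪ W) ≤ mass 𝒱 Z s V + mass 𝒱 Z s W := by
  have hs : 0 < s := one_pos.trans_le h.one_le
  have hC : 0 ≤ C := (h.mass_nonneg V).trans (h.mass_le V)
  refine h.mass_le_of fun n a ha haVW => ?_
  set T := mass 𝒱 Z s V + mass 𝒱 Z s W with hT
  have hT0 : 0 ≤ T := add_nonneg (h.mass_nonneg V) (h.mass_nonneg W)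
  have key : ∀ N : ℕ, 0 < N →
      (∑ i, ‖Z (a i)‖ ^ s) ^ (1 / s) ≤ T ^ (1 / s) + (C / N) ^ (1 / s) := by
    intro N hN
    set L : Set X := ⋃ i, tsupport (a i) with hL
    have hLc : IsCompact L := isCompact_iUnion fun i => (a i).hasCompactSupport
    -- Where `θ > 0` the point is in `V`; on the supports, where `θ < 1` it is in `W`. Any level
    -- strictly between `0` and `1` therefore separates a `V`-part from a `W`-part.
    obtain ⟨θ, hθ0, hθ1, hθV, hθ⟩ := exists_bump (hLc.diff hW) hV (by
      rintro x ⟨hx, hxW⟩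
      obtain ⟨i, hi⟩ := Set.mem_iUnion.1 hx
      exact (haVW i hi).resolve_right hxW)
    obtain ⟨α, β, σ, hb, hsum, hα, hβ, hσ⟩ := exists_cut (θ := θ.toContinuousMap) (N := N)
    have hθc : Continuous fun x => 4 * N * θ x := continuous_const.mul θ.continuous
    -- the layers are disjoint, so one of them is thin
    obtain ⟨j, hj⟩ : ∃ j : Fin N, ∑ i, ‖Z (σ j • a i)‖ ^ s ≤ C / N := by
      by_contra! hcon
      have hd : DisjointTests 𝒱 (fun q : Fin N × Fin n => (σ q.1 • a q.2 : C_c(X, ℝ))) := by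
        refine ⟨fun q => (ha.isTest q.2).smul (fun x => (hb q.1 x).2.2.2.2.1)
          (fun x => (hb q.1 x).2.2.2.2.2), ?_⟩
        rintro ⟨j, i⟩ ⟨j', i'⟩ hne
        by_cases hi : i = i'
        · have hjj : j ≠ j' := fun h => hne (by rw [h, hi])
          have hcl : ∀ j : Fin N, IsClosed {x | 4 * (j : ℝ) ≤ 4 * N * θ x ∧
              4 * N * θ x ≤ 4 * j + 3} := fun j =>
            (isClosed_le continuous_const hθc).inter (isClosed_le hθc continuous_const)
          refine Disjoint.mono (tsupport_smul_subset_left (σ j) (a i) (hcl j) (hσ j))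
            (tsupport_smul_subset_left (σ j') (a i') (hcl j') (hσ j')) ?_
          rw [Set.disjoint_left]
          rintro x ⟨h1, h2⟩ ⟨h3, h4⟩
          rcases lt_or_gt_of_ne hjj with hlt | hlt
          · have : (j : ℝ) + 1 ≤ j' := by exact_mod_cast hlt
            linarith
          · have : (j' : ℝ) + 1 ≤ j := by exact_mod_cast hlt
            linarith
        · exact (ha.disjoint hi).mono (tsupport_smul_subset _ _) (tsupport_smul_subset _ _)
      have h1 := (h.sum_le_mass hd (V := Set.univ) fun _ => Set.subset_univ _).trans
        (h.mass_le _)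
      rw [Fintype.sum_prod_type] at h1
      have : Nonempty (Fin N) := ⟨⟨0, hN⟩⟩
      have h2 : ∑ _j : Fin N, C / N < ∑ j, ∑ i, ‖Z (σ j • a i)‖ ^ s :=
        Finset.sum_lt_sum_of_nonempty Finset.univ_nonempty fun j _ => hcon j
      have hN' : (N : ℝ) ≠ 0 := by exact_mod_cast hN.ne'
      simp only [Finset.sum_const, Finset.card_univ, Fintype.card_fin, nsmul_eq_mul] at h2
      rw [mul_div_cancel₀ _ hN'] at h2
      linarith
    have hα' : ∀ i, tsupport (α j • a i : C_c(X, ℝ)) ⊆ {x | 4 * (j : ℝ) + 2 ≤ 4 * N * θ x} :=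
      fun i => tsupport_smul_subset_left _ _ (isClosed_le continuous_const hθc) (hα j)
    have hβ' : ∀ i, tsupport (β j • a i : C_c(X, ℝ)) ⊆ {x | 4 * N * θ x ≤ 4 * (j : ℝ) + 1} :=
      fun i => tsupport_smul_subset_left _ _ (isClosed_le hθc continuous_const) (hβ j)
    have htα : ∀ i, IsTest 𝒱 (α j • a i) := fun i =>
      (ha.isTest i).smul (fun x => (hb j x).1) (fun x => (hb j x).2.1)
    have htβ : ∀ i, IsTest 𝒱 (β j • a i) := fun i =>
      (ha.isTest i).smul (fun x => (hb j x).2.2.1) (fun x => (hb j x).2.2.2.1)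
    have hsumα : ∑ i, ‖Z (α j • a i)‖ ^ s ≤ mass 𝒱 Z s V := by
      refine h.sum_le_mass ⟨htα, fun i i' hi => (ha.disjoint hi).mono (tsupport_smul_subset _ _)
        (tsupport_smul_subset _ _)⟩ fun i x hx => hθV (subset_tsupport _ ?_)
      have hx' : 4 * (j : ℝ) + 2 ≤ 4 * N * θ x := hα' i hx
      intro h0
      rw [h0] at hx'
      have : (0 : ℝ) ≤ j := Nat.cast_nonneg _
      linarith
    have hsumβ : ∑ i, ‖Z (β j • a i)‖ ^ s ≤ mass 𝒱 Z s W := by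
      refine h.sum_le_mass ⟨htβ, fun i i' hi => (ha.disjoint hi).mono (tsupport_smul_subset _ _)
        (tsupport_smul_subset _ _)⟩ fun i x hx => ?_
      have hx' : 4 * N * θ x ≤ 4 * (j : ℝ) + 1 := hβ' i hx
      by_contra hxW
      have h1 := hθ x ⟨Set.mem_iUnion.2 ⟨i, tsupport_smul_subset _ _ hx⟩, hxW⟩
      rw [h1] at hx'
      -- Since `j ≤ N - 1`, the bound `4j + 1` is below `4N`, which contradicts `θ x = 1`.
      have : (j : ℝ) + 1 ≤ N := by exact_mod_cast j.2
      linarith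
    have hsplit : ∀ i, a i = (α j • a i + β j • a i) + σ j • a i := by
      intro i
      ext x
      simp only [CompactlySupportedContinuousMap.add_apply,
        CompactlySupportedContinuousMap.smulc_apply, smul_eq_mul]
      rw [← add_mul, ← add_mul, hsum, one_mul]
    have hle : ∀ i, ‖Z (a i)‖ ≤ ‖Z (α j • a i + β j • a i)‖ + ‖Z (σ j • a i)‖ := by
      intro i
      conv_lhs => rw [hsplit i, map_add]
      exact norm_add_le _ _
    -- Minkowski's inequality splits off the thin layer with constant one; additivity on disjoint
    -- supports is applied only to the separated upper and lower parts.
    calc (∑ i, ‖Z (a i)‖ ^ s) ^ (1 / s)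
        ≤ (∑ i, (‖Z (α j • a i + β j • a i)‖ + ‖Z (σ j • a i)‖) ^ s) ^ (1 / s) := by
          gcongr with i
          exact hle i
      _ ≤ (∑ i, ‖Z (α j • a i + β j • a i)‖ ^ s) ^ (1 / s) +
          (∑ i, ‖Z (σ j • a i)‖ ^ s) ^ (1 / s) :=
          Real.Lp_add_le_of_nonneg _ h.one_le (fun _ _ => norm_nonneg _)
            (fun _ _ => norm_nonneg _)
      _ ≤ T ^ (1 / s) + (C / N) ^ (1 / s) := by
          gcongr
          rw [hT]
          refine le_trans ?_ (add_le_add hsumα hsumβ)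
          rw [← Finset.sum_add_distrib]
          refine Finset.sum_le_sum fun i _ => h.add_le _ _ (htα i) (htβ i) ?_
          refine Disjoint.mono (hα' i) (hβ' i) (Set.disjoint_left.2 fun x hx hx' => ?_)
          simp only [Set.mem_ofPred_eq] at hx hx'
          linarith
  have hlim : Filter.Tendsto (fun N : ℕ => T ^ (1 / s) + (C / N) ^ (1 / s)) Filter.atTop
      (𝓝 (T ^ (1 / s) + 0)) := by
    refine tendsto_const_nhds.add ?_
    have h1 : Filter.Tendsto (fun N : ℕ => C / (N : ℝ)) Filter.atTop (𝓝 0) :=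
      tendsto_const_div_atTop_nhds_zero_nat C
    have h2 := h1.rpow_const (p := 1 / s) (Or.inr (by positivity))
    rwa [Real.zero_rpow (by positivity)] at h2
  rw [add_zero] at hlim
  have h3 := ge_of_tendsto hlim ((Filter.eventually_gt_atTop 0).mono key)
  exact (Real.rpow_le_rpow_iff (Finset.sum_nonneg fun _ _ => by positivity) hT0
    (by positivity)).1 h3

/-- The content of a compact set: the infimum of the masses of its open neighbourhoods. -/
def outerMass (𝒱 : Set (Set X)) (Z : C_c(X, ℝ) →+ Y) (s : ℝ) (K : Set X) : ℝ :=
  sInf (mass 𝒱 Z s '' {V | IsOpen V ∧ K ⊆ V})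

theorem outerMass_le (h : HasDisjointBound 𝒱 Z s C) {K V : Set X} (hV : IsOpen V)
    (hKV : K ⊆ V) : outerMass 𝒱 Z s K ≤ mass 𝒱 Z s V :=
  csInf_le ⟨0, by rintro _ ⟨V, -, rfl⟩; exact h.mass_nonneg V⟩ ⟨V, ⟨hV, hKV⟩, rfl⟩

theorem le_outerMass {K : Set X} {t : ℝ} (ht : ∀ V, IsOpen V → K ⊆ V → t ≤ mass 𝒱 Z s V) :
    t ≤ outerMass 𝒱 Z s K := by
  refine le_csInf ⟨_, Set.univ, ⟨isOpen_univ, Set.subset_univ _⟩, rfl⟩ ?_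
  rintro _ ⟨V, ⟨hV, hKV⟩, rfl⟩
  exact ht V hV hKV

theorem exists_mass_lt {K : Set X} {t : ℝ} (ht : outerMass 𝒱 Z s K < t) :
    ∃ V, IsOpen V ∧ K ⊆ V ∧ mass 𝒱 Z s V < t := by
  by_contra! hcon
  exact absurd (le_outerMass hcon) (not_le.2 ht)

theorem outerMass_nonneg (h : HasDisjointBound 𝒱 Z s C) (K : Set X) : 0 ≤ outerMass 𝒱 Z s K :=
  le_outerMass fun V _ _ => h.mass_nonneg V

theorem outerMass_union_le (h : HasDisjointBound 𝒱 Z s C) (K L : Set X) :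
    outerMass 𝒱 Z s (K ∪ L) ≤ outerMass 𝒱 Z s K + outerMass 𝒱 Z s L := by
  refine le_of_forall_pos_lt_add fun ε hε => ?_
  obtain ⟨V, hV, hKV, h1⟩ := exists_mass_lt (lt_add_of_pos_right (outerMass 𝒱 Z s K) (half_pos hε))
  obtain ⟨W, hW, hLW, h2⟩ := exists_mass_lt (lt_add_of_pos_right (outerMass 𝒱 Z s L) (half_pos hε))
  have h3 := h.outerMass_le (hV.union hW) (Set.union_subset_union hKV hLW)
  have h4 := h.mass_union_le hV hW
  linarith

/-- Disjoint compact sets have disjoint open neighbourhoods, so every neighbourhood of the union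
contains disjoint neighbourhoods of the two sets, where the mass is superadditive. -/
theorem outerMass_add_le (h : HasDisjointBound 𝒱 Z s C) {K L : Set X} (hK : IsCompact K)
    (hL : IsCompact L) (hd : Disjoint K L) :
    outerMass 𝒱 Z s K + outerMass 𝒱 Z s L ≤ outerMass 𝒱 Z s (K ∪ L) := by
  obtain ⟨A, B, hA, hB, hKA, hLB, hAB⟩ := SeparatedNhds.of_isCompact_isCompact hK hL hd
  refine le_outerMass fun V hV hKL => ?_
  refine (add_le_add (h.outerMass_le (hA.inter hV)
    (Set.subset_inter hKA (Set.subset_union_left.trans hKL))) (h.outerMass_le (hB.inter hV)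
    (Set.subset_inter hLB (Set.subset_union_right.trans hKL)))).trans ?_
  refine (h.mass_add_le (hAB.mono Set.inter_subset_left Set.inter_subset_left)).trans
    (h.mass_mono ?_)
  exact Set.union_subset Set.inter_subset_right Set.inter_subset_right

/-- The outer mass as a content on compact sets. -/
def content (h : HasDisjointBound 𝒱 Z s C) : Content X where
  toFun K := (outerMass 𝒱 Z s K).toNNReal
  mono' _ _ hKL := Real.toNNReal_le_toNNReal
    (le_outerMass fun _ hV hLV => h.outerMass_le hV (hKL.trans hLV))
  sup_disjoint' K L hd _ _ := by
    rw [← Real.toNNReal_add (h.outerMass_nonneg K) (h.outerMass_nonneg L)]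
    exact congrArg _ (le_antisymm (h.outerMass_union_le K L)
      (h.outerMass_add_le K.isCompact L.isCompact hd))
  sup_le' K L := by
    rw [← Real.toNNReal_add (h.outerMass_nonneg K) (h.outerMass_nonneg L)]
    exact Real.toNNReal_le_toNNReal (h.outerMass_union_le K L)

/-- A map with disjoint bounds is dominated by a regular measure. -/
theorem exists_measure [MeasurableSpace X] [BorelSpace X] (h : HasDisjointBound 𝒱 Z s C) :
    ∃ m : Measure X, m.Regular ∧ m Set.univ ≤ ENNReal.ofReal C ∧
      ∀ a, IsTest 𝒱 a → ENNReal.ofReal (‖Z a‖ ^ s) ≤ m (tsupport a) := by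
  refine ⟨h.content.measure, inferInstance, ?_, fun a ha => ?_⟩
  · rw [Content.measure_apply _ MeasurableSet.univ,
      Content.outerMeasure_of_isOpen _ _ isOpen_univ]
    refine iSup₂_le fun K _ => ?_
    exact ENNReal.ofReal_le_ofReal
      ((h.outerMass_le isOpen_univ (Set.subset_univ _)).trans (h.mass_le _))
  · let K : TopologicalSpace.Compacts X := ⟨tsupport a, a.hasCompactSupport⟩
    have h1 := h.content.le_outerMeasure_compacts K
    rw [Content.measure_apply _ (isClosed_tsupport _).measurableSet]
    refine le_trans ?_ h1
    refine ENNReal.ofReal_le_ofReal (le_outerMass fun V _ hKV => ?_)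
    -- The function `a` alone is a disjoint family in every neighbourhood of its support.
    have h2 := h.sum_le_mass (ι := Unit) (a := fun _ => a)
      ⟨fun _ => ha, fun i j hij => (hij rfl).elim⟩ (V := V) fun _ => hKV
    simpa using h2

end HasDisjointBound

end Mass

/-! ### Rotations and disjointness in `L^p` -/

section Rotations

variable {𝕜 : Type*} [RCLike 𝕜]

open RCLike ComplexConjugate

/-- The fourth roots of unity. -/
def fourthRoot (𝕜 : Type*) [RCLike 𝕜] : Fin 4 → 𝕜 := ![1, I, -1, -I]

theorem IsComplexField.I_mul_I (h𝕜 : IsComplexField 𝕜) : (I : 𝕜) * I = -1 :=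
  I_mul_I_of_nonzero h𝕜

theorem norm_fourthRoot (h𝕜 : IsComplexField 𝕜) (k : Fin 4) : ‖fourthRoot 𝕜 k‖ = 1 := by
  fin_cases k <;> simp [fourthRoot, norm_I_of_ne_zero h𝕜]

theorem conj_fourthRoot_mul (h𝕜 : IsComplexField 𝕜) (k : Fin 4) :
    conj (fourthRoot 𝕜 k) * fourthRoot 𝕜 k = 1 := by
  rw [RCLike.conj_mul, norm_fourthRoot h𝕜]
  simp

theorem sum_conj_fourthRoot : ∑ k, conj (fourthRoot 𝕜 k) = 0 := by
  simp [fourthRoot, Fin.sum_univ_four]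

/-- Complex scalars are essential here: over `ℝ` one has `I = 0`, and the sum would be `2`. -/
theorem sum_conj_fourthRoot_sq (h𝕜 : IsComplexField 𝕜) :
    ∑ k, conj (fourthRoot 𝕜 k) * conj (fourthRoot 𝕜 k) = 0 := by
  have := h𝕜.I_mul_I
  simp [fourthRoot, Fin.sum_univ_four]
  grind

/-- Writing real parts as half sums with conjugates, the terms carrying the square of a root or of
its conjugate cancel in the sum, and only `u v` and its conjugate survive. -/
theorem sum_re_mul_re (h𝕜 : IsComplexField 𝕜) (u v : 𝕜) :
    ∑ k, re (conj (fourthRoot 𝕜 k) * u) * re (fourthRoot 𝕜 k * v) = 2 * re (u * v) := by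
  have hI : im (I : 𝕜) = 1 := I_eq_zero_or_im_I_eq_one.resolve_left h𝕜
  simp [fourthRoot, Fin.sum_univ_four, hI]
  ring

theorem norm_add_smul_sq (a b : 𝕜) (t : ℝ) :
    ‖a + (t : 𝕜) * b‖ ^ 2 = ‖a‖ ^ 2 + 2 * t * re (b * conj a) + t ^ 2 * ‖b‖ ^ 2 := by
  simp only [← normSq_eq_def', normSq_apply]
  simp
  ring

/-- The squared norm is a quadratic polynomial in `t`, nonzero at `0`, so its power `p / 2` is
differentiable there for any real `p`. -/
theorem hasDerivAt_norm_rpow {a : 𝕜} (ha : a ≠ 0) (b : 𝕜) (p : ℝ) :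
    HasDerivAt (fun t : ℝ => ‖a + (t : 𝕜) * b‖ ^ p)
      (p * ‖a‖ ^ (p - 2) * re (b * conj a)) 0 := by
  have h1 : HasDerivAt (fun t : ℝ => ‖a‖ ^ 2 + 2 * t * re (b * conj a) + t ^ 2 * ‖b‖ ^ 2)
      (2 * re (b * conj a)) 0 := by
    have h := (((hasDerivAt_id (0 : ℝ)).const_mul 2).mul_const (re (b * conj a))).const_add
      (‖a‖ ^ 2) |>.add (((hasDerivAt_id (0 : ℝ)).pow 2).mul_const (‖b‖ ^ 2))
    exact h.congr_deriv (by simp)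
  have ha' : 0 < ‖a‖ := norm_pos_iff.2 ha
  have h2 := h1.rpow_const (p := p / 2) (Or.inl (by simp [ha]))
  convert h2 using 1
  · funext t
    rw [← norm_add_smul_sq, ← Real.rpow_natCast, ← Real.rpow_mul (norm_nonneg _)]
    congr 1
    push_cast
    ring
  · simp only [mul_zero, zero_mul, add_zero, ne_eq, OfNat.ofNat_ne_zero, not_false_eq_true,
      zero_pow]
    rw [← Real.rpow_natCast, ← Real.rpow_mul (norm_nonneg _)]
    rw [show ((2 : ℕ) : ℝ) * (p / 2 - 1) = p - 2 by push_cast; ring]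
    ring

/-- Step sizes are restricted to the countable set `1 / (n + 1)`, so that null sets indexed by them
still have a null union. -/
theorem eventually_lt_of_hasDerivAt_neg {f : ℝ → ℝ} {f' : ℝ} (hf : HasDerivAt f f' 0)
    (hf' : f' < 0) : ∀ᶠ n : ℕ in Filter.atTop, f (1 / ((n : ℝ) + 1)) < f 0 := by
  have h := hasDerivAt_iff_tendsto_slope.1 hf
  have h1 : Filter.Tendsto (fun n : ℕ => 1 / ((n : ℝ) + 1)) Filter.atTop (𝓝[≠] 0) := by
    refine tendsto_nhdsWithin_iff.2 ⟨tendsto_one_div_add_atTop_nhds_zero_nat, ?_⟩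
    exact Filter.Eventually.of_forall fun n => by
      simp only [Set.mem_compl_iff, Set.mem_singleton_iff]
      positivity
  filter_upwards [(h.comp h1).eventually (gt_mem_nhds hf')] with n hn
  simp only [Function.comp_apply, slope, vsub_eq_sub, sub_zero, smul_eq_mul] at hn
  have hpos : 0 < (1 / ((n : ℝ) + 1))⁻¹ := by positivity
  exact sub_neg.1 (neg_of_mul_neg_right hn hpos.le)

/-- The direction in which a simultaneous rotation-twisted perturbation of the values `a + z s b`
decreases the sum of the `p`-th powers. -/
def decreasingDirection (p : ℝ) (a b : 𝕜) : 𝕜 :=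
  ((-(p - 2) / ‖a‖ ^ 2 : ℝ) : 𝕜) * (a * a * conj b)

theorem norm_decreasingDirection_le (p : ℝ) (a b : 𝕜) :
    ‖decreasingDirection p a b‖ ≤ |p - 2| * ‖b‖ := by
  rw [decreasingDirection, norm_mul, norm_ofReal, norm_mul, norm_mul, norm_conj, abs_div, abs_neg,
    abs_of_nonneg (sq_nonneg ‖a‖)]
  by_cases ha : ‖a‖ = 0
  · simp [ha]
    positivity
  · apply le_of_eq
    field_simp

/-- The first variation in the direction `c` vanishes at `a`, because the conjugate roots sum to
zero. Moving the base points to `a + z s b` makes it change at rate proportional to `(p - 2) re(c ā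
· b ā)`, and `c` is chosen to make this a negative multiple of `(p - 2)²`. So for a small `s` and
then a much smaller `t` the sum drops strictly. At `p = 2` the effect disappears. -/
theorem exists_sum_rpow_lt (h𝕜 : IsComplexField 𝕜) {p : ℝ} (hp0 : 0 < p) (hp : p ≠ 2) {a b : 𝕜}
    (ha : a ≠ 0) (hb : b ≠ 0) : ∃ n m : ℕ,
    ∑ k, ‖a + fourthRoot 𝕜 k * ((1 / ((n : ℝ) + 1) : ℝ) * b) +
        conj (fourthRoot 𝕜 k) * ((1 / ((m : ℝ) + 1) : ℝ) * decreasingDirection p a b)‖ ^ p <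
      ∑ k, ‖a + fourthRoot 𝕜 k * ((1 / ((n : ℝ) + 1) : ℝ) * b)‖ ^ p := by
  set c := decreasingDirection p a b with hc
  set z := fourthRoot 𝕜 with hz
  have ha' : 0 < ‖a‖ := norm_pos_iff.2 ha
  have hb' : 0 < ‖b‖ := norm_pos_iff.2 hb
  -- Up to the factor `p`, this is the derivative at `t = 0` of the sum of the `p`-th powers of `‖a
  -- + z s b + z̄ t c‖`, as a function of `s`.
  let Γ : ℝ → ℝ := fun s => ∑ k, (re (conj (z k) * c * conj a) +
    s * re (conj (z k) * conj (z k) * (c * conj b))) * ‖a + (s : 𝕜) * (z k * b)‖ ^ (p - 2)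
  have hΓ0 : Γ 0 = 0 := by
    simp only [Γ, zero_mul, add_zero, ofReal_zero]
    rw [← Finset.sum_mul, ← map_sum, ← Finset.sum_mul, ← Finset.sum_mul, sum_conj_fourthRoot]
    simp
  have hΓ : HasDerivAt Γ (-(2 * (p - 2) ^ 2 * ‖a‖ ^ (p - 4) * (‖a‖ ^ 2 * ‖b‖ ^ 2))) 0 := by
    have h1 : ∀ k, HasDerivAt (fun s : ℝ => (re (conj (z k) * c * conj a) +
        s * re (conj (z k) * conj (z k) * (c * conj b))) * ‖a + (s : 𝕜) * (z k * b)‖ ^ (p - 2))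
        (re (conj (z k) * conj (z k) * (c * conj b)) * ‖a‖ ^ (p - 2) +
          re (conj (z k) * c * conj a) *
            ((p - 2) * ‖a‖ ^ (p - 2 - 2) * re (z k * b * conj a))) 0 := by
      intro k
      have h := (((hasDerivAt_id (0 : ℝ)).mul_const
        (re (conj (z k) * conj (z k) * (c * conj b)))).const_add
          (re (conj (z k) * c * conj a))).mul (hasDerivAt_norm_rpow ha (z k * b) (p - 2))
      exact h.congr_deriv (by simp only [one_mul, zero_mul, add_zero, ofReal_zero, id])
    have h2 := HasDerivAt.fun_sum (u := Finset.univ) fun k _ => h1 k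
    refine h2.congr_deriv ?_
    rw [Finset.sum_add_distrib, ← Finset.sum_mul, ← map_sum, ← Finset.sum_mul,
      sum_conj_fourthRoot_sq h𝕜]
    have h3 : ∀ k, re (conj (z k) * c * conj a) *
        ((p - 2) * ‖a‖ ^ (p - 2 - 2) * re (z k * b * conj a)) =
        ((p - 2) * ‖a‖ ^ (p - 2 - 2)) *
          (re (conj (z k) * (c * conj a)) * re (z k * (b * conj a))) := by
      intro k
      rw [mul_assoc (conj (z k)), mul_assoc (z k)]
      ring
    rw [Finset.sum_congr rfl fun k _ => h3 k, ← Finset.mul_sum, sum_re_mul_re h𝕜]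
    -- The factor `a * a * conj b` in `c` makes this product real.
    have h4 : c * conj a * (b * conj a) =
        ((-(p - 2) / ‖a‖ ^ 2 * (‖a‖ ^ 2 * ‖a‖ ^ 2 * ‖b‖ ^ 2) : ℝ) : 𝕜) := by
      rw [hc, decreasingDirection]
      have e1 : a * conj a = ((‖a‖ ^ 2 : ℝ) : 𝕜) := by rw [mul_conj]; push_cast; rfl
      have e2 : b * conj b = ((‖b‖ ^ 2 : ℝ) : 𝕜) := by rw [mul_conj]; push_cast; rfl
      rw [ofReal_mul, ofReal_mul, ofReal_mul, ← e1, ← e2]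
      ring
    rw [h4, ofReal_re, show p - 2 - 2 = p - 4 by ring]
    simp only [map_zero, zero_mul, zero_add]
    field_simp
  have hneg : -(2 * (p - 2) ^ 2 * ‖a‖ ^ (p - 4) * (‖a‖ ^ 2 * ‖b‖ ^ 2)) < 0 := by
    have : 0 < (p - 2) ^ 2 := by
      have := sub_ne_zero.2 hp
      positivity
    have : 0 < ‖a‖ ^ (p - 4) := Real.rpow_pos_of_pos ha' _
    simp only [Left.neg_neg_iff]
    positivity
  -- Keeps all four base points away from zero, where the power of the norm might fail to be
  -- differentiable.
  have hsmall : ∀ᶠ n : ℕ in Filter.atTop, 1 / ((n : ℝ) + 1) * ‖b‖ < ‖a‖ := by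
    have h := (tendsto_one_div_add_atTop_nhds_zero_nat (𝕜 := ℝ)).mul_const ‖b‖
    rw [zero_mul] at h
    exact h.eventually (gt_mem_nhds ha')
  obtain ⟨n, hn, hn'⟩ := ((eventually_lt_of_hasDerivAt_neg hΓ hneg).and hsmall).exists
  rw [hΓ0] at hn
  set s : ℝ := 1 / ((n : ℝ) + 1) with hs
  have hs0 : 0 < s := by positivity
  have hne : ∀ k, a + z k * ((s : 𝕜) * b) ≠ 0 := by
    intro k h0
    have : ‖a‖ = s * ‖b‖ := by
      rw [eq_neg_of_add_eq_zero_left h0, norm_neg, norm_mul, norm_mul, norm_fourthRoot h𝕜,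
        norm_ofReal, abs_of_pos hs0, one_mul]
    linarith
  have hQ : HasDerivAt (fun t : ℝ => ∑ k, ‖a + z k * ((s : 𝕜) * b) +
      (t : 𝕜) * (conj (z k) * c)‖ ^ p) (p * Γ s) 0 := by
    have h := HasDerivAt.fun_sum (u := Finset.univ) fun k _ =>
      hasDerivAt_norm_rpow (hne k) (conj (z k) * c) p
    refine h.congr_deriv ?_
    simp only [Γ, Finset.mul_sum]
    refine Finset.sum_congr rfl fun k _ => ?_
    have e1 : (s : 𝕜) * (z k * b) = z k * ((s : 𝕜) * b) := by ring
    have e2 : conj (z k) * c * conj (a + z k * ((s : 𝕜) * b)) = conj (z k) * c * conj a +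
        (s : 𝕜) * (conj (z k) * conj (z k) * (c * conj b)) := by
      simp only [map_add, map_mul, conj_ofReal]
      ring
    rw [e1, e2, map_add, re_ofReal_mul]
    ring
  obtain ⟨m, hm⟩ := (eventually_lt_of_hasDerivAt_neg hQ (mul_neg_of_pos_of_neg hp0 hn)).exists
  refine ⟨n, m, ?_⟩
  simp only [ofReal_zero, zero_mul, add_zero] at hm
  refine lt_of_eq_of_lt (Finset.sum_congr rfl fun k _ => ?_) hm
  rw [mul_left_comm (conj (z k))]

end Rotations

section LpRotations

variable {𝕜 : Type*} [RCLike 𝕜] {E : Type*} [NormedAddCommGroup E] [NormedSpace 𝕜 E]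

open RCLike ComplexConjugate

/-- Applying `P₁ + z P₂` to `ξ + η` shows that no rotated sum exceeds `‖ξ + η‖`. Conversely, the
opposite rotation sends `ξ + zη + z̄ζ` to `ξ + η` plus terms with factors `z̄` and `z̄²`, which
average out over the fourth roots. By Jensen's inequality no perturbation of this twisted shape can
lower the sum. -/
theorem sum_norm_rpow_le_of_rotations (h𝕜 : IsComplexField 𝕜) {P₁ P₂ : E →L[𝕜] E}
    (hP : ∀ z : 𝕜, ‖z‖ = 1 → ‖P₁ + z • P₂‖ ≤ 1) {ξ η : E} (h₁ : P₁ ξ = ξ) (h₂ : P₂ ξ = 0)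
    (h₃ : P₁ η = 0) (h₄ : P₂ η = η) {p : ℝ} (hp : 1 ≤ p) (ζ : E) :
    ∑ k, ‖ξ + fourthRoot 𝕜 k • η‖ ^ p ≤
      ∑ k, ‖ξ + fourthRoot 𝕜 k • η + conj (fourthRoot 𝕜 k) • ζ‖ ^ p := by
  set z := fourthRoot 𝕜 with hz
  have hzn : ∀ k, ‖z k‖ = 1 := norm_fourthRoot h𝕜
  have hle : ∀ (c : 𝕜) (v : E), ‖c‖ = 1 → ‖(P₁ + c • P₂) v‖ ≤ ‖v‖ := fun c v hc => by
    simpa using ((P₁ + c • P₂).le_of_opNorm_le (hP c hc) v)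
  have h1 : ∀ k, ‖ξ + z k • η‖ ≤ ‖ξ + η‖ := fun k => by
    simpa [h₁, h₂, h₃, h₄] using hle (z k) (ξ + η) (hzn k)
  -- The perturbed vectors rotated back: contractivity bounds their norms by those of the perturbed
  -- vectors, and their mean is exactly `ξ + η`.
  let v : Fin 4 → E := fun k => (P₁ + conj (z k) • P₂) (ξ + z k • η + conj (z k) • ζ)
  have hv : ∀ k, v k = ξ + η + (conj (z k) • P₁ ζ + (conj (z k) * conj (z k)) • P₂ ζ) := by
    intro k
    have := conj_fourthRoot_mul h𝕜 k
    simp only [v, map_add, map_smul, add_apply, smul_apply,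
      h₁, h₂, h₃, h₄, smul_zero, zero_add, add_zero, smul_add,
      smul_smul]
    rw [mul_comm (z k), this, one_smul]
  have hsum : ∑ k, v k = (4 : 𝕜) • (ξ + η) := by
    simp only [hv, Finset.sum_add_distrib, ← Finset.sum_smul, sum_conj_fourthRoot,
      sum_conj_fourthRoot_sq h𝕜, hz, zero_smul, add_zero]
    simp [← Nat.cast_smul_eq_nsmul 𝕜]
  have h4 : 4 * ‖ξ + η‖ ≤ ∑ k, ‖v k‖ := by
    have := norm_sum_le Finset.univ v
    rw [hsum, norm_smul] at this
    simpa using this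
  have hjensen : 4 * ‖ξ + η‖ ^ p ≤ ∑ k, ‖v k‖ ^ p := by
    have h := Real.rpow_arith_mean_le_arith_mean_rpow Finset.univ (fun _ : Fin 4 => 1 / 4)
      (fun k => ‖v k‖) (fun _ _ => by norm_num) (by simp) (fun _ _ => norm_nonneg _) hp
    rw [← Finset.mul_sum, ← Finset.mul_sum] at h
    have h5 : ‖ξ + η‖ ^ p ≤ (1 / 4 * ∑ k, ‖v k‖) ^ p := by
      gcongr
      linarith
    linarith
  calc ∑ k, ‖ξ + z k • η‖ ^ p ≤ ∑ _k : Fin 4, ‖ξ + η‖ ^ p := by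
        gcongr with k
        exact h1 k
    _ = 4 * ‖ξ + η‖ ^ p := by simp
    _ ≤ ∑ k, ‖v k‖ ^ p := hjensen
    _ ≤ _ := by
        gcongr with k
        exact hle _ _ (by rw [norm_conj, hzn])

variable {Ω : Type*} [MeasurableSpace Ω] {μ : Measure Ω} {p : ℝ≥0∞}

theorem integrable_norm_rpow (hp0 : p ≠ 0) (hp : p ≠ ∞) (f : Lp 𝕜 p μ) :
    Integrable (fun x => ‖f x‖ ^ p.toReal) μ :=
  (Lp.memLp f).integrable_norm_rpow hp0 hp

theorem norm_rpow_eq_integral (hp0 : p ≠ 0) (hp : p ≠ ∞) (f : Lp 𝕜 p μ) :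
    ‖f‖ ^ p.toReal = ∫ x, ‖f x‖ ^ p.toReal ∂μ := by
  have h0 : 0 ≤ ∫ x, ‖f x‖ ^ p.toReal ∂μ := integral_nonneg fun x => by positivity
  rw [Lp.norm_def, (Lp.memLp f).eLpNorm_eq_integral_rpow_norm hp0 hp,
    ENNReal.toReal_ofReal (by positivity), ← Real.rpow_mul h0,
    inv_mul_cancel₀ (ENNReal.toReal_pos hp0 hp).ne', Real.rpow_one]

theorem measurable_decreasingDirection (t : ℝ) {f g : Ω → 𝕜} (hf : Measurable f)
    (hg : Measurable g) : Measurable fun x => decreasingDirection t (f x) (g x) := by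
  unfold decreasingDirection
  have : Measurable fun x => conj (g x) := continuous_conj.measurable.comp hg
  have h2 : Measurable fun x => ((-(t - 2) / ‖f x‖ ^ 2 : ℝ) : 𝕜) :=
    continuous_ofReal.measurable.comp (by fun_prop)
  fun_prop

/-- If `P₁ + z P₂` is a contraction of a complex `L^p`-space, `p ≠ 2`, for all `|z| = 1`, then the
vectors fixed by `P₁` and killed by `P₂` are disjoint from those fixed by `P₂` and killed
by `P₁`. -/
theorem ae_eq_zero_or_eq_zero_of_rotations [Fact (1 ≤ p)] (h𝕜 : IsComplexField 𝕜) (hp : p ≠ ∞)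
    (hp2 : p ≠ 2)
    {P₁ P₂ : Lp 𝕜 p μ →L[𝕜] Lp 𝕜 p μ} (hP : ∀ z : 𝕜, ‖z‖ = 1 → ‖P₁ + z • P₂‖ ≤ 1)
    {ξ η : Lp 𝕜 p μ} (h₁ : P₁ ξ = ξ) (h₂ : P₂ ξ = 0) (h₃ : P₁ η = 0) (h₄ : P₂ η = η) :
    ∀ᵐ x ∂μ, ξ x = 0 ∨ η x = 0 := by
  have hp1 : 1 ≤ p := Fact.out
  have hp0 : p ≠ 0 := (one_pos.trans_le hp1).ne'
  have ht1 : 1 ≤ p.toReal := by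
    rw [← ENNReal.toReal_one]
    exact ENNReal.toReal_mono hp hp1
  have ht0 : 0 < p.toReal := one_pos.trans_le ht1
  have ht2 : p.toReal ≠ 2 := fun h => hp2 (by
    rw [← ENNReal.ofReal_toReal hp, h]; simp)
  have hξ : Measurable ξ := (Lp.stronglyMeasurable ξ).measurable
  have hη : Measurable η := (Lp.stronglyMeasurable η).measurable
  set t := p.toReal with ht
  set z := fourthRoot 𝕜 with hz
  have key : ∀ n m : ℕ, ∀ᵐ x ∂μ, ¬ (
      ∑ k, ‖ξ x + z k * ((1 / ((n : ℝ) + 1) : ℝ) * η x) +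
        conj (z k) * ((1 / ((m : ℝ) + 1) : ℝ) * decreasingDirection t (ξ x) (η x))‖ ^ t <
      ∑ k, ‖ξ x + z k * ((1 / ((n : ℝ) + 1) : ℝ) * η x)‖ ^ t) := by
    intro n m
    set s : ℝ := 1 / ((n : ℝ) + 1)
    set ε : ℝ := 1 / ((m : ℝ) + 1)
    -- The pointwise decreasing direction lies in `L^p`, being dominated by a constant multiple of
    -- `|η|`.
    set c : Ω → 𝕜 := fun x => (ε : 𝕜) * decreasingDirection t (ξ x) (η x) with hc
    have hcm : Measurable c := (measurable_decreasingDirection t hξ hη).const_mul _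
    -- The perturbation is switched on only where it strictly lowers the pointwise sum. The norm
    -- inequality forbids an overall decrease, so this set is null.
    set A : Set Ω := {x | ∑ k, ‖ξ x + z k * ((s : 𝕜) * η x) + conj (z k) * c x‖ ^ t <
      ∑ k, ‖ξ x + z k * ((s : 𝕜) * η x)‖ ^ t} with hA
    have hAm : MeasurableSet A := measurableSet_lt (by fun_prop) (by fun_prop)
    have hcL : MemLp (A.indicator c) p μ := by
      refine MemLp.indicator hAm ?_
      refine MemLp.of_le_mul (c := |ε| * |t - 2|) (Lp.memLp η) hcm.aestronglyMeasurable
        (Filter.Eventually.of_forall fun x => ?_)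
      rw [hc, norm_mul, norm_ofReal, mul_assoc]
      exact mul_le_mul_of_nonneg_left (norm_decreasingDirection_le _ _ _) (abs_nonneg _)
    set ζ : Lp 𝕜 p μ := hcL.toLp with hζ
    have hineq := sum_norm_rpow_le_of_rotations h𝕜 hP (η := (s : 𝕜) • η) h₁ h₂
      (by rw [map_smul, h₃, smul_zero]) (by rw [map_smul, h₄]) ht1 ζ
    simp only [ht, norm_rpow_eq_integral hp0 hp] at hineq
    rw [← integral_finsetSum _ fun k _ => integrable_norm_rpow hp0 hp _,
      ← integral_finsetSum _ fun k _ => integrable_norm_rpow hp0 hp _, ← sub_nonneg,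
      ← integral_sub (integrable_finsetSum _ fun k _ => integrable_norm_rpow hp0 hp _)
      (integrable_finsetSum _ fun k _ => integrable_norm_rpow hp0 hp _)] at hineq
    have hae1 : ∀ k, ∀ᵐ x ∂μ, (ξ + z k • ((s : 𝕜) • η) : Lp 𝕜 p μ) x =
        ξ x + z k * ((s : 𝕜) * η x) := by
      intro k
      filter_upwards [Lp.coeFn_add ξ (z k • ((s : 𝕜) • η)), Lp.coeFn_smul (z k) ((s : 𝕜) • η),
        Lp.coeFn_smul (s : 𝕜) η] with x e1 e2 e3
      rw [e1, Pi.add_apply, e2, Pi.smul_apply, e3, Pi.smul_apply, smul_eq_mul, smul_eq_mul]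
    have hae2 : ∀ k, ∀ᵐ x ∂μ, (ξ + z k • ((s : 𝕜) • η) + conj (z k) • ζ : Lp 𝕜 p μ) x =
        ξ x + z k * ((s : 𝕜) * η x) + conj (z k) * A.indicator c x := by
      intro k
      filter_upwards [hae1 k, Lp.coeFn_add (ξ + z k • ((s : 𝕜) • η)) (conj (z k) • ζ),
        Lp.coeFn_smul (conj (z k)) ζ, hcL.coeFn_toLp] with x e1 e2 e3 e4
      rw [e2, Pi.add_apply, e1, e3, Pi.smul_apply, e4, smul_eq_mul]
    have hae1' := ae_all_iff.2 hae1
    have hae2' := ae_all_iff.2 hae2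
    set H : Ω → ℝ := fun x => ∑ k, ‖(ξ + z k • ((s : 𝕜) • η) + conj (z k) • ζ : Lp 𝕜 p μ) x‖ ^ t -
      ∑ k, ‖(ξ + z k • ((s : 𝕜) • η) : Lp 𝕜 p μ) x‖ ^ t with hH
    have hHi : Integrable H μ :=
      (integrable_finsetSum _ fun k _ => integrable_norm_rpow hp0 hp _).sub
        (integrable_finsetSum _ fun k _ => integrable_norm_rpow hp0 hp _)
    have hH0 : ∀ᵐ x ∂μ, 0 ≤ -H x ∧ (x ∈ A → 0 < -H x) := by
      filter_upwards [hae1', hae2'] with x e1 e2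
      simp only [hH, e1, e2]
      by_cases hx : x ∈ A
      · rw [Set.indicator_of_mem hx]
        have hx' : ∑ k, ‖ξ x + z k * ((s : 𝕜) * η x) + conj (z k) * c x‖ ^ t <
          ∑ k, ‖ξ x + z k * ((s : 𝕜) * η x)‖ ^ t := hx
        exact ⟨by linarith, fun _ => by linarith⟩
      · rw [Set.indicator_of_notMem hx]
        exact ⟨by simp, fun h => (hx h).elim⟩
    -- The integrand is nonnegative by the choice of `A`, while the rotation inequality says that
    -- its integral is at most zero.
    have hz0 : ∫ x, -H x ∂μ = 0 := by
      refine le_antisymm ?_ (integral_nonneg_of_ae (hH0.mono fun x h => h.1))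
      rw [integral_neg]
      exact neg_nonpos.2 hineq
    have hz1 := (integral_eq_zero_iff_of_nonneg_ae (hH0.mono fun x h => h.1) hHi.neg).1 hz0
    filter_upwards [hz1, hH0] with x hx1 hx2 hxA
    have := hx2.2 hxA
    rw [Pi.zero_apply] at hx1
    exact this.ne' hx1
  -- Off a countable union of null sets no pair of step sizes decreases the sum, which contradicts
  -- `exists_sum_rpow_lt` wherever both values are nonzero.
  filter_upwards [ae_all_iff.2 fun n => ae_all_iff.2 (key n)] with x hx
  by_contra! hcon
  obtain ⟨n, m, hnm⟩ := exists_sum_rpow_lt h𝕜 ht0 ht2 hcon.1 hcon.2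
  exact hx n m hnm

end LpRotations

/-! ### Rotations and `ℓ^∞`-estimates for the supremum norm. -/

section SupRotations

variable {𝕜 : Type*} [RCLike 𝕜] {E : Type*} [NormedAddCommGroup E] [NormedSpace 𝕜 E]

open RCLike ComplexConjugate

/-- The space `E` of functions with the supremum norm has a continuous functional calculus in two
variables: approximations of the coordinates by averages over the fourth roots of unity can be
carried out in `E`. -/
def HasRotationCalculus (𝕜 : Type*) [RCLike 𝕜] (E : Type*) [NormedAddCommGroup E]
    [NormedSpace 𝕜 E] : Prop :=
  ∀ (ξ η : E) (M θ : ℝ) (φ : Fin 4 → 𝕜 × 𝕜 → 𝕜), ‖ξ‖ ≤ 1 → ‖η‖ ≤ 1 →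
    (∀ z : 𝕜, ‖z‖ = 1 → ‖ξ + z • η‖ ≤ M) → 0 ≤ θ → (∀ k, Continuous (φ k)) →
    (∀ k, φ k 0 = 0) →
    (∀ a b : 𝕜, ‖a‖ ≤ 1 → ‖b‖ ≤ 1 → ‖a‖ + ‖b‖ ≤ M → (∀ k, ‖φ k (a, b)‖ ≤ 1) ∧
      ‖a - 4⁻¹ * ∑ k, φ k (a, b)‖ ≤ θ ∧
      ‖b - 4⁻¹ * ∑ k, conj (fourthRoot 𝕜 k) * φ k (a, b)‖ ≤ θ) →
    ∃ h : Fin 4 → E, (∀ k, ‖h k‖ ≤ 1) ∧ ‖ξ - (4⁻¹ : 𝕜) • ∑ k, h k‖ ≤ θ ∧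
      ‖η - (4⁻¹ : 𝕜) • ∑ k, conj (fourthRoot 𝕜 k) • h k‖ ≤ θ

/-- If `‖a + z b‖ ≤ M` for all unimodular `z`, then `‖a‖ + ‖b‖ ≤ M`. -/
theorem norm_add_norm_le_of_rotations {a b : 𝕜} {M : ℝ}
    (h : ∀ z : 𝕜, ‖z‖ = 1 → ‖a + z * b‖ ≤ M) : ‖a‖ + ‖b‖ ≤ M := by
  by_cases hb : b = 0
  · simpa [hb] using h 1 (by simp)
  by_cases ha : a = 0
  · simpa [ha] using h 1 (by simp)
  have ha' : (‖a‖ : 𝕜) ≠ 0 := by simpa using ha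
  have hb' : (‖b‖ : 𝕜) ≠ 0 := by simpa using hb
  have h1 := h ((a / ‖a‖) * (‖b‖ / b)) (by
    have := norm_ne_zero_iff.2 ha
    have := norm_ne_zero_iff.2 hb
    simp only [norm_mul, norm_div, norm_ofReal, abs_norm]
    field_simp)
  have h2 : a + a / ‖a‖ * (‖b‖ / b) * b = (a / ‖a‖) * ((‖a‖ + ‖b‖ : ℝ) : 𝕜) := by
    push_cast
    field_simp
  rw [h2, norm_mul, norm_div, norm_ofReal, norm_ofReal, abs_norm,
    div_self (norm_ne_zero_iff.2 ha), one_mul, abs_of_nonneg (by positivity)] at h1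
  exact h1

/-- Expanding the cubic in `a + z b`, every term with a factor `z`, `z̄` or `z²` averages to zero
over the fourth roots. -/
theorem sum_rotated_cubic (h𝕜 : IsComplexField 𝕜) (a b : 𝕜) :
    4⁻¹ * ∑ k, (a + fourthRoot 𝕜 k * b) *
      (3 / 4 - (a + fourthRoot 𝕜 k * b) * conj (a + fourthRoot 𝕜 k * b) / 16) =
    a * (3 / 4 - (a * conj a + 2 * (b * conj b)) / 16) := by
  have hI := h𝕜.I_mul_I
  simp only [fourthRoot, Fin.sum_univ_four, map_add, map_mul]
  simp
  grind

/-- The weight `z̄` selects instead the terms of the cubic that carry exactly one factor `z`; the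
roles of `a` and `b` are exchanged. -/
theorem sum_conj_rotated_cubic (h𝕜 : IsComplexField 𝕜) (a b : 𝕜) :
    4⁻¹ * ∑ k, conj (fourthRoot 𝕜 k) * ((a + fourthRoot 𝕜 k * b) *
      (3 / 4 - (a + fourthRoot 𝕜 k * b) * conj (a + fourthRoot 𝕜 k * b) / 16)) =
    b * (3 / 4 - (b * conj b + 2 * (a * conj a)) / 16) := by
  have hI := h𝕜.I_mul_I
  simp only [fourthRoot, Fin.sum_univ_four, map_add, map_mul]
  simp
  grind

theorem sum_rotated_linear (a b : 𝕜) : 4⁻¹ * ∑ k, (a + fourthRoot 𝕜 k * b) = a := by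
  simp only [fourthRoot, Fin.sum_univ_four]
  simp
  grind

theorem sum_conj_rotated_linear (h𝕜 : IsComplexField 𝕜) (a b : 𝕜) :
    4⁻¹ * ∑ k, conj (fourthRoot 𝕜 k) * (a + fourthRoot 𝕜 k * b) = b := by
  have hI := h𝕜.I_mul_I
  simp only [fourthRoot, Fin.sum_univ_four]
  simp
  grind

/-- The error is `a` times `1/4 + (|a|² + 2|b|²)/16`, and `1/4 + 3/16 = 7/16`. -/
theorem norm_sub_cubic_le {a b : 𝕜} (ha : ‖a‖ ≤ 1) (hb : ‖b‖ ≤ 1) :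
    ‖a - a * (3 / 4 - (a * conj a + 2 * (b * conj b)) / 16)‖ ≤ 7 / 16 := by
  have h : a - a * (3 / 4 - (a * conj a + 2 * (b * conj b)) / 16) =
      a * ((1 / 4 + (‖a‖ ^ 2 + 2 * ‖b‖ ^ 2) / 16 : ℝ) : 𝕜) := by
    rw [mul_conj, mul_conj]
    push_cast
    ring
  rw [h, norm_mul, norm_ofReal, abs_of_nonneg (by positivity)]
  have h1 : ‖a‖ ^ 2 ≤ 1 := pow_le_one₀ (norm_nonneg _) ha
  have h2 : ‖b‖ ^ 2 ≤ 1 := pow_le_one₀ (norm_nonneg _) hb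
  have h3 : 1 / 4 + (‖a‖ ^ 2 + 2 * ‖b‖ ^ 2) / 16 ≤ 7 / 16 := by linarith
  calc _ ≤ 1 * (7 / 16 : ℝ) := mul_le_mul ha h3 (by positivity) zero_le_one
    _ = 7 / 16 := one_mul _

/-- The radial profile `t(3/4 - t²/16)` increases on `[0, 2]` and reaches its maximum `1` at `t =
2`; this fixes the coefficients. -/
theorem norm_cubic_le {w : 𝕜} (hw : ‖w‖ ≤ 2) : ‖w * (3 / 4 - w * conj w / 16)‖ ≤ 1 := by
  have h : (3 / 4 - w * conj w / 16 : 𝕜) = ((3 / 4 - ‖w‖ ^ 2 / 16 : ℝ) : 𝕜) := by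
    rw [mul_conj]
    push_cast
    ring
  have h1 : ‖w‖ ^ 2 ≤ 2 ^ 2 := pow_le_pow_left₀ (norm_nonneg _) hw 2
  rw [h, norm_mul, norm_ofReal, abs_of_nonneg (by linarith)]
  nlinarith [mul_nonneg (sq_nonneg (‖w‖ - 2)) (by positivity : 0 ≤ ‖w‖ + 4)]

/-- Radial soft thresholding. -/
def softThreshold (τ : ℝ) (a : 𝕜) : 𝕜 := a - ((τ / max ‖a‖ τ : ℝ) : 𝕜) * a

theorem continuous_softThreshold {τ : ℝ} (hτ : 0 < τ) :
    Continuous (softThreshold τ : 𝕜 → 𝕜) := by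
  unfold softThreshold
  have h : Continuous fun a : 𝕜 => τ / max ‖a‖ τ :=
    continuous_const.div (by fun_prop) fun a => (hτ.trans_le (le_max_right _ _)).ne'
  exact continuous_id.sub ((continuous_ofReal.comp h).mul continuous_id)

theorem norm_sub_softThreshold_le {τ : ℝ} (hτ : 0 < τ) (a : 𝕜) :
    ‖a - softThreshold τ a‖ ≤ τ := by
  have h0 : 0 < max ‖a‖ τ := hτ.trans_le (le_max_right _ _)
  rw [softThreshold, sub_sub_cancel, norm_mul, norm_ofReal, abs_of_nonneg (by positivity),
    div_mul_eq_mul_div, div_le_iff₀ h0]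
  exact mul_le_mul_of_nonneg_left (le_max_left _ _) hτ.le

theorem norm_softThreshold {τ : ℝ} (hτ : 0 < τ) (a : 𝕜) :
    ‖softThreshold τ a‖ = max (‖a‖ - τ) 0 := by
  have h0 : 0 < max ‖a‖ τ := hτ.trans_le (le_max_right _ _)
  have h : softThreshold τ a = ((1 - τ / max ‖a‖ τ : ℝ) : 𝕜) * a := by
    rw [softThreshold]
    push_cast
    ring
  have h1 : 0 ≤ 1 - τ / max ‖a‖ τ := by
    rw [sub_nonneg, div_le_one h0]
    exact le_max_right _ _
  rw [h, norm_mul, norm_ofReal, abs_of_nonneg h1]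
  rcases le_total ‖a‖ τ with h2 | h2
  · rw [max_eq_right h2, div_self hτ.ne', sub_self, zero_mul, max_eq_right (by linarith)]
  · have h3 : ‖a‖ ≠ 0 := (hτ.trans_le h2).ne'
    rw [max_eq_left h2, max_eq_left (by linarith)]
    field_simp

/-- In a complex space of functions with the supremum norm, contractions `P₁ + z P₂` for all
`|z| = 1` force an estimate of `ℓ^∞` type. -/
theorem norm_add_le_of_rotations (h𝕜 : IsComplexField 𝕜) (hE : HasRotationCalculus 𝕜 E)
    {E₁ E₂ : Set E} (h₁ : ∀ (c : 𝕜), ∀ ξ ∈ E₁, c • ξ ∈ E₁) (h₂ : ∀ (c : 𝕜), ∀ ξ ∈ E₂, c • ξ ∈ E₂)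
    (hP : ∀ ξ ∈ E₁, ∀ η ∈ E₂, ∃ P₁ P₂ : E →L[𝕜] E, P₁ ξ = ξ ∧ P₂ η = η ∧ (∀ v, P₁ v ∈ E₁) ∧
      (∀ v, P₂ v ∈ E₂) ∧ ∀ z : 𝕜, ‖z‖ = 1 → ‖P₁ + z • P₂‖ ≤ 1)
    {ξ η : E} (hξ : ξ ∈ E₁) (hη : η ∈ E₂) {B : ℝ} (hξB : ‖ξ‖ ≤ B) (hηB : ‖η‖ ≤ B) :
    ‖ξ + η‖ ≤ B := by
  -- `M` is the best constant in `‖ξ + η‖ ≤ M max(‖ξ‖, ‖η‖)`. A priori `M ≤ 2`; the aim is `M ≤ 1`.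
  set A : Set ℝ := {t | ∃ ξ ∈ E₁, ∃ η ∈ E₂, ‖ξ‖ ≤ 1 ∧ ‖η‖ ≤ 1 ∧ t = ‖ξ + η‖} with hA
  have hAb : BddAbove A := by
    refine ⟨2, ?_⟩
    rintro _ ⟨ξ, -, η, -, h1, h2, rfl⟩
    exact (norm_add_le _ _).trans (by linarith)
  have hAne : A.Nonempty := ⟨_, (0 : 𝕜) • ξ, h₁ 0 ξ hξ, (0 : 𝕜) • η, h₂ 0 η hη, by simp, by simp,
    rfl⟩
  set M := sSup A with hM
  have hle : ∀ ξ ∈ E₁, ∀ η ∈ E₂, ‖ξ‖ ≤ 1 → ‖η‖ ≤ 1 → ‖ξ + η‖ ≤ M := fun ξ hξ η hη h1 h2 =>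
    le_csSup hAb ⟨ξ, hξ, η, hη, h1, h2, rfl⟩
  have hscale : ∀ ξ ∈ E₁, ∀ η ∈ E₂, ∀ θ, ‖ξ‖ ≤ θ → ‖η‖ ≤ θ → ‖ξ + η‖ ≤ θ * M := by
    intro ξ hξ η hη θ h1 h2
    rcases ((norm_nonneg ξ).trans h1).eq_or_lt with h0 | h0
    · subst h0
      simp [norm_le_zero_iff.1 h1, norm_le_zero_iff.1 h2]
    · have hc : ∀ v : E, ‖((θ⁻¹ : ℝ) : 𝕜) • v‖ = θ⁻¹ * ‖v‖ := fun v => by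
        rw [norm_smul, norm_ofReal, abs_of_pos (inv_pos.2 h0)]
      have h := hle _ (h₁ ((θ⁻¹ : ℝ) : 𝕜) ξ hξ) _ (h₂ ((θ⁻¹ : ℝ) : 𝕜) η hη)
        (by rw [hc, inv_mul_le_iff₀ h0, mul_one]; exact h1)
        (by rw [hc, inv_mul_le_iff₀ h0, mul_one]; exact h2)
      rwa [← smul_add, hc, inv_mul_le_iff₀ h0] at h
  have hM2 : M ≤ 2 := csSup_le hAne (by
    rintro _ ⟨ξ, -, η, -, h1, h2, rfl⟩
    exact (norm_add_le _ _).trans (by linarith))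
  -- one approximation step
  have step : ∀ (M' θ : ℝ) (φ : Fin 4 → 𝕜 × 𝕜 → 𝕜), M ≤ M' → 0 ≤ θ → (∀ k, Continuous (φ k)) →
      (∀ k, φ k 0 = 0) →
      (∀ a b : 𝕜, ‖a‖ ≤ 1 → ‖b‖ ≤ 1 → ‖a‖ + ‖b‖ ≤ M' → (∀ k, ‖φ k (a, b)‖ ≤ 1) ∧
        ‖a - 4⁻¹ * ∑ k, φ k (a, b)‖ ≤ θ ∧
        ‖b - 4⁻¹ * ∑ k, conj (fourthRoot 𝕜 k) * φ k (a, b)‖ ≤ θ) → M ≤ 1 + θ * M := by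
    intro M' θ φ hMM' hθ hφ hφ0 hφb
    refine csSup_le hAne ?_
    rintro _ ⟨ξ, hξ, η, hη, hξ1, hη1, rfl⟩
    obtain ⟨h, hh, hξh, hηh⟩ := hE ξ η M' θ φ hξ1 hη1 (fun z hz =>
      (hle ξ hξ _ (h₂ z η hη) hξ1 (by rwa [norm_smul, hz, one_mul])).trans hMM') hθ hφ hφ0 hφb
    obtain ⟨P₁, P₂, e1, e2, m1, m2, hP⟩ := hP ξ hξ η hη
    -- Each operator is a half sum or half difference of the contractions with `z = 1` and `z = -1`.
    have hn1 : ‖P₁‖ ≤ 1 := by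
      have e : P₁ = (2⁻¹ : 𝕜) • ((P₁ + (1 : 𝕜) • P₂) + (P₁ + (-1 : 𝕜) • P₂)) := by
        rw [one_smul, neg_one_smul, add_add_add_comm, add_neg_cancel, add_zero, ← two_smul 𝕜,
          smul_smul, inv_mul_cancel₀ two_ne_zero, one_smul]
      have h3 := norm_add_le_of_le (hP 1 (by simp)) (hP (-1) (by simp))
      rw [e, norm_smul, norm_inv, RCLike.norm_two]
      linarith
    have hn2 : ‖P₂‖ ≤ 1 := by
      have e : P₂ = (2⁻¹ : 𝕜) • ((P₁ + (1 : 𝕜) • P₂) - (P₁ + (-1 : 𝕜) • P₂)) := by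
        rw [one_smul, neg_one_smul, add_sub_add_left_eq_sub, sub_neg_eq_add, ← two_smul 𝕜,
          smul_smul, inv_mul_cancel₀ two_ne_zero, one_smul]
      have h3 := norm_sub_le_of_le (hP 1 (by simp)) (hP (-1) (by simp))
      rw [e, norm_smul, norm_inv, RCLike.norm_two]
      linarith
    set g₁ := (4⁻¹ : 𝕜) • ∑ k, h k
    set g₂ := (4⁻¹ : 𝕜) • ∑ k, conj (fourthRoot 𝕜 k) • h k
    -- The averages `g₁`, `g₂` approximate `ξ`, `η` up to `θ`. Their images add up to a mean of
    -- contractions applied to the vectors `h k` of norm at most one, and the errors, projected back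
    -- into `E₁` and `E₂`, cost `θ M`.
    have hsplit : ξ + η = (P₁ g₁ + P₂ g₂) + (P₁ (ξ - g₁) + P₂ (η - g₂)) := by
      rw [map_sub, map_sub, e1, e2]
      abel
    have hmain : ‖P₁ g₁ + P₂ g₂‖ ≤ 1 := by
      have e : P₁ g₁ + P₂ g₂ =
          (4⁻¹ : 𝕜) • ∑ k, (P₁ + conj (fourthRoot 𝕜 k) • P₂) (h k) := by
        simp only [g₁, g₂, map_smul, map_sum, ← smul_add, ← Finset.sum_add_distrib, add_apply,
          smul_apply]
      rw [e, norm_smul, norm_inv]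
      have h4 : ‖∑ k, (P₁ + conj (fourthRoot 𝕜 k) • P₂) (h k)‖ ≤ ∑ _k : Fin 4, (1 : ℝ) := by
        refine norm_sum_le_of_le _ fun k _ => ?_
        have := (P₁ + conj (fourthRoot 𝕜 k) • P₂).le_of_opNorm_le
          (hP (conj (fourthRoot 𝕜 k)) (by rw [norm_conj, norm_fourthRoot h𝕜])) (h k)
        rw [one_mul] at this
        exact this.trans (hh k)
      have h5 : ‖(4 : 𝕜)‖ = 4 := by simp
      rw [h5]
      simp only [Finset.sum_const, Finset.card_univ, Fintype.card_fin, nsmul_eq_mul, mul_one,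
        Nat.cast_ofNat] at h4
      linarith
    have hrest : ‖P₁ (ξ - g₁) + P₂ (η - g₂)‖ ≤ θ * M := by
      refine hscale _ (m1 _) _ (m2 _) θ ?_ ?_
      · exact (P₁.le_of_opNorm_le hn1 _).trans (by rwa [one_mul])
      · exact (P₂.le_of_opNorm_le hn2 _).trans (by rwa [one_mul])
    rw [hsplit]
    exact (norm_add_le _ _).trans (add_le_add hmain hrest)
  -- The cubic works under the trivial bound `M ≤ 2` with error `7/16`, and `M ≤ 1 + (7/16) M` gives
  -- `16/9`. A bound strictly below `2` is what the thresholding argument needs.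
  have hM1 : M ≤ 16 / 9 := by
    have := step 2 (7 / 16) (fun k q => (q.1 + fourthRoot 𝕜 k * q.2) *
      (3 / 4 - (q.1 + fourthRoot 𝕜 k * q.2) * conj (q.1 + fourthRoot 𝕜 k * q.2) / 16)) hM2
      (by norm_num) (fun k => by
        have : Continuous (fun q : 𝕜 × 𝕜 => conj (q.1 + fourthRoot 𝕜 k * q.2)) :=
          continuous_conj.comp (by fun_prop)
        fun_prop) (fun k => by simp) (fun a b ha hb _ => ⟨fun k => norm_cubic_le ?_, ?_, ?_⟩)
    · linarith
    · refine (norm_add_le _ _).trans ?_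
      rw [norm_mul, norm_fourthRoot h𝕜]
      linarith
    · rw [sum_rotated_cubic h𝕜]
      exact norm_sub_cubic_le ha hb
    · rw [sum_conj_rotated_cubic h𝕜]
      exact norm_sub_cubic_le hb ha
  have hM3 : M ≤ 1 := by
    by_contra! hcon
    -- Thresholding both coordinates by `τ` lowers `‖a‖ + ‖b‖ ≤ M` to at most `1`. The resulting `M
    -- ≤ 1 + τ M` would force `M ≥ 2` if `M > 1`.
    set τ := (M - 1) / 2 with hτ
    have hτ0 : 0 < τ := by rw [hτ]; linarith
    have := step M τ (fun k q => softThreshold τ q.1 + fourthRoot 𝕜 k * softThreshold τ q.2)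
      le_rfl hτ0.le (fun k => by
        have := continuous_softThreshold (𝕜 := 𝕜) hτ0
        fun_prop) (fun k => by simp [softThreshold]) (fun a b ha hb hab => ⟨fun k => ?_, ?_, ?_⟩)
    · rw [hτ] at this
      nlinarith
    · refine (norm_add_le _ _).trans ?_
      rw [norm_mul, norm_fourthRoot h𝕜, one_mul, norm_softThreshold hτ0, norm_softThreshold hτ0]
      rcases max_cases (‖a‖ - τ) 0 with h | h <;> rcases max_cases (‖b‖ - τ) 0 with h' | h' <;>
        linarith
    · rw [sum_rotated_linear]
      exact norm_sub_softThreshold_le hτ0 a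
    · rw [sum_conj_rotated_linear h𝕜]
      exact norm_sub_softThreshold_le hτ0 b
  refine (hscale ξ hξ η hη B hξB hηB).trans ?_
  exact mul_le_of_le_one_right ((norm_nonneg _).trans hξB) hM3

end SupRotations

/-! ### Functional calculus in `C₀` and `L^∞`, and sums of functions with disjoint supports. -/

section SupSpaces

variable {𝕜 : Type*} [RCLike 𝕜] {Ω : Type*}

open RCLike ComplexConjugate

theorem norm_c0_le [TopologicalSpace Ω] {f : C₀(Ω, 𝕜)} {B : ℝ} (hB : 0 ≤ B)
    (h : ∀ x, ‖f x‖ ≤ B) : ‖f‖ ≤ B := by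
  rw [← ZeroAtInftyContinuousMap.norm_toBCF_eq_norm]
  exact (BoundedContinuousFunction.norm_le hB).2 h

theorem norm_apply_le_c0 [TopologicalSpace Ω] (f : C₀(Ω, 𝕜)) (x : Ω) : ‖f x‖ ≤ ‖f‖ := by
  rw [← ZeroAtInftyContinuousMap.norm_toBCF_eq_norm]
  exact f.toBCF.norm_coe_le_norm x

theorem sum_apply_c0 [TopologicalSpace Ω] {ι : Type*} (s : Finset ι) (f : ι → C₀(Ω, 𝕜)) (x : Ω) :
    (∑ i ∈ s, f i) x = ∑ i ∈ s, f i x := by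
  induction s using Finset.cons_induction with
  | empty => simp
  | cons a s ha ih => simp [Finset.sum_cons, ih]

theorem hasRotationCalculus_c0 [TopologicalSpace Ω] : HasRotationCalculus 𝕜 C₀(Ω, 𝕜) := by
  intro ξ η M θ φ hξ hη hM hθ hφ hφ0 hφb
  have hb : ∀ x, ‖ξ x‖ ≤ 1 ∧ ‖η x‖ ≤ 1 ∧ ‖ξ x‖ + ‖η x‖ ≤ M := fun x =>
    ⟨(norm_apply_le_c0 ξ x).trans hξ, (norm_apply_le_c0 η x).trans hη,
      norm_add_norm_le_of_rotations fun z hz =>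
        (norm_apply_le_c0 (ξ + z • η) x).trans (hM z hz)⟩
  let h : Fin 4 → C₀(Ω, 𝕜) := fun k =>
    { toFun := fun x => φ k (ξ x, η x)
      continuous_toFun := (hφ k).comp (ξ.continuous.prodMk η.continuous)
      -- The condition `φ k 0 = 0` is used here, to stay inside the functions vanishing at infinity.
      zero_at_infty' := by
        have h1 := (hφ k).continuousAt.tendsto.comp ((zero_at_infty ξ).prodMk_nhds (zero_at_infty η))
        rw [← hφ0 k]
        exact h1 }
  refine ⟨h, fun k => norm_c0_le zero_le_one fun x => ?_, norm_c0_le hθ fun x => ?_,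
    norm_c0_le hθ fun x => ?_⟩
  · exact (hφb _ _ (hb x).1 (hb x).2.1 (hb x).2.2).1 k
  · have := (hφb _ _ (hb x).1 (hb x).2.1 (hb x).2.2).2.1
    rw [ZeroAtInftyContinuousMap.sub_apply, ZeroAtInftyContinuousMap.smul_apply, sum_apply_c0]
    exact this
  · have := (hφb _ _ (hb x).1 (hb x).2.1 (hb x).2.2).2.2
    rw [ZeroAtInftyContinuousMap.sub_apply, ZeroAtInftyContinuousMap.smul_apply, sum_apply_c0]
    exact this

variable [MeasurableSpace Ω] {μ : Measure Ω} {p : ℝ≥0∞}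

theorem norm_lpTop_le {f : Lp 𝕜 ∞ μ} {B : ℝ} (hB : 0 ≤ B) (h : ∀ᵐ x ∂μ, ‖f x‖ ≤ B) :
    ‖f‖ ≤ B := by
  rw [Lp.norm_def, eLpNorm_exponent_top]
  refine ENNReal.toReal_le_of_le_ofReal hB ?_
  exact eLpNormEssSup_le_of_ae_bound h

theorem ae_norm_le_lpTop (f : Lp 𝕜 ∞ μ) : ∀ᵐ x ∂μ, ‖f x‖ ≤ ‖f‖ := by
  filter_upwards [ae_le_eLpNormEssSup (f := f) (μ := μ)] with x hx
  rw [Lp.norm_def, eLpNorm_exponent_top]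
  have h := ENNReal.toReal_mono (by
    rw [← eLpNorm_exponent_top]
    exact (Lp.eLpNorm_lt_top f).ne) hx
  rwa [toReal_enorm] at h

theorem coeFn_sum_lp {ι : Type*} (s : Finset ι) (f : ι → Lp 𝕜 p μ) :
    ∀ᵐ x ∂μ, (∑ i ∈ s, f i : Lp 𝕜 p μ) x = ∑ i ∈ s, f i x := by
  induction s using Finset.cons_induction with
  | empty =>
    filter_upwards [Lp.coeFn_zero 𝕜 p μ] with x hx
    simpa using hx
  | cons a s ha ih =>
    rw [Finset.sum_cons]
    filter_upwards [ih, Lp.coeFn_add (f a) (∑ i ∈ s, f i)] with x h1 h2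
    rw [h2, Finset.sum_cons, ← h1]
    rfl

theorem hasRotationCalculus_lpTop : HasRotationCalculus 𝕜 (Lp 𝕜 ∞ μ) := by
  intro ξ η M θ φ hξ hη hM hθ hφ hφ0 hφb
  -- The norm bound for one `z` holds only almost everywhere. A countable dense set of unimodular
  -- `z` has a common null set, and closedness of the condition recovers all `z`.
  obtain ⟨D, hDc, hD⟩ := TopologicalSpace.exists_countable_dense (Metric.sphere (0 : 𝕜) 1)
  have hrot : ∀ᵐ x ∂μ, ∀ z ∈ D, ‖ξ x + (z : 𝕜) * η x‖ ≤ M := by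
    rw [ae_ball_iff hDc]
    intro z hz
    filter_upwards [ae_norm_le_lpTop (ξ + (z : 𝕜) • η), Lp.coeFn_add ξ ((z : 𝕜) • η),
      Lp.coeFn_smul (z : 𝕜) η] with x h1 h2 h3
    rw [h2, Pi.add_apply, h3] at h1
    exact h1.trans (hM _ (by simp))
  have hb : ∀ᵐ x ∂μ, ‖ξ x‖ ≤ 1 ∧ ‖η x‖ ≤ 1 ∧ ‖ξ x‖ + ‖η x‖ ≤ M := by
    filter_upwards [hrot, ae_norm_le_lpTop ξ, ae_norm_le_lpTop η] with x h1 h2 h3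
    refine ⟨h2.trans hξ, h3.trans hη, norm_add_norm_le_of_rotations fun z hz => ?_⟩
    have hcl : IsClosed {z : Metric.sphere (0 : 𝕜) 1 | ‖ξ x + (z : 𝕜) * η x‖ ≤ M} :=
      isClosed_le (by fun_prop) continuous_const
    exact (hcl.closure_subset_iff.2 h1) (hD ⟨z, by simpa using hz⟩)
  have hmem : ∀ k, MemLp (fun x => φ k (ξ x, η x)) ∞ μ := fun k =>
    memLp_top_of_bound ((hφ k).comp_aestronglyMeasurable
      ((Lp.aestronglyMeasurable ξ).prodMk (Lp.aestronglyMeasurable η))) 1 (by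
        filter_upwards [hb] with x hx
        exact (hφb _ _ hx.1 hx.2.1 hx.2.2).1 k)
  have hval : ∀ᵐ x ∂μ, ∀ k, (hmem k).toLp _ x = φ k (ξ x, η x) :=
    ae_all_iff.2 fun k => (hmem k).coeFn_toLp
  refine ⟨fun k => (hmem k).toLp _, fun k => norm_lpTop_le zero_le_one ?_,
    norm_lpTop_le hθ ?_, norm_lpTop_le hθ ?_⟩
  · filter_upwards [hb, hval] with x hx h1
    rw [h1]
    exact (hφb _ _ hx.1 hx.2.1 hx.2.2).1 k
  · filter_upwards [hb, hval, Lp.coeFn_sub ξ ((4⁻¹ : 𝕜) • ∑ k, (hmem k).toLp _),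
      Lp.coeFn_smul (4⁻¹ : 𝕜) (∑ k, (hmem k).toLp _),
      coeFn_sum_lp Finset.univ fun k => (hmem k).toLp _] with x hx h1 h2 h3 h4
    rw [h2, Pi.sub_apply, h3, Pi.smul_apply, h4, smul_eq_mul]
    simp only [h1]
    exact (hφb _ _ hx.1 hx.2.1 hx.2.2).2.1
  · have h5 : ∀ᵐ x ∂μ, ∀ k, (conj (fourthRoot 𝕜 k) • (hmem k).toLp _ : Lp 𝕜 ∞ μ) x =
        conj (fourthRoot 𝕜 k) * φ k (ξ x, η x) := by
      refine ae_all_iff.2 fun k => ?_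
      filter_upwards [hval, Lp.coeFn_smul (conj (fourthRoot 𝕜 k)) ((hmem k).toLp _)] with x h1 h2
      rw [h2, Pi.smul_apply, h1, smul_eq_mul]
    filter_upwards [hb, h5, Lp.coeFn_sub η
        ((4⁻¹ : 𝕜) • ∑ k, conj (fourthRoot 𝕜 k) • (hmem k).toLp _),
      Lp.coeFn_smul (4⁻¹ : 𝕜) (∑ k, conj (fourthRoot 𝕜 k) • (hmem k).toLp _),
      coeFn_sum_lp Finset.univ fun k => conj (fourthRoot 𝕜 k) • (hmem k).toLp _]
      with x hx h1 h2 h3 h4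
    rw [h2, Pi.sub_apply, h3, Pi.smul_apply, h4, smul_eq_mul]
    simp only [h1]
    exact (hφb _ _ hx.1 hx.2.1 hx.2.2).2.2

/-- A function of finitely many scalars, at most one of which is nonzero. -/
theorem exists_sum_eq_of_disjoint {ι : Type*} [Fintype ι] {c : ι → 𝕜}
    (h : Pairwise fun i j => c i = 0 ∨ c j = 0) :
    (∀ i, c i = 0) ∨ ∃ i, c i ≠ 0 ∧ ∀ j ≠ i, c j = 0 := by
  by_cases h0 : ∀ i, c i = 0
  · exact Or.inl h0
  · push Not at h0
    obtain ⟨i, hi⟩ := h0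
    exact Or.inr ⟨i, hi, fun j hj => (h hj).resolve_right hi⟩

theorem norm_sum_rpow_of_disjoint {ι : Type*} [Fintype ι] {c : ι → 𝕜}
    (h : Pairwise fun i j => c i = 0 ∨ c j = 0) {t : ℝ} (ht : 0 < t) :
    ‖∑ i, c i‖ ^ t = ∑ i, ‖c i‖ ^ t := by
  rcases exists_sum_eq_of_disjoint h with h0 | ⟨i, -, hi⟩
  · simp [h0, Real.zero_rpow ht.ne']
  · rw [Finset.sum_eq_single i (fun j _ hj => hi j hj) (by simp),
      Finset.sum_eq_single i (fun j _ hj => by simp [hi j hj, Real.zero_rpow ht.ne']) (by simp)]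

theorem norm_sum_le_of_disjoint {ι : Type*} [Fintype ι] {c : ι → 𝕜}
    (h : Pairwise fun i j => c i = 0 ∨ c j = 0) {B : ℝ} (hB : 0 ≤ B) (hc : ∀ i, ‖c i‖ ≤ B) :
    ‖∑ i, c i‖ ≤ B := by
  rcases exists_sum_eq_of_disjoint h with h0 | ⟨i, -, hi⟩
  · simpa [h0] using hB
  · rw [Finset.sum_eq_single i (fun j _ hj => hi j hj) (by simp)]
    exact hc i

theorem ae_pairwise {ι : Type*} [Countable ι] {P : ι → ι → Ω → Prop}
    (h : Pairwise fun i j => ∀ᵐ x ∂μ, P i j x) : ∀ᵐ x ∂μ, Pairwise fun i j => P i j x := by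
  unfold Pairwise
  simp only [ae_all_iff]
  exact fun i j hij => h hij

/-- Functions in `L^p` with disjoint supports. -/
theorem norm_sum_rpow_lp_of_disjoint (hp0 : p ≠ 0) (hp : p ≠ ∞) {ι : Type*} [Fintype ι]
    {f : ι → Lp 𝕜 p μ} (h : Pairwise fun i j => ∀ᵐ x ∂μ, f i x = 0 ∨ f j x = 0) :
    ‖∑ i, f i‖ ^ p.toReal = ∑ i, ‖f i‖ ^ p.toReal := by
  simp only [norm_rpow_eq_integral hp0 hp]
  rw [← integral_finsetSum _ fun i _ => integrable_norm_rpow hp0 hp (f i)]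
  refine integral_congr_ae ?_
  filter_upwards [coeFn_sum_lp Finset.univ f, ae_pairwise h] with x h1 h2
  rw [h1, norm_sum_rpow_of_disjoint h2 (ENNReal.toReal_pos hp0 hp)]

theorem norm_sum_lpTop_le_of_disjoint {ι : Type*} [Fintype ι] {f : ι → Lp 𝕜 ∞ μ}
    (h : Pairwise fun i j => ∀ᵐ x ∂μ, f i x = 0 ∨ f j x = 0) {B : ℝ} (hB : 0 ≤ B)
    (hf : ∀ i, ‖f i‖ ≤ B) : ‖∑ i, f i‖ ≤ B := by
  refine norm_lpTop_le hB ?_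
  filter_upwards [coeFn_sum_lp Finset.univ f, ae_pairwise h,
    ae_all_iff.2 fun i => ae_norm_le_lpTop (f i)] with x h1 h2 h3
  rw [h1]
  exact norm_sum_le_of_disjoint h2 hB fun i => (h3 i).trans (hf i)

end SupSpaces

/-! ### Actions of `C_c(X)` by contractions and their `ℓ^p`-type estimates. -/

section TestActions

variable {𝕜 : Type*} [RCLike 𝕜] {X : Type*} [TopologicalSpace X] [T2Space X]
  [LocallyCompactSpace X] {E : Type*} [NormedAddCommGroup E] [NormedSpace 𝕜 E]
  {𝒱 : Set (Set X)} {ρ : C_c(X, ℝ) →+ (E →L[𝕜] E)}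

/-- A multiplicative action of `C_c(X)` on `E` that is contractive on the test functions
subordinate to `𝒱`. -/
structure IsTestAction (𝒱 : Set (Set X)) (ρ : C_c(X, ℝ) →+ (E →L[𝕜] E)) : Prop where
  isOpen : ∀ V ∈ 𝒱, IsOpen V
  map_mul : ∀ a b ξ, ρ (a * b) ξ = ρ a (ρ b ξ)
  norm_le : ∀ a, IsTest 𝒱 a → ‖ρ a‖ ≤ 1

/-- Disjoint test functions act as in an `ℓ^p`-sum, seen from the source. -/
def LowerEstimate (𝒱 : Set (Set X)) (ρ : C_c(X, ℝ) →+ (E →L[𝕜] E)) (p : ℝ) : Prop :=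
  ∀ (n : ℕ) (a : Fin n → C_c(X, ℝ)), DisjointTests 𝒱 a → ∀ ξ, ∑ i, ‖ρ (a i) ξ‖ ^ p ≤ ‖ξ‖ ^ p

/-- Disjoint test functions act as in an `ℓ^p`-sum, seen from the target. -/
def UpperEstimate (𝒱 : Set (Set X)) (ρ : C_c(X, ℝ) →+ (E →L[𝕜] E)) (p : ℝ) : Prop :=
  ∀ (n : ℕ) (a : Fin n → C_c(X, ℝ)), DisjointTests 𝒱 a → ∀ ξ : Fin n → E,
    ‖∑ i, ρ (a i) (ξ i)‖ ^ p ≤ ∑ i, ‖ξ i‖ ^ p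

/-- Disjoint test functions act as in an `ℓ^∞`-sum, seen from the target. -/
def SupEstimate (𝒱 : Set (Set X)) (ρ : C_c(X, ℝ) →+ (E →L[𝕜] E)) : Prop :=
  ∀ (n : ℕ) (a : Fin n → C_c(X, ℝ)), DisjointTests 𝒱 a → ∀ (ξ : Fin n → E) (B : ℝ), 0 ≤ B →
    (∀ i, ‖ξ i‖ ≤ B) → ‖∑ i, ρ (a i) (ξ i)‖ ≤ B

/-- The action is contractive for the supremum norm on combinations of disjointly supported
functions. -/
def IsSupContractive (ρ : C_c(X, ℝ) →+ (E →L[𝕜] E)) : Prop :=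
  ∀ (n : ℕ) (a : Fin n → C_c(X, ℝ)), (∀ i x, 0 ≤ a i x) → (∀ i x, a i x ≤ 1) →
    (Pairwise fun i j => Disjoint (tsupport (a i)) (tsupport (a j))) →
    ∀ c : Fin n → 𝕜, (∀ i, ‖c i‖ ≤ 1) → ‖∑ i, c i • ρ (a i)‖ ≤ 1

namespace IsTestAction

theorem apply_le (h : IsTestAction 𝒱 ρ) {a : C_c(X, ℝ)} (ha : IsTest 𝒱 a) (ξ : E) :
    ‖ρ a ξ‖ ≤ ‖ξ‖ := by
  simpa using (ρ a).le_of_opNorm_le (h.norm_le a ha) ξ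

theorem apply_of_eq_one (h : IsTestAction 𝒱 ρ) {a v : C_c(X, ℝ)}
    (hv : ∀ x ∈ tsupport a, v x = 1) (ξ : E) : ρ v (ρ a ξ) = ρ a ξ := by
  rw [← h.map_mul]
  congr 2
  ext x
  by_cases hx : a x = 0
  · simp [hx]
  · simp [hv x (subset_tsupport _ hx)]

theorem apply_apply_of_eq_one (h : IsTestAction 𝒱 ρ) {a v : C_c(X, ℝ)}
    (hv : ∀ x ∈ tsupport a, v x = 1) (ξ : E) : ρ a (ρ v ξ) = ρ a ξ := by
  rw [← h.map_mul, mul_comm, h.map_mul, h.apply_of_eq_one hv]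

theorem apply_apply_of_disjoint (h : IsTestAction 𝒱 ρ) {a b : C_c(X, ℝ)}
    (hab : Disjoint (tsupport a) (tsupport b)) (ξ : E) : ρ a (ρ b ξ) = 0 := by
  rw [← h.map_mul]
  have : a * b = 0 := by
    ext x
    by_cases hx : a x = 0
    · simp [hx]
    · simp [image_eq_zero_of_notMem_tsupport (hab.notMem_of_mem_left (subset_tsupport _ hx))]
  rw [this, map_zero]
  rfl

end IsTestAction

/-! ### Actions on `L^p` by operators with disjoint ranges -/

section Lp

variable {Ω : Type*} [MeasurableSpace Ω] {μ : Measure Ω} {p : ℝ≥0∞} [Fact (1 ≤ p)]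
  {σ : C_c(X, ℝ) →+ (Lp 𝕜 p μ →L[𝕜] Lp 𝕜 p μ)}

/-- The ranges of the operators of disjoint test functions consist of functions with disjoint
supports. -/
def HasDisjointRanges (𝒱 : Set (Set X)) (σ : C_c(X, ℝ) →+ (Lp 𝕜 p μ →L[𝕜] Lp 𝕜 p μ)) : Prop :=
  ∀ a b, IsTest 𝒱 a → IsTest 𝒱 b → Disjoint (tsupport a) (tsupport b) → ∀ ξ η,
    ∀ᵐ x ∂μ, σ a ξ x = 0 ∨ σ b η x = 0

theorem HasDisjointRanges.pairwise (hd : HasDisjointRanges 𝒱 σ) {ι : Type*}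
    {a : ι → C_c(X, ℝ)} (ha : DisjointTests 𝒱 a) (ξ : ι → Lp 𝕜 p μ) :
    Pairwise fun i j => ∀ᵐ x ∂μ, σ (a i) (ξ i) x = 0 ∨ σ (a j) (ξ j) x = 0 :=
  fun i j hij => hd _ _ (ha.isTest i) (ha.isTest j) (ha.disjoint hij) _ _

theorem HasDisjointRanges.upperEstimate (hd : HasDisjointRanges 𝒱 σ) (h : IsTestAction 𝒱 σ)
    (hp : p ≠ ∞) : UpperEstimate 𝒱 σ p.toReal := by
  have hp0 : p ≠ 0 := (one_pos.trans_le (Fact.out : 1 ≤ p)).ne'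
  intro n a ha ξ
  rw [norm_sum_rpow_lp_of_disjoint hp0 hp (hd.pairwise ha ξ)]
  exact Finset.sum_le_sum fun i _ =>
    Real.rpow_le_rpow (norm_nonneg _) (h.apply_le (ha.isTest i) _) ENNReal.toReal_nonneg

theorem HasDisjointRanges.supEstimate {σ : C_c(X, ℝ) →+ (Lp 𝕜 ∞ μ →L[𝕜] Lp 𝕜 ∞ μ)}
    (hd : HasDisjointRanges 𝒱 σ) (h : IsTestAction 𝒱 σ) : SupEstimate 𝒱 σ :=
  fun _ _ ha ξ _ hB hξ => norm_sum_lpTop_le_of_disjoint (hd.pairwise ha ξ) hB fun i =>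
    (h.apply_le (ha.isTest i) _).trans (hξ i)

/-- The sum of the operators is itself a contraction, and applied to `ξ` it yields a sum of
disjointly supported functions, whose `p`-th power norms add up. -/
theorem IsSupContractive.lowerEstimate (hs : IsSupContractive σ) (hd : HasDisjointRanges 𝒱 σ)
    (hp : p ≠ ∞) : LowerEstimate 𝒱 σ p.toReal := by
  have hp0 : p ≠ 0 := (one_pos.trans_le (Fact.out : 1 ≤ p)).ne'
  intro n a ha ξ
  rw [← norm_sum_rpow_lp_of_disjoint hp0 hp (hd.pairwise ha fun _ => ξ)]
  have h1 := hs n a (fun i => (ha.isTest i).nonneg) (fun i => (ha.isTest i).le_one) ha.disjoint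
    (fun _ => 1) (fun _ => by simp)
  have h2 := (∑ i, (1 : 𝕜) • σ (a i)).le_of_opNorm_le h1 ξ
  simp only [one_smul, sum_apply, one_mul] at h2
  exact Real.rpow_le_rpow (norm_nonneg _) h2 ENNReal.toReal_nonneg

theorem IsSupContractive.norm_add_smul_le {ρ : C_c(X, ℝ) →+ (E →L[𝕜] E)}
    (hs : IsSupContractive ρ) {a b : C_c(X, ℝ)} (ha0 : ∀ x, 0 ≤ a x) (ha1 : ∀ x, a x ≤ 1)
    (hb0 : ∀ x, 0 ≤ b x) (hb1 : ∀ x, b x ≤ 1) (hab : Disjoint (tsupport a) (tsupport b)) {z : 𝕜}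
    (hz : ‖z‖ = 1) : ‖ρ a + z • ρ b‖ ≤ 1 := by
  have h := hs 2 ![a, b]
    (by simp only [Fin.forall_fin_two]; exact ⟨ha0, hb0⟩)
    (by simp only [Fin.forall_fin_two]; exact ⟨ha1, hb1⟩)
    (by
      intro i j hij
      fin_cases i <;> fin_cases j <;> simp_all [disjoint_comm]) ![1, z]
    (by simp [Fin.forall_fin_two, hz])
  simpa [Fin.sum_univ_two] using h

theorem IsTestAction.exists_pair_units {ρ : C_c(X, ℝ) →+ (E →L[𝕜] E)} (h : IsTestAction 𝒱 ρ)
    {a b : C_c(X, ℝ)} (ha : IsTest 𝒱 a) (hb : IsTest 𝒱 b)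
    (hab : Disjoint (tsupport a) (tsupport b)) :
    ∃ v w, IsTest 𝒱 v ∧ IsTest 𝒱 w ∧ Disjoint (tsupport v) (tsupport w) ∧
      (∀ x ∈ tsupport a, v x = 1) ∧ ∀ x ∈ tsupport b, w x = 1 := by
  obtain ⟨v, hv, h1⟩ := DisjointTests.exists_units h.isOpen (a := ![a, b])
    ⟨by simp [Fin.forall_fin_two, ha, hb], by
      intro i j hij
      fin_cases i <;> fin_cases j <;> simp_all [disjoint_comm]⟩
  exact ⟨v 0, v 1, hv.isTest 0, hv.isTest 1, hv.disjoint (by simp), h1 0, h1 1⟩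

/-- Disjoint local units `v`, `w` for `a`, `b` play the roles of `P₁`, `P₂`: the vector `σ a ξ` is
fixed by `σ v` and killed by `σ w`, and symmetrically for `σ b η`. -/
theorem IsSupContractive.hasDisjointRanges (hs : IsSupContractive σ) (h : IsTestAction 𝒱 σ)
    (h𝕜 : IsComplexField 𝕜) (hp : p ≠ ∞) (hp2 : p ≠ 2) : HasDisjointRanges 𝒱 σ := by
  intro a b ha hb hab ξ η
  obtain ⟨v, w, hv, hw, hvw, hva, hwb⟩ := h.exists_pair_units ha hb hab
  have hwa : Disjoint (tsupport w) (tsupport a) := by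
    refine hvw.symm.mono_right ?_
    exact closure_mono fun x hx => by simp [hva x (subset_tsupport _ hx)]
  have hvb : Disjoint (tsupport v) (tsupport b) := by
    refine hvw.mono_right ?_
    exact closure_mono fun x hx => by simp [hwb x (subset_tsupport _ hx)]
  exact ae_eq_zero_or_eq_zero_of_rotations h𝕜 hp hp2
    (fun z hz => hs.norm_add_smul_le hv.nonneg hv.le_one hw.nonneg hw.le_one hvw hz) (h.apply_of_eq_one hva ξ)
    (h.apply_apply_of_disjoint hwa ξ) (h.apply_apply_of_disjoint hvb η) (h.apply_of_eq_one hwb η)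

/-- The multiplier of `σ a` times the function `σ b η` vanishes, as `a * b = 0`. Pointwise one
factor is zero, and a zero of the multiplier is a zero of `σ a ξ`. -/
theorem hasDisjointRanges_of_multiplication (h : IsTestAction 𝒱 σ)
    (hm : ∀ a, IsLpMultiplication (σ a)) : HasDisjointRanges 𝒱 σ := by
  intro a b _ _ hab ξ η
  obtain ⟨k, hk⟩ := hm a
  obtain ⟨l, hl⟩ := hm b
  have h0 : σ a (σ b η) = 0 := h.apply_apply_of_disjoint hab η
  filter_upwards [hk ξ, hl η, hk (σ b η), h0 ▸ Lp.coeFn_zero 𝕜 p μ] with x h1 h2 h3 h4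
  rw [h3] at h4
  rcases mul_eq_zero.1 h4 with h5 | h5
  · left
    rw [h1, h5, zero_mul]
  · exact Or.inr h5

/-- The sum of the operators is not assumed contractive, so `ξ` is cut down to the set where `σ (a
i) ξ` is nonzero. This does not change `σ (a i) ξ`, and the pieces of `ξ` are disjoint almost
everywhere. -/
theorem lowerEstimate_of_multiplication (h : IsTestAction 𝒱 σ)
    (hm : ∀ a, IsLpMultiplication (σ a)) (hp : p ≠ ∞) : LowerEstimate 𝒱 σ p.toReal := by
  have hp0 : p ≠ 0 := (one_pos.trans_le (Fact.out : 1 ≤ p)).ne'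
  have hd := hasDisjointRanges_of_multiplication h hm
  intro n a ha ξ
  have hA : ∀ i, MeasurableSet {x | σ (a i) ξ x ≠ 0} := fun i =>
    ((Lp.stronglyMeasurable (σ (a i) ξ)).measurable (measurableSet_singleton 0)).compl
  have hmem : ∀ i, MemLp ({x | σ (a i) ξ x ≠ 0}.indicator ξ) p μ := fun i =>
    (Lp.memLp ξ).indicator (hA i)
  have hval : ∀ᵐ x ∂μ, ∀ i, (hmem i).toLp _ x = {x | σ (a i) ξ x ≠ 0}.indicator ξ x :=
    ae_all_iff.2 fun i => (hmem i).coeFn_toLp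
  have hfix : ∀ i, σ (a i) ξ = σ (a i) ((hmem i).toLp _) := by
    intro i
    obtain ⟨k, hk⟩ := hm (a i)
    refine Lp.ext ?_
    filter_upwards [hk ξ, hk ((hmem i).toLp _), hval] with x h1 h2 h3
    rw [h2, h3 i, Set.indicator_apply]
    split_ifs with h4
    · exact h1
    · rw [mul_zero]
      simpa using h4
  calc ∑ i, ‖σ (a i) ξ‖ ^ p.toReal ≤ ∑ i, ‖(hmem i).toLp _‖ ^ p.toReal :=
        Finset.sum_le_sum fun i _ => Real.rpow_le_rpow (norm_nonneg _)
          ((congrArg norm (hfix i)).trans_le (h.apply_le (ha.isTest i) _)) ENNReal.toReal_nonneg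
    _ = ‖∑ i, (hmem i).toLp _‖ ^ p.toReal := by
        refine (norm_sum_rpow_lp_of_disjoint hp0 hp fun i j hij => ?_).symm
        filter_upwards [hval, hd.pairwise ha (fun _ => ξ) hij] with x h1 h2
        rw [h1, h1]
        exact h2.imp (fun h3 => Set.indicator_of_notMem (by simpa using h3) _)
          (fun h3 => Set.indicator_of_notMem (by simpa using h3) _)
    _ ≤ ‖ξ‖ ^ p.toReal := by
        refine Real.rpow_le_rpow (norm_nonneg _) (Lp.norm_le_norm_of_ae_le ?_)
          ENNReal.toReal_nonneg
        filter_upwards [hval, coeFn_sum_lp Finset.univ fun i => (hmem i).toLp _,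
          ae_pairwise (hd.pairwise ha (fun _ => ξ))] with x h1 h2 h3
        rw [h2]
        refine norm_sum_le_of_disjoint (fun i j hij => ?_) (norm_nonneg _) fun i => ?_
        · simp only [h1]
          exact (h3 hij).imp (fun h3 => Set.indicator_of_notMem (by simpa using h3) _)
            (fun h3 => Set.indicator_of_notMem (by simpa using h3) _)
        · rw [h1]
          exact norm_indicator_le_norm_self _ _

end Lp

/-! ### Actions on spaces with the supremum norm -/

theorem supEstimate_of_c0Multiplication {Ω : Type*} [TopologicalSpace Ω]
    {σ : C_c(X, ℝ) →+ (C₀(Ω, 𝕜) →L[𝕜] C₀(Ω, 𝕜))} (h : IsTestAction 𝒱 σ)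
    (hm : ∀ a, IsC0Multiplication (σ a)) : SupEstimate 𝒱 σ := by
  intro n a ha ξ B hB hξ
  refine norm_c0_le hB fun x => ?_
  rw [sum_apply_c0]
  refine norm_sum_le_of_disjoint (fun i j hij => ?_) hB fun i =>
    (norm_apply_le_c0 _ x).trans ((h.apply_le (ha.isTest i) _).trans (hξ i))
  obtain ⟨k, hk⟩ := hm (a i)
  have h0 : σ (a i) (σ (a j) (ξ j)) x = 0 := by
    rw [h.apply_apply_of_disjoint (ha.disjoint hij)]
    rfl
  rw [hk] at h0
  rcases mul_eq_zero.1 h0 with h1 | h1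
  · left
    rw [hk, h1, zero_mul]
  · exact Or.inr h1

/-- The summands are added one at a time with `norm_add_le_of_rotations`: disjoint neighbourhoods
separate the new support from the union of the earlier ones, and the bound `B` never grows. -/
theorem IsSupContractive.supEstimate (hs : IsSupContractive ρ) (h : IsTestAction 𝒱 ρ)
    (h𝕜 : IsComplexField 𝕜) (hE : HasRotationCalculus 𝕜 E) : SupEstimate 𝒱 ρ := by
  intro n a ha ξ B hB hξ
  obtain ⟨W, hWo, hW, hWd⟩ := exists_disjoint_open_nhds (fun i => (a i).hasCompactSupport)
    ha.disjoint
  -- Vectors having a local unit inside `V`. This class is stable under scalars and contains the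
  -- range of every `ρ v` with `v` supported in the open set `V`, as the rotation lemma requires of
  -- `E₁` and `E₂`.
  let F : Set X → Set E := fun V =>
    {η | ∃ v : C_c(X, ℝ), (∀ x, 0 ≤ v x) ∧ (∀ x, v x ≤ 1) ∧ tsupport v ⊆ V ∧ ρ v η = η}
  have hF : ∀ (V : Set X) (c : 𝕜), ∀ η ∈ F V, c • η ∈ F V := by
    rintro V c η ⟨v, h0, h1, hv, hη⟩
    exact ⟨v, h0, h1, hv, by rw [map_smul, hη]⟩
  have hmap : ∀ V, IsOpen V → ∀ v : C_c(X, ℝ), tsupport v ⊆ V → ∀ η, ρ v η ∈ F V := by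
    intro V hV v hv η
    obtain ⟨u, h0, h1, hu, huv⟩ := exists_bump v.hasCompactSupport hV hv
    exact ⟨u, h0, h1, hu, h.apply_of_eq_one huv η⟩
  suffices H : ∀ s : Finset (Fin n), ‖∑ i ∈ s, ρ (a i) (ξ i)‖ ≤ B from H _
  intro s
  induction s using Finset.cons_induction with
  | empty => simpa using hB
  | cons k s hk ih =>
    rw [Finset.sum_cons]
    have hUo : IsOpen (⋃ i ∈ s, W i) := isOpen_biUnion fun i _ => hWo i
    have hd : Disjoint (W k) (⋃ i ∈ s, W i) := by
      simp only [Set.disjoint_iUnion_right]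
      exact fun i hi => hWd fun hki => hk (hki ▸ hi)
    refine norm_add_le_of_rotations h𝕜 hE (hF (W k)) (hF (⋃ i ∈ s, W i)) ?_
      (hmap _ (hWo k) _ (hW k) _) ?_ ((h.apply_le (ha.isTest k) _).trans (hξ k)) ih
    · rintro ζ ⟨v, hv0, hv1, hv, hvζ⟩ η ⟨w, hw0, hw1, hw, hwη⟩
      exact ⟨ρ v, ρ w, hvζ, hwη, hmap _ (hWo k) v hv, hmap _ hUo w hw, fun z hz =>
        hs.norm_add_smul_le hv0 hv1 hw0 hw1 (hd.mono hv hw) hz⟩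
    · obtain ⟨u, h0, h1, hu, hu1⟩ := exists_bump
        (s.isCompact_biUnion fun i _ => (a i).hasCompactSupport) hUo
        (Set.iUnion₂_mono fun i _ => hW i)
      refine ⟨u, h0, h1, hu, ?_⟩
      rw [map_sum]
      exact Finset.sum_congr rfl fun i hi => h.apply_of_eq_one
        (fun x hx => hu1 x (Set.mem_biUnion hi hx)) _

/-! ### Actions on Hilbert spaces -/

section Hilbert

variable {H : Type*} [NormedAddCommGroup H] [InnerProductSpace 𝕜 H] [CompleteSpace H]
  {σ : C_c(X, ℝ) →+ (H →L[𝕜] H)}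

/-- A fixed vector of a contraction is fixed by the adjoint. -/
theorem adjoint_apply_of_apply_eq {A : H →L[𝕜] H} (hA : ‖A‖ ≤ 1) {ξ : H} (hξ : A ξ = ξ) :
    ContinuousLinearMap.adjoint A ξ = ξ := by
  have h1 : ‖ContinuousLinearMap.adjoint A ξ‖ ≤ ‖ξ‖ := by
    simpa using (ContinuousLinearMap.adjoint A).le_of_opNorm_le
      ((LinearIsometryEquiv.norm_map _ A).trans_le hA) ξ
  have h2 : inner 𝕜 (ContinuousLinearMap.adjoint A ξ) ξ = inner 𝕜 ξ ξ := by
    rw [ContinuousLinearMap.adjoint_inner_left, hξ]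
  rw [← sub_eq_zero, ← norm_eq_zero, ← sq_eq_zero_iff]
  refine le_antisymm ?_ (sq_nonneg _)
  rw [@norm_sub_sq 𝕜, h2, inner_self_eq_norm_sq]
  have := pow_le_pow_left₀ (norm_nonneg _) h1 2
  linarith

theorem norm_sum_sq_of_orthogonal {ι : Type*} [Fintype ι] {f : ι → H}
    (h : Pairwise fun i j => inner 𝕜 (f i) (f j) = 0) :
    ‖∑ i, f i‖ ^ 2 = ∑ i, ‖f i‖ ^ 2 := by
  classical
  have h1 : (inner 𝕜 (∑ i, f i) (∑ i, f i) : 𝕜) = ∑ i, inner 𝕜 (f i) (f i) := by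
    rw [sum_inner]
    refine Finset.sum_congr rfl fun i _ => ?_
    rw [inner_sum]
    exact Finset.sum_eq_single i (fun j _ hj => h hj.symm) (by simp)
  have h2 := congrArg RCLike.re h1
  rw [inner_self_eq_norm_sq, map_sum] at h2
  simpa only [inner_self_eq_norm_sq] using h2

/-- A vector fixed by the contraction `σ v` is also fixed by its adjoint, so local units can be
moved across the inner product, where they meet an operator with disjoint support. For the second
identity the argument runs with adjoints. Only contractivity on single test functions is used. -/
theorem IsTestAction.inner_eq_zero (h : IsTestAction 𝒱 σ) {a b : C_c(X, ℝ)} (ha : IsTest 𝒱 a)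
    (hb : IsTest 𝒱 b) (hab : Disjoint (tsupport a) (tsupport b)) (ξ η : H) :
    inner 𝕜 (σ a ξ) (σ b η) = 0 ∧
    inner 𝕜 (ContinuousLinearMap.adjoint (σ a) ξ) (ContinuousLinearMap.adjoint (σ b) η) = 0 := by
  obtain ⟨v, w, hv, hw, hvw, hva, hwb⟩ := h.exists_pair_units ha hb hab
  constructor
  · rw [← adjoint_apply_of_apply_eq (h.norm_le v hv) (h.apply_of_eq_one hva ξ),
      ContinuousLinearMap.adjoint_inner_left, h.apply_apply_of_disjoint, inner_zero_right]
    exact hvw.mono_right (closure_mono fun x hx => by simp [hwb x (subset_tsupport _ hx)])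
  · set ζ := ContinuousLinearMap.adjoint (σ b) η
    have h1 : ContinuousLinearMap.adjoint (σ w) ζ = ζ := by
      refine ext_inner_right 𝕜 fun y => ?_
      simp only [ζ, ContinuousLinearMap.adjoint_inner_left]
      rw [h.apply_apply_of_eq_one hwb]
    have h2 : σ w ζ = ζ := by
      have := adjoint_apply_of_apply_eq (A := ContinuousLinearMap.adjoint (σ w))
        (by rw [LinearIsometryEquiv.norm_map]; exact h.norm_le w hw) h1
      rwa [ContinuousLinearMap.adjoint_adjoint] at this
    rw [ContinuousLinearMap.adjoint_inner_left, ← h2, h.apply_apply_of_disjoint, inner_zero_right]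
    exact hvw.mono_left (closure_mono fun x hx => by simp [hva x (subset_tsupport _ hx)])

theorem IsTestAction.upperEstimate_two (h : IsTestAction 𝒱 σ) : UpperEstimate 𝒱 σ 2 := by
  intro n a ha ξ
  simp only [Real.rpow_two]
  rw [norm_sum_sq_of_orthogonal (𝕜 := 𝕜) fun i j hij =>
    (h.inner_eq_zero (ha.isTest i) (ha.isTest j) (ha.disjoint hij) _ _).1]
  exact Finset.sum_le_sum fun i _ =>
    pow_le_pow_left₀ (norm_nonneg _) (h.apply_le (ha.isTest i) _) 2

/-- With `ζ` the sum of the vectors `σ(a i)* σ(a i) ξ`, the left side is `Q = re ⟨ζ, ξ⟩`, while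
orthogonality of the adjoint ranges gives `‖ζ‖² ≤ Q`. Cauchy–Schwarz then yields `Q ≤ ‖ξ‖²`. -/
theorem IsTestAction.lowerEstimate_two (h : IsTestAction 𝒱 σ) : LowerEstimate 𝒱 σ 2 := by
  intro n a ha ξ
  simp only [Real.rpow_two]
  set Q := ∑ i, ‖σ (a i) ξ‖ ^ 2
  set ζ := ∑ i, ContinuousLinearMap.adjoint (σ (a i)) (σ (a i) ξ)
  have hζ : ‖ζ‖ ^ 2 ≤ Q := by
    rw [norm_sum_sq_of_orthogonal (𝕜 := 𝕜) fun i j hij =>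
      (h.inner_eq_zero (ha.isTest i) (ha.isTest j) (ha.disjoint hij) _ _).2]
    refine Finset.sum_le_sum fun i _ => pow_le_pow_left₀ (norm_nonneg _) ?_ 2
    simpa using (ContinuousLinearMap.adjoint (σ (a i))).le_of_opNorm_le
      ((LinearIsometryEquiv.norm_map _ _).trans_le (h.norm_le _ (ha.isTest i))) (σ (a i) ξ)
  have hQ : Q = RCLike.re (inner 𝕜 ζ ξ) := by
    simp only [ζ, sum_inner, ContinuousLinearMap.adjoint_inner_left, map_sum,
      inner_self_eq_norm_sq]
    rfl
  have h1 : Q ≤ ‖ζ‖ * ‖ξ‖ := hQ ▸ re_inner_le_norm ζ ξ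
  nlinarith [sq_nonneg (‖ζ‖ - ‖ξ‖)]

end Hilbert

end TestActions

/-! ### Fibre integrals, and bounds for sections over one bisection. -/

section Integration

universe u v w

/-- The unit space of `𝒢` as a type. -/
abbrev UnitSpace {G : Type u} [TopologicalSpace G] (𝒢 : EtaleGroupoid G) : Type u :=
  Set.range 𝒢.d

instance {G : Type u} [TopologicalSpace G] (𝒢 : EtaleGroupoid G) : T2Space (UnitSpace 𝒢) :=
  𝒢.t2Space_units

instance {G : Type u} [TopologicalSpace G] (𝒢 : EtaleGroupoid G) :
    LocallyCompactSpace (UnitSpace 𝒢) :=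
  𝒢.locallyCompactSpace_units

/-- The domain map into the unit space. -/
def dUnit {G : Type u} [TopologicalSpace G] (𝒢 : EtaleGroupoid G) (γ : G) : UnitSpace 𝒢 :=
  ⟨𝒢.d γ, γ, rfl⟩

/-- The range map into the unit space. -/
def rUnit {G : Type u} [TopologicalSpace G] (𝒢 : EtaleGroupoid G) (γ : G) : UnitSpace 𝒢 :=
  ⟨𝒢.r γ, 𝒢.r γ, 𝒢.d_r γ⟩

section Fibres

variable {G X : Type*} [TopologicalSpace G] [TopologicalSpace X] [MeasurableSpace X]
  [BorelSpace X] {τ : G → X} {m : Measure X}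

/-- The integral over `X` of the sums of `u` over the fibres of `τ`. -/
def fibreIntegral (τ : G → X) (m : Measure X) (u : G → ℝ≥0∞) : ℝ≥0∞ :=
  ∫⁻ x, ∑' γ : {γ // τ γ = x}, u γ ∂m

theorem fibreIntegral_mono {u v : G → ℝ≥0∞} (h : ∀ γ, u γ ≤ v γ) :
    fibreIntegral τ m u ≤ fibreIntegral τ m v :=
  lintegral_mono fun _ => ENNReal.tsum_le_tsum fun _ => h _

/-- The fibre sums are not known to be measurable. Superadditivity of the lower integral needs no
measurability and is the direction that the estimates use. -/
theorem le_fibreIntegral_add (u v : G → ℝ≥0∞) :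
    fibreIntegral τ m u + fibreIntegral τ m v ≤ fibreIntegral τ m fun γ => u γ + v γ := by
  unfold fibreIntegral
  simp only [ENNReal.tsum_add]
  exact le_lintegral_add _ _

theorem le_fibreIntegral_sum {ι : Type*} (s : Finset ι) (u : ι → G → ℝ≥0∞) :
    ∑ i ∈ s, fibreIntegral τ m (u i) ≤ fibreIntegral τ m fun γ => ∑ i ∈ s, u i γ := by
  induction s using Finset.cons_induction with
  | empty => simp
  | cons a s ha ih =>
    simp only [Finset.sum_cons]
    exact (add_le_add_right ih _).trans (le_fibreIntegral_add _ _)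

theorem mul_measure_le_fibreIntegral {A : Set G} (hA : MeasurableSet (τ '' A)) (c : ℝ≥0∞) :
    c * m (τ '' A) ≤ fibreIntegral τ m (A.indicator fun _ => c) := by
  rw [← lintegral_indicator_const hA]
  refine lintegral_mono fun x => ?_
  by_cases hx : x ∈ τ '' A
  · obtain ⟨γ, hγ, rfl⟩ := hx
    rw [Set.indicator_of_mem (Set.mem_image_of_mem τ hγ)]
    refine le_trans ?_ (ENNReal.le_tsum ⟨γ, rfl⟩)
    rw [Set.indicator_of_mem hγ]
  · rw [Set.indicator_of_notMem hx]
    exact zero_le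

theorem tsum_fibre_indicator {G X : Type*} {τ : G → X} {A : Set G} (hA : A.InjOn τ) (c : ℝ≥0∞) (x : X) :
    ∑' γ : {γ // τ γ = x}, A.indicator (fun _ => c) γ = (τ '' A).indicator (fun _ => c) x := by
  by_cases hx : x ∈ τ '' A
  · obtain ⟨γ, hγ, rfl⟩ := hx
    rw [Set.indicator_of_mem (Set.mem_image_of_mem τ hγ), tsum_eq_single ⟨γ, rfl⟩, Set.indicator_of_mem hγ]
    rintro ⟨η, hη⟩ hne
    exact Set.indicator_of_notMem (fun h => hne (Subtype.ext (hA h hγ hη))) _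
  · rw [Set.indicator_of_notMem hx, ENNReal.tsum_eq_zero]
    rintro ⟨η, hη⟩
    exact Set.indicator_of_notMem (fun h => hx ⟨η, h, hη⟩) _

/-- Equality holds because one summand is measurable: on an injective set the fibre sum of the
indicator is the indicator of the image. -/
theorem fibreIntegral_add_indicator (u : G → ℝ≥0∞) {A : Set G} (hA : A.InjOn τ)
    (hm : MeasurableSet (τ '' A)) (c : ℝ≥0∞) :
    fibreIntegral τ m (fun γ => u γ + A.indicator (fun _ => c) γ) =
      fibreIntegral τ m u + c * m (τ '' A) := by
  unfold fibreIntegral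
  simp only [ENNReal.tsum_add, tsum_fibre_indicator hA]
  rw [lintegral_add_right _ (measurable_const.indicator hm), lintegral_indicator_const hm]

/-- An open set on which `τ` is a homeomorphism contains compact sets that nearly exhaust the
measure of its image. -/
theorem exists_compact_measure_diff_lt [T2Space X] [IsFiniteMeasure m] [m.Regular]
    {V : Set G} (hτ : IsOpenEmbedding (V.domRestrict τ)) {ε : ℝ≥0∞} (hε : ε ≠ 0) :
    ∃ C ⊆ V, IsCompact C ∧ m (τ '' V \ τ '' C) < ε := by
  have hVo : IsOpen (τ '' V) := by
    have := hτ.isOpen_range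
    rwa [Set.range_domRestrict] at this
  obtain ⟨A, hAV, hA, hlt⟩ := hVo.measurableSet.exists_isCompact_sdiff_lt (μ := m) (measure_ne_top m _) hε
  refine ⟨Subtype.val '' (V.domRestrict τ ⁻¹' A), ?_, ?_, ?_⟩
  · rintro _ ⟨x, -, rfl⟩
    exact x.2
  · refine IsCompact.image ?_ continuous_subtype_val
    refine (hτ.isInducing.isCompact_preimage_iff ?_).2 hA
    rwa [Set.range_domRestrict]
  · have h1 : τ '' (Subtype.val '' (V.domRestrict τ ⁻¹' A)) = A := by
      rw [Set.image_image]
      change V.domRestrict τ '' (V.domRestrict τ ⁻¹' A) = A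
      rw [Set.image_preimage_eq_iff, Set.range_domRestrict]
      exact hAV
    rwa [h1]

end Fibres

variable {𝕜 : Type w} [RCLike 𝕜] {G : Type u} [TopologicalSpace G] {𝒢 : EtaleGroupoid G}
  {L : G → Type v} [∀ γ, NormedAddCommGroup (L γ)] [∀ γ, NormedSpace 𝕜 (L γ)]
  [TopologicalSpace (TotalSpace 𝕜 L)]

theorem continuous_dUnit : Continuous (dUnit 𝒢) := 𝒢.isLocalHomeomorph_d.continuous

theorem continuous_rUnit : Continuous (rUnit 𝒢) := 𝒢.isLocalHomeomorph_r.continuous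

theorem isOpenEmbedding_dUnit {U V : Set G} (hU : 𝒢.IsBisection U) (hVU : V ⊆ U)
    (hV : IsOpen V) : IsOpenEmbedding (V.domRestrict (dUnit 𝒢)) :=
  .of_continuous_injective_isOpenMap (continuous_dUnit.comp continuous_subtype_val)
    (Set.injOn_iff_injective.1 fun _ h1 _ h2 h =>
      (EtaleGroupoid.isBisection_iff.1 hU).2.1 (hVU h1) (hVU h2) (congrArg Subtype.val h))
    (𝒢.isLocalHomeomorph_d.isOpenMap.comp hV.isOpenMap_subtype_val)

theorem isOpenEmbedding_rUnit {U V : Set G} (hU : 𝒢.IsBisection U) (hVU : V ⊆ U)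
    (hV : IsOpen V) : IsOpenEmbedding (V.domRestrict (rUnit 𝒢)) :=
  .of_continuous_injective_isOpenMap (continuous_rUnit.comp continuous_subtype_val)
    (Set.injOn_iff_injective.1 fun _ h1 _ h2 h =>
      (EtaleGroupoid.isBisection_iff.1 hU).2.2 (hVU h1) (hVU h2) (congrArg Subtype.val h))
    (𝒢.isLocalHomeomorph_r.isOpenMap.comp hV.isOpenMap_subtype_val)

/-- A section over a bisection that vanishes off a compact set covered by finitely many
bisections decomposes accordingly. -/
theorem exists_sum_of_cover (hL : IsLineBundle 𝕜 L) {f : ∀ γ, L γ} {U K : Set G}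
    (hU : 𝒢.IsBisection U) (hfc : ContinuousOn (fun γ => (⟨γ, f γ⟩ : TotalSpace 𝕜 L)) U)
    (hKU : K ⊆ U) (hK : IsCompact K) (h0 : ∀ γ, γ ∉ K → f γ = 0) {n : ℕ} {W : Fin n → Set G}
    (hW : ∀ k, 𝒢.IsBisection (W k)) (hKW : K ⊆ ⋃ k, W k) :
    ∃ F : Fin n → ∀ γ, L γ, (∀ k, F k ∈ CcOn 𝕜 (W k)) ∧ f = ∑ k, F k := by
  classical
  have := hU.t2Space
  have := hU.locallyCompactSpace
  have hK' : IsCompact ((Subtype.val : U → G) ⁻¹' K) :=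
    (IsInducing.subtypeVal.isCompact_preimage_iff (by simpa using hKU)).2 hK
  -- The partition of unity is built on the bisection `U`, which is Hausdorff and locally compact
  -- even when the groupoid is not, and then extended by zero.
  obtain ⟨φ, hφ1, hφ2, -, hφ4⟩ := exists_continuous_sum_one_of_isOpen_isCompact
    (s := fun k => (Subtype.val : U → G) ⁻¹' W k)
    (fun k => (hW k).1.preimage continuous_subtype_val) hK' (by
      rintro x hx
      obtain ⟨k, hk⟩ := Set.mem_iUnion.1 (hKW hx)
      exact Set.mem_iUnion.2 ⟨k, hk⟩)
  let c : Fin n → G → 𝕜 := fun k γ => if h : γ ∈ U then ((φ k ⟨γ, h⟩ : ℝ) : 𝕜) else 0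
  refine ⟨fun k γ => c k γ • f γ, fun k => ?_, ?_⟩
  · refine mem_CcOn_of_inter hU.1 (hW k)
      ((hφ4 k).isCompact.image continuous_subtype_val) ?_ ?_ ?_ ?_ hL
    · rintro _ ⟨x, -, rfl⟩
      exact x.2
    · rintro _ ⟨x, hx, rfl⟩
      exact hφ1 k hx
    · refine hL.smul_continuousOn ?_ hfc
      rw [continuousOn_iff_continuous_domRestrict]
      have : U.domRestrict (c k) = fun x => ((φ k x : ℝ) : 𝕜) := by
        funext x
        simp [c, Set.domRestrict]
      rw [this]
      exact RCLike.continuous_ofReal.comp (φ k).continuous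
    · intro γ hγ
      by_cases h : γ ∈ U
      · have : φ k ⟨γ, h⟩ = 0 := by
          by_contra h1
          exact hγ ⟨⟨γ, h⟩, subset_tsupport _ h1, rfl⟩
        simp [c, h, this]
      · simp [c, h]
  · funext γ
    rw [Finset.sum_apply]
    by_cases hγ : γ ∈ K
    · have h1 := hφ2 (x := ⟨γ, hKU hγ⟩) hγ
      have h2 : ∑ k, c k γ = 1 := by
        simp only [Finset.sum_apply, Pi.one_apply] at h1
        simp only [c, hKU hγ, dif_pos]
        exact_mod_cast h1
      rw [← Finset.sum_smul, h2, one_smul]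
    · simp [h0 γ hγ]

/-- A local frame of a line bundle, with its coordinate function. -/
theorem IsLineBundle.exists_frame (hL : IsLineBundle 𝕜 L) (γ₀ : G) :
    ∃ U : Set G, IsOpen U ∧ γ₀ ∈ U ∧ ∃ s : ∀ γ, L γ, (∀ γ ∈ U, ‖s γ‖ = 1) ∧
      ContinuousOn (fun γ => (⟨γ, s γ⟩ : TotalSpace 𝕜 L)) U ∧
      ∃ κ : TotalSpace 𝕜 L → 𝕜, ContinuousOn κ (TotalSpace.proj ⁻¹' U) ∧
        ∀ z : TotalSpace 𝕜 L, z.proj ∈ U → κ z • s z.proj = z.snd := by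
  obtain ⟨U, hU, hγ, s, hs, he⟩ := hL.locally_trivial γ₀
  have : Nonempty (U × 𝕜) := ⟨(⟨γ₀, hγ⟩, 0)⟩
  let e := he.toOpenPartialHomeomorph
  have ht : ∀ z : TotalSpace 𝕜 L, z.proj ∈ U → z ∈ e.target := by
    intro z hz
    obtain ⟨c, hc⟩ := hL.exists_smul_eq (hs _ hz) z.snd
    have : z ∈ Set.range (fun p : U × 𝕜 => (⟨p.1, p.2 • s p.1⟩ : TotalSpace 𝕜 L)) :=
      ⟨(⟨z.proj, hz⟩, c), by simp only [hc]⟩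
    simpa [e] using this
  refine ⟨U, hU, hγ, s, hs, ?_, fun z => (e.symm z).2, ?_, ?_⟩
  · rw [continuousOn_iff_continuous_domRestrict]
    have := he.continuous.comp (by fun_prop : Continuous fun x : U => (x, (1 : 𝕜)))
    refine this.congr fun x => ?_
    simp
  · exact continuous_snd.comp_continuousOn (e.continuousOn_symm.mono ht)
  · intro z hz
    have h1 : (⟨(e.symm z).1, (e.symm z).2 • s (e.symm z).1⟩ : TotalSpace 𝕜 L) = z :=
      e.right_inv (ht z hz)
    have h2 : ((e.symm z).1 : G) = z.proj := congrArg TotalSpace.proj h1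
    change (e.symm z).2 • s z.proj = z.snd
    generalize e.symm z = q at h1 h2 ⊢
    obtain ⟨⟨γ, hγ⟩, c⟩ := q
    subst h1
    rfl

/-- Near each point both sections are scalar multiples of one continuous frame, and the continuous
coordinate functions are added. -/
theorem IsLineBundle.add_continuousOn (hL : IsLineBundle 𝕜 L) {f g : ∀ γ, L γ} {U : Set G}
    (hf : ContinuousOn (fun γ => (⟨γ, f γ⟩ : TotalSpace 𝕜 L)) U)
    (hg : ContinuousOn (fun γ => (⟨γ, g γ⟩ : TotalSpace 𝕜 L)) U) :
    ContinuousOn (fun γ => (⟨γ, f γ + g γ⟩ : TotalSpace 𝕜 L)) U := by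
  intro γ₀ hγ₀
  obtain ⟨V, hV, hγV, s, -, hs, κ, hκ, hκs⟩ := hL.exists_frame γ₀
  have h1 : ContinuousWithinAt (fun γ => κ ⟨γ, f γ⟩ + κ ⟨γ, g γ⟩) (U ∩ V) γ₀ := by
    refine ContinuousWithinAt.add ?_ ?_
    · exact (hκ _ hγV).comp ((hf γ₀ hγ₀).mono Set.inter_subset_left) fun γ hγ => hγ.2
    · exact (hκ _ hγV).comp ((hg γ₀ hγ₀).mono Set.inter_subset_left) fun γ hγ => hγ.2
  have h2 := hL.continuous_smul.continuousAt.comp_continuousWithinAt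
    (h1.prodMk ((hs γ₀ hγV).mono Set.inter_subset_right))
  have h3 : ContinuousWithinAt (fun γ => (⟨γ, f γ + g γ⟩ : TotalSpace 𝕜 L)) (U ∩ V) γ₀ := by
    refine h2.congr (fun γ hγ => ?_) ?_
    · simp [add_smul, hκs ⟨γ, f γ⟩ hγ.2, hκs ⟨γ, g γ⟩ hγ.2]
    · simp [add_smul, hκs ⟨γ₀, f γ₀⟩ hγV, hκs ⟨γ₀, g γ₀⟩ hγV]
  exact (continuousWithinAt_inter (hV.mem_nhds hγV)).1 h3

theorem IsLineBundle.add_mem_CcOn (hL : IsLineBundle 𝕜 L) {f g : ∀ γ, L γ} {U : Set G}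
    (hf : f ∈ CcOn 𝕜 U) (hg : g ∈ CcOn 𝕜 U) : f + g ∈ CcOn 𝕜 U := by
  obtain ⟨h1, K, hK, hKc, h0⟩ := hf
  obtain ⟨h2, K', hK', hKc', h0'⟩ := hg
  refine ⟨hL.add_continuousOn h1 h2, K ∪ K', Set.union_subset hK hK', hKc.union hKc',
    fun γ hγ => ?_⟩
  rw [Set.mem_union, not_or] at hγ
  simp [h0 γ hγ.1, h0' γ hγ.2]

/-- The bundle section `γ ↦ χ γ • f γ` for a continuous real function on `U`. -/
theorem IsLineBundle.ofReal_smul_continuousOn (hL : IsLineBundle 𝕜 L) {χ : G → ℝ}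
    {f : ∀ γ, L γ} {U : Set G} (hχ : ContinuousOn χ U)
    (hf : ContinuousOn (fun γ => (⟨γ, f γ⟩ : TotalSpace 𝕜 L)) U) :
    ContinuousOn (fun γ => (⟨γ, (χ γ : 𝕜) • f γ⟩ : TotalSpace 𝕜 L)) U :=
  hL.smul_continuousOn (RCLike.continuous_ofReal.comp_continuousOn hχ) hf

section Functional

variable [MeasurableSpace (UnitSpace 𝒢)] [BorelSpace (UnitSpace 𝒢)]
  {m n : Measure (UnitSpace 𝒢)} {Θ : (∀ γ, L γ) →ₗ[𝕜] 𝕜}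

/-- The functional `Θ` is bounded on sections over members of `S` by the measures of the images of
their supports under the domain and the range map. -/
def IsSupportBounded (S : 𝒢.CoveringSemigroup) (m n : Measure (UnitSpace 𝒢))
    (Θ : (∀ γ, L γ) →ₗ[𝕜] 𝕜) : Prop :=
  ∀ U ∈ S.carrier, ∀ g ∈ CcOn (L := L) 𝕜 U, ∀ (c : ℝ) (K : Set G), 0 ≤ c → (∀ γ, ‖g γ‖ ≤ c) →
    K ⊆ U → IsCompact K → (∀ γ, γ ∉ K → g γ = 0) →
    ‖Θ g‖ₑ ≤ ENNReal.ofReal c * (m (dUnit 𝒢 '' K) + n (rUnit 𝒢 '' K))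

/-- The sum of the two integrals of fibre sums. -/
def totalIntegral (m n : Measure (UnitSpace 𝒢)) (u : G → ℝ≥0∞) : ℝ≥0∞ :=
  fibreIntegral (dUnit 𝒢) m u + fibreIntegral (rUnit 𝒢) n u

theorem le_totalIntegral_add (u v : G → ℝ≥0∞) :
    totalIntegral m n u + totalIntegral m n v ≤ totalIntegral m n fun γ => u γ + v γ := by
  unfold totalIntegral
  rw [add_add_add_comm]
  exact add_le_add (le_fibreIntegral_add _ _) (le_fibreIntegral_add _ _)

theorem totalIntegral_mono {u v : G → ℝ≥0∞} (h : ∀ γ, u γ ≤ v γ) :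
    totalIntegral m n u ≤ totalIntegral m n v :=
  add_le_add (fibreIntegral_mono h) (fibreIntegral_mono h)

/-- Absorbs an error `δ B` as `δ → 0`; finiteness of `B` excludes a permanently infinite error. -/
theorem le_of_forall_le_add_ofReal_mul {x A B : ℝ≥0∞} (hB : B ≠ ∞)
    (h : ∀ δ : ℝ, 0 < δ → x ≤ A + ENNReal.ofReal δ * B) : x ≤ A := by
  refine ENNReal.le_of_forall_pos_le_add fun ε hε _ => ?_
  have hB0 : 0 < B.toReal + 1 := by positivity
  refine (h (ε / (B.toReal + 1)) (by positivity)).trans (add_le_add_right ?_ A)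
  rw [← ENNReal.ofReal_toReal hB, ← ENNReal.ofReal_mul (by positivity),
    ENNReal.toReal_ofReal ENNReal.toReal_nonneg]
  refine ENNReal.ofReal_le_of_le_toReal ?_
  rw [ENNReal.coe_toReal, div_mul_eq_mul_div, div_le_iff₀ hB0]
  exact mul_le_mul_of_nonneg_left (by linarith) ε.2

theorem sum_ite_mul_le {s δ : ℝ} (hs : 0 ≤ s) (hδ : 0 ≤ δ) (M : ℕ) :
    ∑ j ∈ Finset.range M, (if ((j + 1 : ℕ) : ℝ) * δ ≤ s then δ else 0) ≤ min s (M * δ) := by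
  induction M with
  | zero => simp [hs]
  | succ M ih =>
    rw [Finset.sum_range_succ]
    have h2 := ih.trans (min_le_right _ _)
    split_ifs with h
    · have h3 : ((M + 1 : ℕ) : ℝ) * δ = M * δ + δ := by push_cast; ring
      exact le_min (by linarith) (by linarith)
    · have h3 : ((M + 1 : ℕ) : ℝ) * δ = M * δ + δ := by push_cast; ring
      exact le_min (by linarith [ih.trans (min_le_left _ _)]) (by linarith)

theorem div_max_mul {s t : ℝ} (hs : 0 ≤ s) (ht : 0 ≤ t) : t / max s t * s = min s t := by
  rcases le_total s t with h | h
  · rw [max_eq_right h, min_eq_left h]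
    rcases ht.eq_or_lt with rfl | h0
    · simp [le_antisymm h hs]
    · field_simp
  · rw [max_eq_left h, min_eq_right h]
    rcases hs.eq_or_lt with rfl | h0
    · simp [le_antisymm h ht]
    · field_simp

/-- Cutting a section into slices of small norm. -/
theorem IsSupportBounded.enorm_le_of_mem_CcOn {S : 𝒢.CoveringSemigroup} [IsFiniteMeasure m]
    [IsFiniteMeasure n] (hΘ : IsSupportBounded S m n Θ) (hL : IsLineBundle 𝕜 L) {U : Set G}
    (hU : U ∈ S.carrier) {g : ∀ γ, L γ} (hg : g ∈ CcOn 𝕜 U) :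
    ‖Θ g‖ₑ ≤ totalIntegral m n fun γ => ‖g γ‖ₑ := by
  classical
  obtain ⟨hgc, K, hKU, hK, hg0⟩ := id hg
  have hnorm : ContinuousOn (fun γ => ‖g γ‖) U := hL.continuous_norm.comp_continuousOn hgc
  refine le_of_forall_le_add_ofReal_mul (B := m Set.univ + n Set.univ) (by simp) ?_
  intro δ hδ
  let κ : ℝ → G → ℝ := fun t γ => t / max ‖g γ‖ t
  let trunc : ℝ → ∀ γ, L γ := fun t γ => (κ t γ : 𝕜) • g γ
  have hκ : ∀ t, 0 ≤ t → ContinuousOn (κ t) U := by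
    intro t ht
    rcases ht.eq_or_lt with rfl | ht
    · simpa [κ] using continuousOn_const
    · exact continuousOn_const.div (hnorm.sup continuousOn_const)
        fun γ _ => (ht.trans_le (le_max_right _ _)).ne'
  have hκg : ∀ t, 0 ≤ t → ∀ γ, κ t γ * ‖g γ‖ = min ‖g γ‖ t := fun t ht γ =>
    div_max_mul (norm_nonneg _) ht
  obtain ⟨N, hN⟩ := exists_nat_gt (supNorm g / δ)
  have hgN : ∀ γ, ‖g γ‖ ≤ (N + 1 : ℕ) * δ := fun γ => by
    have := (CcOn.norm_le hL hg γ).trans ((div_lt_iff₀ hδ).1 hN).le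
    push_cast
    linarith
  -- The difference of two radial truncations has norm at most `δ` and lives where `‖g‖ ≥ jδ`. The
  -- sum over `j ≤ N` telescopes to `g`, since the truncation at `0` is zero and the one at `(N +
  -- 1)δ` changes nothing.
  let slice : ℕ → ∀ γ, L γ := fun j => trunc ((j + 1 : ℕ) * δ) - trunc (j * δ)
  have hslice : ∀ j γ, slice j γ =
      ((κ ((j + 1 : ℕ) * δ) γ - κ (j * δ) γ : ℝ) : 𝕜) • g γ := by
    intro j γ
    simp only [slice, trunc, Pi.sub_apply, RCLike.ofReal_sub, sub_smul]
  have hsum : g = ∑ j ∈ Finset.range (N + 1), slice j := by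
    rw [Finset.sum_range_sub (fun j : ℕ => trunc (j * δ))]
    funext γ
    have h1 : (0 : ℝ) < (N + 1 : ℕ) * δ := by positivity
    simp only [trunc, κ, Pi.sub_apply, max_eq_right (hgN γ), div_self h1.ne']
    simp
  let A : ℕ → Set G := fun j => {γ ∈ K | j * δ ≤ ‖g γ‖}
  have hA : ∀ j, IsCompact (A j) := by
    intro j
    have := isCompact_iff_compactSpace.1 hK
    have h1 : IsClosed {x : K | j * δ ≤ ‖g x‖} := isClosed_le continuous_const
      (continuousOn_iff_continuous_domRestrict.1 (hnorm.mono hKU))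
    convert h1.isCompact.image continuous_subtype_val using 1
    ext γ
    simp only [A, Set.mem_ofPred_eq, Set.mem_image, Subtype.exists]
    exact ⟨fun h => ⟨γ, h.1, h.2, rfl⟩, fun ⟨_, h1, h2, h3⟩ => h3 ▸ ⟨h1, h2⟩⟩
  have hbound : ∀ j, ‖Θ (slice j)‖ₑ ≤
      ENNReal.ofReal δ * (m (dUnit 𝒢 '' A j) + n (rUnit 𝒢 '' A j)) := by
    intro j
    have h1 : (0 : ℝ) ≤ (j + 1 : ℕ) * δ := by positivity
    have h2 : (0 : ℝ) ≤ j * δ := by positivity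
    have h0 : ∀ γ, γ ∉ A j → slice j γ = 0 := by
      intro γ hγ
      by_cases hγK : γ ∈ K
      · have h3 : ‖g γ‖ < j * δ := by
          by_contra! h
          exact hγ ⟨hγK, h⟩
        have h4 : (j : ℝ) * δ ≤ (j + 1 : ℕ) * δ := by push_cast; linarith
        have h5 : 0 < (j : ℝ) * δ := (norm_nonneg _).trans_lt h3
        rw [hslice]
        simp only [κ, max_eq_right h3.le, max_eq_right (h3.le.trans h4), div_self h5.ne',
          div_self (h5.trans_le h4).ne']
        simp
      · rw [hslice, hg0 γ hγK, smul_zero]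
    refine hΘ U hU _ ⟨?_, A j, fun γ hγ => hKU hγ.1, hA j, h0⟩ δ (A j) hδ.le ?_
      (fun γ hγ => hKU hγ.1) (hA j) h0
    · have := hL.ofReal_smul_continuousOn ((hκ _ h1).sub (hκ _ h2)) hgc
      refine this.congr fun γ _ => ?_
      rw [hslice]
      rfl
    · intro γ
      rw [hslice, norm_smul, RCLike.norm_ofReal, ← abs_of_nonneg (norm_nonneg (g γ)), ← abs_mul,
        sub_mul, hκg _ h1, hκg _ h2]
      have h3 : ((j + 1 : ℕ) : ℝ) * δ = j * δ + δ := by push_cast; ring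
      rw [h3, abs_le]
      constructor
      · rcases min_cases ‖g γ‖ (j * δ) with h | h <;>
          rcases min_cases ‖g γ‖ (j * δ + δ) with h' | h' <;> linarith
      · rcases min_cases ‖g γ‖ (j * δ) with h | h <;>
          rcases min_cases ‖g γ‖ (j * δ + δ) with h' | h' <;> linarith
  -- The layer-cake estimate: `δ` times the number of levels `jδ`, `j ≥ 1`, below `‖g γ‖` is at most
  -- `‖g γ‖`. Hence the shift to `A (j + 1)`.
  have hpoint : ∀ γ, ∑ j ∈ Finset.range N, (A (j + 1)).indicator (fun _ => ENNReal.ofReal δ) γ ≤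
      ‖g γ‖ₑ := by
    intro γ
    have h1 := (sum_ite_mul_le (norm_nonneg (g γ)) hδ.le N).trans (min_le_left _ _)
    rw [← ofReal_norm]
    refine le_trans ?_ (ENNReal.ofReal_le_ofReal h1)
    rw [ENNReal.ofReal_sum_of_nonneg fun j _ => by split_ifs <;> positivity]
    refine Finset.sum_le_sum fun j _ => ?_
    rw [Set.indicator_apply]
    split_ifs with h2 h3
    · rfl
    · exact absurd h2.2 h3
    · exact zero_le
    · exact zero_le
  have hfib : ∀ (τ : G → UnitSpace 𝒢) (k : Measure (UnitSpace 𝒢)), Continuous τ →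
      ∑ j ∈ Finset.range N, ENNReal.ofReal δ * k (τ '' A (j + 1)) ≤
        fibreIntegral τ k fun γ => ‖g γ‖ₑ := by
    intro τ k hτ
    refine (Finset.sum_le_sum fun j _ => mul_measure_le_fibreIntegral
      ((hA (j + 1)).image hτ).measurableSet _).trans ?_
    exact (le_fibreIntegral_sum _ _).trans (fibreIntegral_mono hpoint)
  calc ‖Θ g‖ₑ ≤ ∑ j ∈ Finset.range (N + 1), ‖Θ (slice j)‖ₑ := by
        conv_lhs => rw [hsum, map_sum]
        exact enorm_sum_le _ _
    _ ≤ ∑ j ∈ Finset.range (N + 1),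
          ENNReal.ofReal δ * (m (dUnit 𝒢 '' A j) + n (rUnit 𝒢 '' A j)) :=
        Finset.sum_le_sum fun j _ => hbound j
    _ ≤ _ := by
        -- The bottom slice `j = 0` is split off: it costs at most `δ` times the total masses and is
        -- the only error term.
        rw [Finset.sum_range_succ']
        refine add_le_add ?_ (mul_le_mul_right (add_le_add (measure_mono (Set.subset_univ _))
          (measure_mono (Set.subset_univ _))) _)
        simp only [mul_add, Finset.sum_add_distrib]
        exact add_le_add (hfib _ m continuous_dUnit) (hfib _ n continuous_rUnit)

end Functional

end Integration

/-! ### Sums over several bisections, and the norms `dNorm` and `rNorm`. -/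

section Integration

universe u v w

variable {𝕜 : Type w} [RCLike 𝕜] {G : Type u} [TopologicalSpace G] {𝒢 : EtaleGroupoid G}
  {L : G → Type v} [∀ γ, NormedAddCommGroup (L γ)] [∀ γ, NormedSpace 𝕜 (L γ)]
  [TopologicalSpace (TotalSpace 𝕜 L)] [MeasurableSpace (UnitSpace 𝒢)] [BorelSpace (UnitSpace 𝒢)]
  {m n : Measure (UnitSpace 𝒢)} {Θ : (∀ γ, L γ) →ₗ[𝕜] 𝕜}

theorem injOn_dUnit {U : Set G} (hU : 𝒢.IsBisection U) : U.InjOn (dUnit 𝒢) :=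
  fun _ h1 _ h2 h => (EtaleGroupoid.isBisection_iff.1 hU).2.1 h1 h2 (congrArg Subtype.val h)

theorem injOn_rUnit {U : Set G} (hU : 𝒢.IsBisection U) : U.InjOn (rUnit 𝒢) :=
  fun _ h1 _ h2 h => (EtaleGroupoid.isBisection_iff.1 hU).2.2 h1 h2 (congrArg Subtype.val h)

/-- A continuous cut-off function on a bisection. -/
theorem exists_cutoff {U V C : Set G} (hU : 𝒢.IsBisection U) (hV : IsOpen V) (hVU : V ⊆ U)
    (hC : IsCompact C) (hCV : C ⊆ V) :
    ∃ χ : G → ℝ, ContinuousOn χ U ∧ (∀ γ, 0 ≤ χ γ) ∧ (∀ γ, χ γ ≤ 1) ∧ (∀ γ ∈ C, χ γ = 1) ∧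
      ∃ K ⊆ V, IsCompact K ∧ ∀ γ, γ ∉ K → χ γ = 0 := by
  classical
  have := hU.t2Space
  have := hU.locallyCompactSpace
  obtain ⟨a, h0, h1, ha, haC⟩ := exists_bump (X := U) (K := Subtype.val ⁻¹' C)
    (V := Subtype.val ⁻¹' V)
    ((IsInducing.subtypeVal.isCompact_preimage_iff (by simpa using hCV.trans hVU)).2 hC)
    (hV.preimage continuous_subtype_val) (Set.preimage_mono hCV)
  refine ⟨fun γ => if h : γ ∈ U then a ⟨γ, h⟩ else 0, ?_, fun γ => ?_, fun γ => ?_,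
    fun γ hγ => ?_, Subtype.val '' tsupport a, ?_,
    (show IsCompact (tsupport a) from a.hasCompactSupport).image continuous_subtype_val,
    fun γ hγ => ?_⟩
  · rw [continuousOn_iff_continuous_domRestrict]
    refine a.continuous.congr fun x => ?_
    simp [Set.domRestrict]
  · dsimp only
    split_ifs
    exacts [h0 _, le_rfl]
  · dsimp only
    split_ifs
    exacts [h1 _, zero_le_one]
  · simp only [hVU (hCV hγ), dif_pos]
    exact haC _ hγ
  · rintro _ ⟨x, hx, rfl⟩
    exact ha hx
  · dsimp only
    split_ifs with h
    · by_contra h2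
      exact hγ ⟨⟨γ, h⟩, subset_tsupport _ h2, rfl⟩
    · rfl

/-- Separating one bisection from the others costs little. -/
theorem IsSupportBounded.enorm_le_of_sum {S : 𝒢.CoveringSemigroup} [IsFiniteMeasure m]
    [IsFiniteMeasure n] [m.Regular] [n.Regular] (hΘ : IsSupportBounded S m n Θ)
    (hL : IsLineBundle 𝕜 L) {N : ℕ} {W : Fin N → Set G} (hW : ∀ k, W k ∈ S.carrier)
    {F : Fin N → ∀ γ, L γ} (hF : ∀ k, F k ∈ CcOn 𝕜 (W k)) :
    ‖Θ (∑ k, F k)‖ₑ ≤ totalIntegral m n fun γ => ‖(∑ k, F k) γ‖ₑ := by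
  induction N with
  | zero => simp
  | succ N ih =>
    set U := W (Fin.last N) with hUdef
    set g := F (Fin.last N) with hgdef
    have hU := S.isBisection U (hW _)
    have hg : g ∈ CcOn 𝕜 U := hF _
    set H : ∀ γ, L γ := ∑ k : Fin N, F k.castSucc with hH
    set O : Set G := ⋃ k : Fin N, W k.castSucc with hO
    have hOo : IsOpen O := isOpen_iUnion fun k => (S.isBisection _ (hW _)).1
    have hHO : ∀ γ, γ ∉ O → H γ = 0 := by
      intro γ hγ
      rw [hH, Finset.sum_apply]
      refine Finset.sum_eq_zero fun k _ => ?_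
      by_contra h
      exact hγ (Set.mem_iUnion.2 ⟨k, CcOn.support_subset (hF _) h⟩)
    have hfsum : ∑ k, F k = H + g := Fin.sum_univ_castSucc F
    rw [hfsum]
    obtain ⟨hgc, K, hKU, hK, hg0⟩ := id hg
    -- Only on `V` can cancellation between `g` and the other sections occur. A cut-off equal to one
    -- on a compact part of `V`, exhausting it up to `δ` for both measures, moves the overlapping
    -- part of `g` to the other bisections.
    set V := U ∩ O with hVdef
    have hV : IsOpen V := hU.1.inter hOo
    have hVU : V ⊆ U := Set.inter_subset_left
    refine le_of_forall_le_add_ofReal_mul (B := ENNReal.ofReal (4 * supNorm g))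
      ENNReal.ofReal_ne_top ?_
    intro δ hδ
    have hδ0 : ENNReal.ofReal δ ≠ 0 := by simpa using hδ
    obtain ⟨C₁, hC₁V, hC₁, hm⟩ := exists_compact_measure_diff_lt (m := m)
      (isOpenEmbedding_dUnit hU hVU hV) hδ0
    obtain ⟨C₂, hC₂V, hC₂, hn⟩ := exists_compact_measure_diff_lt (m := n)
      (isOpenEmbedding_rUnit hU hVU hV) hδ0
    obtain ⟨χ, hχc, hχ0, hχ1, hχC, K', hK'V, hK', hχK⟩ := exists_cutoff hU hV hVU
      (hC₁.union hC₂) (Set.union_subset hC₁V hC₂V)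
    set g₁ : ∀ γ, L γ := fun γ => (χ γ : 𝕜) • g γ with hg₁
    set g₂ : ∀ γ, L γ := fun γ => ((1 - χ γ : ℝ) : 𝕜) • g γ with hg₂
    have hg12 : ∀ γ, g γ = g₁ γ + g₂ γ := by
      intro γ
      rw [hg₁, hg₂]
      dsimp only
      rw [← add_smul, ← RCLike.ofReal_add, add_sub_cancel, RCLike.ofReal_one, one_smul]
    have hg₂U : g₂ ∈ CcOn 𝕜 U :=
      ⟨hL.ofReal_smul_continuousOn (continuousOn_const.sub hχc) hgc, K, hKU, hK,
        fun γ hγ => by simp [hg₂, hg0 γ hγ]⟩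
    -- The cut-off part `g₁` is supported in a compact subset of the other `N` bisections and is
    -- distributed among them, so the induction hypothesis applies to `H + g₁`.
    obtain ⟨P, hP, hPsum⟩ := exists_sum_of_cover hL hU
      (hL.ofReal_smul_continuousOn hχc hgc) (hK'V.trans hVU) hK'
      (fun γ hγ => by simp [hχK γ hγ]) (W := fun k : Fin N => W k.castSucc)
      (fun k => S.isBisection _ (hW _)) (hK'V.trans Set.inter_subset_right)
    have h1 : ‖Θ (H + g₁)‖ₑ ≤ totalIntegral m n fun γ => ‖(H + g₁) γ‖ₑ := by
      have := ih (fun k => hW k.castSucc) (F := fun k => F k.castSucc + P k)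
        fun k => hL.add_mem_CcOn (hF _) (hP k)
      rw [Finset.sum_add_distrib, ← hPsum] at this
      exact this
    have h2 : ‖Θ g₂‖ₑ ≤ totalIntegral m n fun γ => ‖g₂ γ‖ₑ :=
      hΘ.enorm_le_of_mem_CcOn hL (hW _) hg₂U
    set D : Set G := V \ (C₁ ∪ C₂) with hD
    set c : ℝ≥0∞ := ENNReal.ofReal (2 * supNorm g) with hc
    -- Outside `D` at most one of the two terms is nonzero, so their norms add up to the norm of the
    -- sum. On `D` the excess is at most `2‖g₂ γ‖`, which is at most twice the supremum norm of `g`.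
    have hpoint : ∀ γ, ‖(H + g₁) γ‖ₑ + ‖g₂ γ‖ₑ ≤
        ‖(H + g) γ‖ₑ + D.indicator (fun _ => c) γ := by
      intro γ
      have hHg : (H + g) γ = (H + g₁) γ + g₂ γ := by
        rw [Pi.add_apply, Pi.add_apply, hg12 γ, add_assoc]
      by_cases hγV : γ ∈ V
      · by_cases hγC : γ ∈ C₁ ∪ C₂
        · have : g₂ γ = 0 := by simp [hg₂, hχC γ hγC]
          rw [hHg, this, add_zero, enorm_zero, add_zero]
          exact le_self_add
        · rw [Set.indicator_of_mem (show γ ∈ D from ⟨hγV, hγC⟩)]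
          have h3 : ‖g₂ γ‖ ≤ supNorm g := by
            simp only [hg₂]
            rw [norm_smul, RCLike.norm_ofReal, abs_of_nonneg (sub_nonneg.2 (hχ1 γ))]
            refine (mul_le_of_le_one_left (norm_nonneg _) ?_).trans (CcOn.norm_le hL hg γ)
            linarith [hχ0 γ]
          have h4 : ‖(H + g₁) γ‖ ≤ ‖(H + g) γ‖ + ‖g₂ γ‖ := by
            rw [hHg]
            simpa using norm_sub_le ((H + g₁) γ + g₂ γ) (g₂ γ)
          rw [hc, ← ofReal_norm, ← ofReal_norm, ← ofReal_norm, ← ENNReal.ofReal_add (by positivity)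
            (by positivity), ← ENNReal.ofReal_add (by positivity)
              (by linarith [supNorm_nonneg g])]
          exact ENNReal.ofReal_le_ofReal (by linarith)
      · rw [Set.indicator_of_notMem fun h => hγV h.1, add_zero]
        have hχγ : χ γ = 0 := hχK γ fun h => hγV (hK'V h)
        have hg₁γ : g₁ γ = 0 := by simp [hg₁, hχγ]
        rw [hHg, Pi.add_apply, hg₁γ, add_zero]
        by_cases hγU : γ ∈ U
        · rw [hHO γ fun h => hγV ⟨hγU, h⟩]
          simp
        · have : g₂ γ = 0 := by
            by_contra h
            exact hγU (CcOn.support_subset hg₂U h)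
          simp [this]
    have hmeas : ∀ τ : G → UnitSpace 𝒢, Continuous τ → IsOpenEmbedding (V.domRestrict τ) →
        MeasurableSet (τ '' D) := by
      intro τ hτ hτV
      have hinj : V.InjOn τ := Set.injOn_iff_injective.2 hτV.injective
      rw [hD, hinj.image_sdiff_subset (Set.union_subset hC₁V hC₂V)]
      have hVo := hτV.isOpen_range
      rw [Set.range_domRestrict] at hVo
      exact hVo.measurableSet.diff ((hC₁.union hC₂).image hτ).measurableSet
    have hle : ∀ (τ : G → UnitSpace 𝒢) (C : Set G) (k : Measure (UnitSpace 𝒢)),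
        V.InjOn τ → C ⊆ V → C ⊆ C₁ ∪ C₂ → k (τ '' V \ τ '' C) < ENNReal.ofReal δ →
        k (τ '' D) ≤ ENNReal.ofReal δ := by
      intro τ C k hτ hCV hC hk
      refine (measure_mono ?_).trans hk.le
      rw [← hτ.image_sdiff_subset hCV]
      exact Set.image_mono (Set.sdiff_subset_sdiff_right hC)
    calc ‖Θ (H + g)‖ₑ = ‖Θ (H + g₁) + Θ g₂‖ₑ := by
          rw [← map_add]
          congr 2
          funext γ
          rw [Pi.add_apply, Pi.add_apply, Pi.add_apply, hg12 γ, add_assoc]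
      _ ≤ ‖Θ (H + g₁)‖ₑ + ‖Θ g₂‖ₑ := enorm_add_le _ _
      _ ≤ totalIntegral m n fun γ => ‖(H + g₁) γ‖ₑ + ‖g₂ γ‖ₑ :=
          (add_le_add h1 h2).trans (le_totalIntegral_add _ _)
      _ ≤ totalIntegral m n fun γ => ‖(H + g) γ‖ₑ + D.indicator (fun _ => c) γ :=
          totalIntegral_mono hpoint
      _ ≤ (totalIntegral m n fun γ => ‖(H + g) γ‖ₑ) +
            (c * ENNReal.ofReal δ + c * ENNReal.ofReal δ) := by
          unfold totalIntegral
          rw [fibreIntegral_add_indicator _ ((injOn_dUnit hU).mono (Set.sdiff_subset.trans hVU))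
            (hmeas _ continuous_dUnit (isOpenEmbedding_dUnit hU hVU hV)),
            fibreIntegral_add_indicator _ ((injOn_rUnit hU).mono (Set.sdiff_subset.trans hVU))
            (hmeas _ continuous_rUnit (isOpenEmbedding_rUnit hU hVU hV)), add_add_add_comm]
          refine add_le_add_right (add_le_add (mul_le_mul_right ?_ c) (mul_le_mul_right ?_ c)) _
          · exact hle _ _ _ ((injOn_dUnit hU).mono hVU) hC₁V Set.subset_union_left hm
          · exact hle _ _ _ ((injOn_rUnit hU).mono hVU) hC₂V Set.subset_union_right hn
      _ = _ := by
          have : ENNReal.ofReal (4 * supNorm g) = c + c := by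
            rw [hc, ← ENNReal.ofReal_add (by linarith [supNorm_nonneg g])
              (by linarith [supNorm_nonneg g])]
            congr 1
            ring
          rw [this]
          ring

theorem tsum_fibre_le_of_mem_CcOn (hL : IsLineBundle 𝕜 L) {X : Type*} {τ : G → X} {U : Set G}
    (hτ : U.InjOn τ) {g : ∀ γ, L γ} (hg : g ∈ CcOn 𝕜 U) (x : X) :
    ∑' γ : {γ // τ γ = x}, ‖g γ‖ₑ ≤ ENNReal.ofReal (supNorm g) := by
  calc ∑' γ : {γ // τ γ = x}, ‖g γ‖ₑ
      ≤ ∑' γ : {γ // τ γ = x}, U.indicator (fun _ => ENNReal.ofReal (supNorm g)) γ := by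
        refine ENNReal.tsum_le_tsum fun γ => ?_
        by_cases h : g γ = 0
        · simp [h]
        · rw [Set.indicator_of_mem (CcOn.support_subset hg h), ← ofReal_norm]
          exact ENNReal.ofReal_le_ofReal (CcOn.norm_le hL hg γ)
    _ = (τ '' U).indicator (fun _ => ENNReal.ofReal (supNorm g)) x := tsum_fibre_indicator hτ _ x
    _ ≤ _ := Set.indicator_le_self _ _ x

/-- Injectivity on bisections bounds the fibre sums of each spanning section. Without such a bound
the real-valued sums and suprema in `dNorm` and `rNorm` could take the default value `0`. -/
theorem exists_tsum_fibre_le (T : Twist 𝕜 L 𝒢) {X : Type*} {τ : G → X}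
    (hτ : ∀ U, 𝒢.IsBisection U → U.InjOn τ) {f : ∀ γ, L γ} (hf : f ∈ Cc T) :
    ∃ C : ℝ, 0 ≤ C ∧ ∀ x, ∑' γ : {γ // τ γ = x}, ‖f γ‖ₑ ≤ ENNReal.ofReal C := by
  induction hf using Submodule.span_induction with
  | mem f hf =>
    obtain ⟨U, hU, hf⟩ := hf
    exact ⟨supNorm f, supNorm_nonneg f, tsum_fibre_le_of_mem_CcOn T.isLineBundle (hτ U hU) hf⟩
  | zero => exact ⟨0, le_rfl, by simp⟩
  | add f g _ _ h1 h2 =>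
    obtain ⟨C, hC, h1⟩ := h1
    obtain ⟨C', hC', h2⟩ := h2
    refine ⟨C + C', add_nonneg hC hC', fun x => ?_⟩
    rw [ENNReal.ofReal_add hC hC']
    refine le_trans ?_ (add_le_add (h1 x) (h2 x))
    rw [← ENNReal.tsum_add]
    exact ENNReal.tsum_le_tsum fun γ => enorm_add_le _ _
  | smul c f _ h1 =>
    obtain ⟨C, hC, h1⟩ := h1
    refine ⟨‖c‖ * C, by positivity, fun x => ?_⟩
    simp only [Pi.smul_apply, enorm_smul]
    rw [ENNReal.tsum_mul_left, ENNReal.ofReal_mul (norm_nonneg c), ofReal_norm]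
    exact mul_le_mul_right (h1 x) _

/-- The fibre sums of a section in `𝔠_c(𝒢, L)` are bounded by their supremum. -/
theorem tsum_fibre_le_ofReal_iSup (T : Twist 𝕜 L 𝒢) {X : Type*} {τ : G → X}
    (hτ : ∀ U, 𝒢.IsBisection U → U.InjOn τ) {f : ∀ γ, L γ} (hf : f ∈ Cc T) (x : X) :
    ∑' γ : {γ // τ γ = x}, ‖f γ‖ₑ ≤
      ENNReal.ofReal (⨆ x, ∑' γ : {γ // τ γ = x}, ‖f γ‖) := by
  obtain ⟨C, hC, h⟩ := exists_tsum_fibre_le T hτ hf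
  have heq : ∀ x, ∑' γ : {γ // τ γ = x}, ‖f γ‖ = (∑' γ : {γ // τ γ = x}, ‖f γ‖ₑ).toReal := by
    intro x
    rw [ENNReal.tsum_toReal_eq fun γ => enorm_ne_top]
    simp only [toReal_enorm]
  have hne : ∀ x, ∑' γ : {γ // τ γ = x}, ‖f γ‖ₑ ≠ ∞ := fun x =>
    ((h x).trans_lt ENNReal.ofReal_lt_top).ne
  rw [← ENNReal.ofReal_toReal (hne x), ← heq]
  refine ENNReal.ofReal_le_ofReal (le_ciSup (f := fun x => ∑' γ : {γ // τ γ = x}, ‖f γ‖) ?_ x)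
  refine ⟨C, ?_⟩
  rintro _ ⟨y, rfl⟩
  dsimp only
  rw [heq]
  exact ENNReal.toReal_le_of_le_ofReal hC (h y)

theorem iSup_dUnit_eq_dNorm (f : ∀ γ, L γ) :
    ⨆ x, ∑' γ : {γ // dUnit 𝒢 γ = x}, ‖f γ‖ = dNorm 𝒢 f := by
  refine iSup_congr fun x => ?_
  exact (Equiv.subtypeEquivRight fun γ =>
    (Subtype.ext_iff : dUnit 𝒢 γ = x ↔ 𝒢.d γ = x)).tsum_eq
    (fun γ : {γ // 𝒢.d γ = x} => ‖f γ‖)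

theorem iSup_rUnit_eq_rNorm (f : ∀ γ, L γ) :
    ⨆ x, ∑' γ : {γ // rUnit 𝒢 γ = x}, ‖f γ‖ = rNorm 𝒢 f := by
  refine iSup_congr fun x => ?_
  exact (Equiv.subtypeEquivRight fun γ =>
    (Subtype.ext_iff : rUnit 𝒢 γ = x ↔ 𝒢.r γ = x)).tsum_eq
    (fun γ : {γ // 𝒢.r γ = x} => ‖f γ‖)

/-- The integrands in the bound for sums are fibre sums, dominated everywhere by their suprema;
integrating constants leaves the total masses. -/
theorem IsSupportBounded.enorm_le {S : 𝒢.CoveringSemigroup} [IsFiniteMeasure m]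
    [IsFiniteMeasure n] [m.Regular] [n.Regular] (hΘ : IsSupportBounded S m n Θ)
    (T : Twist 𝕜 L 𝒢) {f : ∀ γ, L γ} (hf : f ∈ Cc T) :
    ‖Θ f‖ₑ ≤ ENNReal.ofReal (dNorm 𝒢 f) * m Set.univ + ENNReal.ofReal (rNorm 𝒢 f) * n Set.univ := by
  obtain ⟨N, F, hF, rfl⟩ := exists_decomposition T S hf
  choose W hW hF using hF
  refine (hΘ.enorm_le_of_sum T.isLineBundle hW hF).trans (add_le_add ?_ ?_)
  · rw [← lintegral_const, ← iSup_dUnit_eq_dNorm]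
    exact lintegral_mono fun x => tsum_fibre_le_ofReal_iSup T (fun U hU => injOn_dUnit hU) hf x
  · rw [← lintegral_const, ← iSup_rUnit_eq_rNorm]
    exact lintegral_mono fun x => tsum_fibre_le_ofReal_iSup T (fun U hU => injOn_rUnit hU) hf x

end Integration

/-! ### Functions on the unit space as sections, and their action through `ψ`. -/

section UnitSections

universe u v w

variable {𝕜 : Type w} [RCLike 𝕜] {G : Type u} [TopologicalSpace G] {𝒢 : EtaleGroupoid G}
  {L : G → Type v} [∀ γ, NormedAddCommGroup (L γ)] [∀ γ, NormedSpace 𝕜 (L γ)]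
  [TopologicalSpace (TotalSpace 𝕜 L)] (T : Twist 𝕜 L 𝒢)

theorem r_eq_self {x : G} (hx : x ∈ 𝒢.units) : 𝒢.r x = x := by
  obtain ⟨η, rfl⟩ := hx
  exact 𝒢.r_d η

theorem comp_units {x : G} (hx : x ∈ 𝒢.units) : 𝒢.Comp x x x := by
  refine ⟨by rw [EtaleGroupoid.d_eq_self hx, r_eq_self hx], ?_⟩
  have := 𝒢.mul_d x
  rwa [EtaleGroupoid.d_eq_self hx] at this

theorem isBisection_units : 𝒢.IsBisection 𝒢.units := by
  refine EtaleGroupoid.isBisection_iff.2 ⟨EtaleGroupoid.isOpen_units, fun x hx y hy h => ?_,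
    fun x hx y hy h => ?_⟩
  · rwa [EtaleGroupoid.d_eq_self hx, EtaleGroupoid.d_eq_self hy] at h
  · rwa [r_eq_self hx, r_eq_self hy] at h

/-- Multiplicativity of the norm makes the norm of the unit idempotent. It is nonzero because a left
unit that vanished would kill the whole one-dimensional fibre. -/
theorem norm_one_eq {x : G} (hx : x ∈ 𝒢.units) : ‖T.one hx‖ = 1 := by
  have h1 := T.norm_mul (comp_units hx) (T.one hx) (T.one hx)
  rw [T.one_mul hx (comp_units hx)] at h1
  have h2 : T.one hx ≠ 0 := by
    intro h0
    have : Nontrivial (L x) :=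
      Module.nontrivial_of_finrank_pos (R := 𝕜) (by rw [T.isLineBundle.finrank_eq_one]; simp)
    obtain ⟨z, hz⟩ := exists_ne (0 : L x)
    apply hz
    rw [← T.one_mul hx (comp_units hx) z, h0, map_zero, LinearMap.zero_apply]
  have h3 := norm_ne_zero_iff.2 h2
  exact (mul_left_cancel₀ h3 (by rw [mul_one]; exact h1)).symm

open Classical in
/-- The unit section, extended by zero. -/
def oneSection (γ : G) : L γ := if h : γ ∈ 𝒢.units then T.one h else 0

/-- Continuity of the units is not part of a twist; it follows from continuity of the product. For a
local frame `s` one has `s · s = k s` with `k` continuous and nonvanishing, and the unit is `k⁻¹ s`.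
-/
theorem continuousOn_oneSection :
    ContinuousOn (fun γ => (⟨γ, oneSection T γ⟩ : TotalSpace 𝕜 L)) 𝒢.units := by
  intro x₀ hx₀
  obtain ⟨U, hU, hxU, s, hs1, hs, κ, hκ, hκs⟩ := T.isLineBundle.exists_frame x₀
  set W := 𝒢.units ∩ U with hW
  have hWo : IsOpen W := EtaleGroupoid.isOpen_units.inter hU
  -- the square of the frame, as a multiple of the frame
  let sq : W → TotalSpace 𝕜 L := fun x => ⟨x, T.mul (comp_units x.2.1) (s x) (s x)⟩
  have hsq : Continuous sq := by
    have h1 : Continuous fun x : W => (⟨x, s x⟩ : TotalSpace 𝕜 L) :=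
      hs.comp_continuous continuous_subtype_val fun x => x.2.2
    refine (T.continuous_mul.comp ((h1.prodMk h1).subtype_mk
      fun x => (comp_units x.2.1).1)).congr fun x => ?_
    exact mk_mul_eq T (comp_units x.2.1) (s x) (s x)
  have hk : Continuous fun x : W => κ (sq x) := hκ.comp_continuous hsq fun x => x.2.2
  have hone : ∀ x : W, κ (sq x) ≠ 0 ∧ (κ (sq x))⁻¹ • s x = T.one x.2.1 := by
    intro x
    have h1 : κ (sq x) • s x = T.mul (comp_units x.2.1) (s x) (s x) := hκs (sq x) x.2.2
    obtain ⟨c, hc⟩ := T.isLineBundle.exists_smul_eq (hs1 x x.2.2) (T.one x.2.1)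
    have h2 : (c * κ (sq x)) • s x = (1 : 𝕜) • s x := by
      rw [mul_smul, h1, one_smul]
      conv_rhs => rw [← T.one_mul x.2.1 (comp_units x.2.1) (s x), ← hc, map_smul,
        LinearMap.smul_apply]
    have hs0 : s x ≠ 0 := by
      intro h
      have := hs1 x x.2.2
      simp [h] at this
    have h3 : c * κ (sq x) = 1 := smul_left_injective 𝕜 hs0 h2
    exact ⟨right_ne_zero_of_mul_eq_one h3, by rw [← eq_inv_of_mul_eq_one_left h3, hc]⟩
  refine ContinuousAt.continuousWithinAt ?_
  refine hWo.isOpenEmbedding_subtypeVal.continuousAt_iff (x := ⟨x₀, hx₀, hxU⟩).1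
    (Continuous.continuousAt ?_)
  have h4 : Continuous fun x : W => (⟨x, s x⟩ : TotalSpace 𝕜 L) :=
    hs.comp_continuous continuous_subtype_val fun x => x.2.2
  refine (T.isLineBundle.continuous_smul.comp
    ((hk.inv₀ fun x => (hone x).1).prodMk h4)).congr fun x => ?_
  have h5 : oneSection T (x : G) = (κ (sq x))⁻¹ • s x := by
    rw [(hone x).2, oneSection, dif_pos x.2.1]
  simp only [Function.comp_apply, h5, Pi.inv_apply]

open Classical in
/-- The section of `L` given by a compactly supported function on the unit space. -/
def unitSection (a : C_c(UnitSpace 𝒢, ℝ)) (γ : G) : L γ :=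
  if h : γ ∈ 𝒢.units then ((a ⟨γ, h⟩ : ℝ) : 𝕜) • T.one h else 0

variable {T}

theorem unitSection_apply (a : C_c(UnitSpace 𝒢, ℝ)) {γ : G} (h : γ ∈ 𝒢.units) :
    unitSection T a γ = ((a ⟨γ, h⟩ : ℝ) : 𝕜) • T.one h := dif_pos h

theorem unitSection_of_notMem (a : C_c(UnitSpace 𝒢, ℝ)) {γ : G} (h : γ ∉ 𝒢.units) :
    unitSection T a γ = 0 := dif_neg h

theorem unitSection_add (a b : C_c(UnitSpace 𝒢, ℝ)) :
    unitSection T (a + b) = unitSection T a + unitSection T b := by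
  funext γ
  by_cases h : γ ∈ 𝒢.units
  · simp [unitSection_apply _ h, add_smul]
  · simp [unitSection_of_notMem _ h]

theorem norm_unitSection_apply (a : C_c(UnitSpace 𝒢, ℝ)) {γ : G} (h : γ ∈ 𝒢.units) :
    ‖unitSection T a γ‖ = |a ⟨γ, h⟩| := by
  rw [unitSection_apply _ h, norm_smul, norm_one_eq, mul_one, RCLike.norm_ofReal]

theorem unitSection_mem_CcOn (a : C_c(UnitSpace 𝒢, ℝ)) {U : Set G} (hU : 𝒢.IsBisection U)
    (ha : Subtype.val '' tsupport a ⊆ U) : unitSection T a ∈ CcOn 𝕜 U := by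
  refine mem_CcOn_of_inter (EtaleGroupoid.isOpen_units (𝒢 := 𝒢)) hU
    ((show IsCompact (tsupport a) from a.hasCompactSupport).image continuous_subtype_val) ?_ ha ?_ ?_
    T.isLineBundle
  · rintro _ ⟨x, -, rfl⟩
    exact x.2
  · classical
    have hc : ContinuousOn (fun γ => if h : γ ∈ 𝒢.units then a ⟨γ, h⟩ else 0) 𝒢.units := by
      rw [continuousOn_iff_continuous_domRestrict]
      refine a.continuous.congr fun x => ?_
      have : (x : G) ∈ 𝒢.units := x.2
      simp [Set.domRestrict, this]
    refine (T.isLineBundle.ofReal_smul_continuousOn hc (continuousOn_oneSection T)).congr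
      fun γ hγ => ?_
    simp [unitSection_apply _ hγ, oneSection, hγ]
  · intro γ hγ
    by_cases h : γ ∈ 𝒢.units
    · have : a ⟨γ, h⟩ = 0 := by
        by_contra h0
        exact hγ ⟨⟨γ, h⟩, subset_tsupport _ h0, rfl⟩
      rw [unitSection_apply _ h, this, RCLike.ofReal_zero, zero_smul]
    · exact unitSection_of_notMem _ h

theorem unitSection_mem_CcOn_units (a : C_c(UnitSpace 𝒢, ℝ)) :
    unitSection T a ∈ CcOn 𝕜 𝒢.units :=
  unitSection_mem_CcOn a isBisection_units (by rintro _ ⟨x, -, rfl⟩; exact x.2)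

theorem conv_unitSection_left (a : C_c(UnitSpace 𝒢, ℝ)) (g : ∀ γ, L γ) :
    conv T (unitSection T a) g = fun γ => ((a (rUnit 𝒢 γ) : ℝ) : 𝕜) • g γ := by
  funext γ
  have hr : 𝒢.r γ ∈ 𝒢.units := ⟨𝒢.r γ, 𝒢.d_r γ⟩
  have hc : 𝒢.Comp (𝒢.r γ) γ γ := ⟨𝒢.d_r γ, 𝒢.r_mul_self γ⟩
  rw [conv_eq_of_comp T (EtaleGroupoid.isBisection_iff.1 isBisection_units).2.2
    (fun γ => CcOn.support_subset (unitSection_mem_CcOn_units a)) hr hc, unitSection_apply _ hr,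
    map_smul, LinearMap.smul_apply, T.one_mul]
  rfl

theorem conv_unitSection_right (a : C_c(UnitSpace 𝒢, ℝ)) {U : Set G} (hU : 𝒢.IsBisection U)
    {g : ∀ γ, L γ} (hg : g ∈ CcOn 𝕜 U) :
    conv T g (unitSection T a) = fun γ => ((a (dUnit 𝒢 γ) : ℝ) : 𝕜) • g γ := by
  funext γ
  have hinj := (EtaleGroupoid.isBisection_iff.1 hU).2.2
  have hgU : ∀ γ, g γ ≠ 0 → γ ∈ U := fun γ => CcOn.support_subset hg
  by_cases hγ : γ ∈ U
  · have hd : 𝒢.d γ ∈ 𝒢.units := ⟨γ, rfl⟩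
    have hc : 𝒢.Comp γ (𝒢.d γ) γ := ⟨(𝒢.r_d γ).symm, 𝒢.mul_d γ⟩
    rw [conv_eq_of_comp T hinj hgU hγ hc, unitSection_apply _ hd, map_smul, T.mul_one]
    rfl
  · have hg0 : g γ = 0 := by
      by_contra h
      exact hγ (hgU γ h)
    rw [hg0, smul_zero]
    by_cases h : ∃ η ∈ U, 𝒢.r η = 𝒢.r γ
    · obtain ⟨η, hη, hr⟩ := h
      have hc := EtaleGroupoid.comp_div hr
      rw [conv_eq_of_comp T hinj hgU hη hc, unitSection_of_notMem, map_zero]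
      -- If `η⁻¹γ` were a unit, then `γ = η` would lie in `U`.
      intro hu
      have h1 : 𝒢.mul (𝒢.inv η) γ = 𝒢.d η := by
        rw [hc.1, r_eq_self hu]
      have h2 := hc.2
      rw [h1, 𝒢.mul_d] at h2
      exact hγ (h2 ▸ hη)
    · push Not at h
      exact conv_eq_zero T hgU h

theorem conv_unitSection_unitSection (a b : C_c(UnitSpace 𝒢, ℝ)) :
    conv T (unitSection T a) (unitSection T b) = unitSection T (a * b) := by
  rw [conv_unitSection_left]
  funext γ
  by_cases h : γ ∈ 𝒢.units
  · have : rUnit 𝒢 γ = ⟨γ, h⟩ := Subtype.ext (r_eq_self h)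
    simp [unitSection_apply _ h, this, mul_smul]
  · simp [unitSection_of_notMem _ h]

/-- The domains of the bisections in `S`, as subsets of the unit space. -/
def domains (S : 𝒢.CoveringSemigroup) : Set (Set (UnitSpace 𝒢)) :=
  {V | ∃ U ∈ S.carrier, V = dUnit 𝒢 '' U}

theorem isOpen_of_mem_domains {S : 𝒢.CoveringSemigroup} : ∀ V ∈ domains S, IsOpen V := by
  rintro _ ⟨U, hU, rfl⟩
  exact 𝒢.isLocalHomeomorph_d.isOpenMap _ (S.isBisection U hU).1

theorem image_dUnit_mem_domains {S : 𝒢.CoveringSemigroup} {U : Set G} (hU : U ∈ S.carrier) :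
    dUnit 𝒢 '' U ∈ domains S := ⟨U, hU, rfl⟩

theorem image_rUnit_mem_domains {S : 𝒢.CoveringSemigroup} {U : Set G} (hU : U ∈ S.carrier) :
    rUnit 𝒢 '' U ∈ domains S := by
  refine ⟨_, S.inv_mem U hU, ?_⟩
  rw [EtaleGroupoid.setInv, Set.image_image]
  exact Set.image_congr fun γ _ => Subtype.ext (𝒢.d_inv γ).symm

/-- Each `x = d(γ)` with `γ ∈ U` is the product `γ⁻¹γ`, so the section lives on `U⁻¹U ∈ S`. This is
why test functions act contractively even if `X` is not in `S`. -/
theorem exists_mem_CcOn_of_isTest {S : 𝒢.CoveringSemigroup} {a : C_c(UnitSpace 𝒢, ℝ)}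
    (ha : IsTest (domains S) a) : ∃ U ∈ S.carrier, unitSection T a ∈ CcOn 𝕜 U := by
  obtain ⟨_, ⟨U, hU, rfl⟩, haU⟩ := ha.exists_subset
  have hW := S.mul_mem _ (S.inv_mem U hU) _ hU
  refine ⟨_, hW, unitSection_mem_CcOn a (S.isBisection _ hW) ?_⟩
  rintro _ ⟨x, hx, rfl⟩
  obtain ⟨γ, hγ, rfl⟩ := haU hx
  exact ⟨𝒢.inv γ, ⟨γ, hγ, rfl⟩, γ, hγ, 𝒢.d_inv γ, 𝒢.inv_mul γ⟩

namespace BanachRep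

variable {S : 𝒢.CoveringSemigroup} {E : Type*} [NormedAddCommGroup E] [NormedSpace 𝕜 E]
  (ψ : BanachRep T S E)

theorem onCc_add (f g : Cc T) : ψ.onCc (f + g) = ψ.onCc f + ψ.onCc g := by
  unfold onCc
  rw [← map_add]
  exact congrArg _ (CcAlg.toFAlg_add T S f g)

theorem onCc_smul (c : 𝕜) (f : Cc T) : ψ.onCc (c • f) = c • ψ.onCc f := by
  unfold onCc
  rw [← map_smul]
  exact congrArg _ (CcAlg.toFAlg_smul T S c f)

theorem onCc_conv (f g : Cc T) (h : conv T f.1 g.1 ∈ Cc T) :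
    ψ.onCc ⟨conv T f.1 g.1, h⟩ = ψ.onCc f * ψ.onCc g := by
  unfold onCc
  rw [← map_mul]
  exact congrArg _ (CcAlg.toFAlg_mul T S f g)

/-- The linear map `f ↦ ψ(f)`. -/
def onCcLinear : Cc T →ₗ[𝕜] (E →L[𝕜] E) where
  toFun := ψ.onCc
  map_add' := ψ.onCc_add
  map_smul' := ψ.onCc_smul

/-- A section over a member of `S` is its own one-term decomposition in the definition of `maxNorm`.
-/
theorem norm_onCc_le {U : Set G} (hU : U ∈ S.carrier) {f : Cc T} (hf : f.1 ∈ CcOn 𝕜 U) :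
    ‖ψ.onCc f‖ ≤ supNorm f.1 := by
  refine (ψ.contractive _).trans ?_
  refine (CcAlg.norm_toFAlg T S f).trans_le ?_
  have := maxNorm_le (𝕜 := 𝕜) S (fun _ : Unit => f.1) fun _ => ⟨U, hU, hf⟩
  simp only [Finset.univ_unique, Finset.sum_const, Finset.card_singleton, one_smul] at this
  exact this

/-- The action of `C_c(X)` through `ψ`. -/
def unitAction : C_c(UnitSpace 𝒢, ℝ) →+ (E →L[𝕜] E) :=
  AddMonoidHom.mk' (fun a => ψ.onCc ⟨unitSection T a,
    CcOn.mem_Cc T isBisection_units (unitSection_mem_CcOn_units a)⟩) fun a b => by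
      rw [← onCc_add]
      congr 1
      exact Subtype.ext (unitSection_add a b)

theorem unitAction_eq (a : C_c(UnitSpace 𝒢, ℝ)) (h : unitSection T a ∈ Cc T) :
    ψ.unitAction a = ψ.onCc ⟨unitSection T a, h⟩ := rfl

theorem supNorm_unitSection_le {a : C_c(UnitSpace 𝒢, ℝ)} (h0 : ∀ x, 0 ≤ a x)
    (h1 : ∀ x, a x ≤ 1) : supNorm (unitSection T a) ≤ 1 := by
  refine supNorm_le zero_le_one fun γ => ?_
  by_cases h : γ ∈ 𝒢.units
  · rw [norm_unitSection_apply _ h, abs_of_nonneg (h0 _)]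
    exact h1 _
  · rw [unitSection_of_notMem _ h, norm_zero]
    exact zero_le_one

theorem isTestAction : IsTestAction (domains S) ψ.unitAction where
  isOpen := isOpen_of_mem_domains
  map_mul a b ξ := by
    have hm : ∀ a, unitSection T a ∈ Cc T := fun a =>
      CcOn.mem_Cc T isBisection_units (unitSection_mem_CcOn_units a)
    have h := ψ.onCc_conv ⟨_, hm a⟩ ⟨_, hm b⟩ (conv_mem_Cc T (hm a) (hm b))
    simp only [conv_unitSection_unitSection] at h
    rw [unitAction_eq ψ _ (hm _), h]
    rfl
  norm_le a ha := by
    obtain ⟨U, hU, h⟩ := exists_mem_CcOn_of_isTest (T := T) ha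
    exact (ψ.norm_onCc_le hU h).trans (supNorm_unitSection_le ha.nonneg ha.le_one)

/-- At each unit at most one summand is nonzero, so the combination is a section over the units of
supremum norm at most one. -/
theorem ContractiveOnUnits.isSupContractive {ψ : BanachRep T S E} (h : ψ.ContractiveOnUnits) :
    IsSupContractive ψ.unitAction := by
  intro n a h0 h1 hd c hc
  have hm : ∀ a, unitSection T a ∈ Cc T := fun a =>
    CcOn.mem_Cc T isBisection_units (unitSection_mem_CcOn_units a)
  set f : Cc T := ∑ i, c i • ⟨unitSection T (a i), hm (a i)⟩ with hf
  have hfval : f.1 = ∑ i, c i • unitSection T (a i) := by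
    rw [hf]
    simp
  have e : ∑ i, c i • ψ.unitAction (a i) = ψ.onCc f := by
    change _ = ψ.onCcLinear f
    rw [hf, map_sum]
    exact Finset.sum_congr rfl fun i _ => (ψ.onCc_smul _ _).symm
  rw [e]
  have hmem : f.1 ∈ CcOn 𝕜 𝒢.units := by
    rw [hfval]
    refine Finset.sum_induction _ (· ∈ CcOn 𝕜 𝒢.units)
      (fun _ _ => T.isLineBundle.add_mem_CcOn) (T.isLineBundle.zero_mem_CcOn _) fun i _ =>
      T.isLineBundle.smul_mem_CcOn _ (unitSection_mem_CcOn_units _)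
  refine (h f hmem).trans (supNorm_le zero_le_one fun γ => ?_)
  rw [hfval, Finset.sum_apply]
  by_cases hγ : γ ∈ 𝒢.units
  · have h2 : ∑ i, (c i • unitSection T (a i)) γ =
        (∑ i, c i * ((a i ⟨γ, hγ⟩ : ℝ) : 𝕜)) • T.one hγ := by
      rw [Finset.sum_smul]
      refine Finset.sum_congr rfl fun i _ => ?_
      rw [Pi.smul_apply, unitSection_apply _ hγ, smul_smul]
    rw [h2, norm_smul, norm_one_eq, mul_one]
    refine norm_sum_le_of_disjoint (fun i j hij => ?_) zero_le_one fun i => ?_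
    · by_cases h3 : a i ⟨γ, hγ⟩ = 0
      · simp [h3]
      · right
        rw [image_eq_zero_of_notMem_tsupport
          ((hd hij).notMem_of_mem_left (subset_tsupport _ h3))]
        simp
    · rw [norm_mul, RCLike.norm_ofReal, abs_of_nonneg (h0 i _)]
      exact mul_le_one₀ (hc i) (h0 i _) (h1 i _)
  · rw [Finset.sum_eq_zero fun i _ => by
      rw [Pi.smul_apply, unitSection_of_notMem _ hγ, smul_zero], norm_zero]
    exact zero_le_one

theorem UnitsSatisfy.unitAction {ψ : BanachRep T S E} {P : (E →L[𝕜] E) → Prop}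
    (h : ψ.UnitsSatisfy P) (a : C_c(UnitSpace 𝒢, ℝ)) : P (ψ.unitAction a) :=
  h ⟨_, CcOn.mem_Cc T isBisection_units (unitSection_mem_CcOn_units a)⟩
    (unitSection_mem_CcOn_units a)

/-- Local units on both sides of an operator `ψ(g)`. -/
theorem onCc_eq_mul_mul {U K : Set G} (hU : 𝒢.IsBisection U) {g : Cc T} (hg : g.1 ∈ CcOn 𝕜 U)
    (hK : ∀ γ, γ ∉ K → g.1 γ = 0) {a b : C_c(UnitSpace 𝒢, ℝ)}
    (ha : ∀ x ∈ dUnit 𝒢 '' K, a x = 1) (hb : ∀ x ∈ rUnit 𝒢 '' K, b x = 1) :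
    ψ.onCc g = ψ.unitAction b * ψ.onCc g * ψ.unitAction a := by
  have hm : ∀ a, unitSection T a ∈ Cc T := fun a =>
    CcOn.mem_Cc T isBisection_units (unitSection_mem_CcOn_units a)
  have h1 : conv T (unitSection T b) g.1 = g.1 := by
    rw [conv_unitSection_left]
    funext γ
    by_cases hγ : γ ∈ K
    · rw [hb _ ⟨γ, hγ, rfl⟩, RCLike.ofReal_one, one_smul]
    · rw [hK γ hγ, smul_zero]
  have h2 : conv T g.1 (unitSection T a) = g.1 := by
    rw [conv_unitSection_right a hU hg]
    funext γ
    by_cases hγ : γ ∈ K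
    · rw [ha _ ⟨γ, hγ, rfl⟩, RCLike.ofReal_one, one_smul]
    · rw [hK γ hγ, smul_zero]
  have h3 := ψ.onCc_conv ⟨_, hm b⟩ g (conv_mem_Cc T (hm b) g.2)
  have h4 := ψ.onCc_conv g ⟨_, hm a⟩ (conv_mem_Cc T g.2 (hm a))
  simp only [h1] at h3
  simp only [h2] at h4
  rw [unitAction_eq ψ b (hm b), ← h3, unitAction_eq ψ a (hm a), ← h4]

end BanachRep

end UnitSections

/-! ### Dominating measures for vectors and functionals. -/

section VectorMeasures

variable {𝕜 : Type*} [RCLike 𝕜] {X : Type*} [TopologicalSpace X] [T2Space X]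
  [LocallyCompactSpace X] {E : Type*} [NormedAddCommGroup E] [NormedSpace 𝕜 E]
  {𝒱 : Set (Set X)} {ρ : C_c(X, ℝ) →+ (E →L[𝕜] E)} {p q : ℝ}

/-- The vector-valued functional `a ↦ ρ(a) ξ`. -/
def orbitMap (ρ : C_c(X, ℝ) →+ (E →L[𝕜] E)) (ξ : E) : C_c(X, ℝ) →+ E :=
  AddMonoidHom.mk' (fun a => ρ a ξ) fun a b => by rw [map_add]; rfl

/-- The functional `a ↦ φ ∘ ρ(a)` with values in the dual space. -/
def dualOrbitMap (ρ : C_c(X, ℝ) →+ (E →L[𝕜] E)) (φ : E →L[𝕜] 𝕜) : C_c(X, ℝ) →+ (E →L[𝕜] 𝕜) :=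
  AddMonoidHom.mk' (fun a => φ ∘L ρ a) fun a b => by rw [map_add, ContinuousLinearMap.comp_add]

theorem disjointTests_pair {a b : C_c(X, ℝ)} (ha : IsTest 𝒱 a) (hb : IsTest 𝒱 b)
    (hab : Disjoint (tsupport a) (tsupport b)) : DisjointTests 𝒱 ![a, b] :=
  ⟨by simp [Fin.forall_fin_two, ha, hb], by
    intro i j hij
    fin_cases i <;> fin_cases j <;> simp_all [disjoint_comm]⟩

/-- The estimate is applied to local units `v`, `w` and the vectors `ρ a ξ`, `ρ b ξ` fixed by them,
so the right side retains these norms instead of `‖ξ‖`. -/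
theorem UpperEstimate.add_le (hU : UpperEstimate 𝒱 ρ p) (h : IsTestAction 𝒱 ρ) {a b : C_c(X, ℝ)}
    (ha : IsTest 𝒱 a) (hb : IsTest 𝒱 b) (hab : Disjoint (tsupport a) (tsupport b)) (ξ : E) :
    ‖ρ (a + b) ξ‖ ^ p ≤ ‖ρ a ξ‖ ^ p + ‖ρ b ξ‖ ^ p := by
  obtain ⟨v, w, hv, hw, hvw, hva, hwb⟩ := h.exists_pair_units ha hb hab
  have := hU 2 ![v, w] (disjointTests_pair hv hw hvw) ![ρ a ξ, ρ b ξ]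
  simp only [Fin.sum_univ_two, Matrix.cons_val_zero, Matrix.cons_val_one,
    h.apply_of_eq_one hva, h.apply_of_eq_one hwb] at this
  rw [map_add]
  exact this

/-- The lower estimate bounds the mass of disjoint families, the upper estimate gives additivity on
disjoint supports. -/
theorem LowerEstimate.exists_measure [MeasurableSpace X] [BorelSpace X]
    (hl : LowerEstimate 𝒱 ρ p) (hu : UpperEstimate 𝒱 ρ p) (h : IsTestAction 𝒱 ρ) (hp : 1 ≤ p)
    (ξ : E) : ∃ m : Measure X, m.Regular ∧ m Set.univ ≤ ENNReal.ofReal (‖ξ‖ ^ p) ∧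
      ∀ a, IsTest 𝒱 a → ENNReal.ofReal (‖ρ a ξ‖ ^ p) ≤ m (tsupport a) :=
  HasDisjointBound.exists_measure (Z := orbitMap ρ ξ)
    { one_le := hp
      sum_le := fun n a ha => hl n a ha ξ
      add_le := fun _ _ ha hb hab => hu.add_le h ha hb hab ξ }

theorem upperEstimate_one (h : IsTestAction 𝒱 ρ) : UpperEstimate 𝒱 ρ 1 := by
  intro n a ha ξ
  simp only [Real.rpow_one]
  exact norm_sum_le_of_le _ fun i _ => h.apply_le (ha.isTest i) _

/-- The norm of a functional on an `ℓ^∞`-sum. -/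
theorem sum_mul_norm_le_of_forall {ι : Type*} [Fintype ι] {φ : ι → E →L[𝕜] 𝕜} {w : ι → ℝ}
    (hw : ∀ i, 0 ≤ w i) {B : ℝ} (h : ∀ ξ : ι → E, (∀ i, ‖ξ i‖ ≤ w i) → ‖∑ i, φ i (ξ i)‖ ≤ B) :
    ∑ i, w i * ‖φ i‖ ≤ B := by
  have key : ∀ ε > 0, ∑ i, w i * ‖φ i‖ ≤ B + (∑ i, w i) * ε := by
    intro ε hε
    -- Nearly norming vectors, rotated so that their values are nonnegative and add up without
    -- cancellation.
    have hx : ∀ i, ∃ x : E, ‖x‖ ≤ 1 ∧ ‖φ i‖ - ε ≤ ‖φ i x‖ ∧ φ i x = (‖φ i x‖ : 𝕜) := by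
      intro i
      obtain ⟨x, hx1, hx2⟩ := (φ i).exists_lt_apply_of_lt_opNorm (sub_lt_self ‖φ i‖ hε)
      obtain ⟨c, hc, hcx⟩ := RCLike.exists_norm_eq_mul_self (φ i x)
      refine ⟨c • x, by rw [norm_smul, hc, one_mul]; exact hx1.le, ?_, ?_⟩
      · rw [map_smul, norm_smul, hc, one_mul]
        exact hx2.le
      · rw [map_smul, smul_eq_mul, norm_mul, hc, one_mul, hcx]
    choose x hx1 hx2 hx3 using hx
    have h1 := h (fun i => (w i : 𝕜) • x i) fun i => by
      rw [norm_smul, RCLike.norm_ofReal, abs_of_nonneg (hw i)]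
      exact mul_le_of_le_one_right (hw i) (hx1 i)
    have h2 : ∑ i, φ i ((w i : 𝕜) • x i) = ((∑ i, w i * ‖φ i (x i)‖ : ℝ) : 𝕜) := by
      rw [RCLike.ofReal_sum]
      refine Finset.sum_congr rfl fun i _ => ?_
      rw [map_smul, smul_eq_mul, RCLike.ofReal_mul, ← hx3]
    rw [h2, RCLike.norm_ofReal] at h1
    have h3 := (le_abs_self _).trans h1
    calc ∑ i, w i * ‖φ i‖ ≤ ∑ i, (w i * ‖φ i (x i)‖ + w i * ε) :=
          Finset.sum_le_sum fun i _ => by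
            rw [← mul_add]
            exact mul_le_mul_of_nonneg_left (by linarith [hx2 i]) (hw i)
      _ ≤ B + (∑ i, w i) * ε := by
          rw [Finset.sum_add_distrib, Finset.sum_mul]
          linarith
  have hs : 0 ≤ ∑ i, w i := Finset.sum_nonneg fun i _ => hw i
  refine le_of_forall_pos_le_add fun ε hε => ?_
  refine (key (ε / (∑ i, w i + 1)) (by positivity)).trans (add_le_add_right ?_ B)
  rw [mul_div_assoc', div_le_iff₀ (by positivity)]
  nlinarith

/-- By duality an `ℓ^∞`-estimate for the operators becomes an `ℓ¹`-bound for the functionals `φ ∘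
ρ(b)`; with exponent one, additivity is the triangle inequality. -/
theorem SupEstimate.exists_measure [MeasurableSpace X] [BorelSpace X] (hs : SupEstimate 𝒱 ρ)
    (φ : E →L[𝕜] 𝕜) :
    ∃ n : Measure X, n.Regular ∧ n Set.univ ≤ ENNReal.ofReal ‖φ‖ ∧
      ∀ b, IsTest 𝒱 b → ENNReal.ofReal ‖φ ∘L ρ b‖ ≤ n (tsupport b) := by
  have := HasDisjointBound.exists_measure (Z := dualOrbitMap ρ φ) (𝒱 := 𝒱) (s := 1) (C := ‖φ‖)
    { one_le := le_rfl
      sum_le := fun n a ha => by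
        simp only [Real.rpow_one]
        have := sum_mul_norm_le_of_forall (φ := fun i => φ ∘L ρ (a i)) (w := fun _ => 1)
          (fun _ => zero_le_one) (B := ‖φ‖) fun ξ hξ => by
            simp only [ContinuousLinearMap.comp_apply]
            rw [← map_sum]
            exact φ.unit_le_opNorm _ (hs n a ha ξ 1 zero_le_one hξ)
        simp only [one_mul] at this
        exact this
      add_le := fun a b _ _ _ => by
        simp only [Real.rpow_one, map_add]
        exact norm_add_le _ _ }
  simp only [Real.rpow_one] at this
  exact this

/-- Duality exchanges the estimates: the upper `p`-estimate for vectors gives the `q`-bound on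
disjoint families of functionals, and the lower `p`-estimate gives their `q`-additivity. -/
theorem UpperEstimate.exists_measure [MeasurableSpace X] [BorelSpace X]
    (hu : UpperEstimate 𝒱 ρ p) (hl : LowerEstimate 𝒱 ρ p) (h : IsTestAction 𝒱 ρ)
    (hpq : p.HolderConjugate q) (φ : E →L[𝕜] 𝕜) :
    ∃ n : Measure X, n.Regular ∧ n Set.univ ≤ ENNReal.ofReal (‖φ‖ ^ q) ∧
      ∀ b, IsTest 𝒱 b → ENNReal.ofReal (‖φ ∘L ρ b‖ ^ q) ≤ n (tsupport b) := by
  refine HasDisjointBound.exists_measure (Z := dualOrbitMap ρ φ) (𝒱 := 𝒱) (s := q)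
    (C := ‖φ‖ ^ q) ⟨hpq.symm.lt.le, fun n a ha => ?_, fun a b ha hb hab => ?_⟩
  · set y : Fin n → ℝ := fun i => ‖φ ∘L ρ (a i)‖ with hy
    have hy0 : ∀ i, 0 ≤ y i := fun i => norm_nonneg _
    change ∑ i, y i ^ q ≤ _
    set Q := ∑ i, y i ^ q with hQ
    have hQ0 : 0 ≤ Q := Finset.sum_nonneg fun i _ => Real.rpow_nonneg (hy0 i) q
    -- The extremal weights for Hölder's inequality: `y^(q-1) · y = y^q` and `(y^(q-1))^p = y^q`, so
    -- both sides are expressed by `Q`, giving `Q ≤ ‖φ‖ Q^(1/p)`.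
    have hw : ∀ i, 0 ≤ y i ^ (q - 1) := fun i => Real.rpow_nonneg (hy0 i) _
    have h1 := sum_mul_norm_le_of_forall (φ := fun i => φ ∘L ρ (a i)) hw
      (B := ‖φ‖ * Q ^ p⁻¹) fun ξ hξ => by
        simp only [ContinuousLinearMap.comp_apply]
        rw [← map_sum]
        refine (φ.le_opNorm _).trans (mul_le_mul_of_nonneg_left ?_ (norm_nonneg φ))
        rw [Real.le_rpow_inv_iff_of_pos (norm_nonneg _) hQ0 hpq.pos]
        refine (hu n a ha ξ).trans (Finset.sum_le_sum fun i _ => ?_)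
        refine (Real.rpow_le_rpow (norm_nonneg _) (hξ i) hpq.nonneg).trans_eq ?_
        rw [← Real.rpow_mul (hy0 i), hpq.symm.sub_one_mul_conj]
    have h2 : ∑ i, y i ^ (q - 1) * ‖φ ∘L ρ (a i)‖ = Q := by
      refine Finset.sum_congr rfl fun i _ => ?_
      change y i ^ (q - 1) * y i = _
      conv_lhs => rw [← Real.rpow_one (y i), ← Real.rpow_mul (hy0 i), one_mul]
      rw [← Real.rpow_add' (hy0 i) (by linarith [hpq.symm.pos]), sub_add_cancel]
    rw [h2] at h1
    rcases hQ0.eq_or_lt with h0 | h0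
    · rw [← h0]
      positivity
    · have h3 : Q ^ q⁻¹ ≤ ‖φ‖ := by
        have h4 : Q = Q ^ q⁻¹ * Q ^ p⁻¹ := by
          rw [← Real.rpow_add h0, add_comm, hpq.inv_add_inv_eq_one, Real.rpow_one]
        conv_lhs at h1 => rw [h4]
        exact le_of_mul_le_mul_right h1 (Real.rpow_pos_of_pos h0 _)
      calc Q = (Q ^ q⁻¹) ^ q := by
            rw [← Real.rpow_mul hQ0, inv_mul_cancel₀ hpq.symm.ne_zero, Real.rpow_one]
        _ ≤ ‖φ‖ ^ q := Real.rpow_le_rpow (by positivity) h3 hpq.symm.nonneg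
  · obtain ⟨v, w, hv, hw, hvw, hva, hwb⟩ := h.exists_pair_units ha hb hab
    change ‖dualOrbitMap ρ φ (a + b)‖ ^ q ≤ ‖φ ∘L ρ a‖ ^ q + ‖φ ∘L ρ b‖ ^ q
    set y := ‖φ ∘L ρ a‖
    set z := ‖φ ∘L ρ b‖
    have hC : 0 ≤ y ^ q + z ^ q := by positivity
    rw [← Real.le_rpow_inv_iff_of_pos (norm_nonneg _) hC hpq.symm.pos]
    refine ContinuousLinearMap.opNorm_le_bound _ (by positivity) fun ξ => ?_
    -- Local units split `ξ` into `ρ v ξ` and `ρ w ξ`; Hölder's inequality and the lower estimate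
    -- for this pair then bound the functional.
    have h1 : dualOrbitMap ρ φ (a + b) ξ = (φ ∘L ρ a) (ρ v ξ) + (φ ∘L ρ b) (ρ w ξ) := by
      rw [map_add]
      simp only [ContinuousLinearMap.comp_apply, h.apply_apply_of_eq_one hva,
        h.apply_apply_of_eq_one hwb]
      rfl
    have h2 := Real.inner_le_Lp_mul_Lq Finset.univ ![y, z] ![‖ρ v ξ‖, ‖ρ w ξ‖] hpq.symm
    have hlow := hl 2 ![v, w] (disjointTests_pair hv hw hvw) ξ
    simp only [Fin.sum_univ_two, Matrix.cons_val_zero, Matrix.cons_val_one, abs_norm,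
      one_div] at h2 hlow
    rw [abs_of_nonneg (norm_nonneg (φ ∘L ρ a) : 0 ≤ y),
      abs_of_nonneg (norm_nonneg (φ ∘L ρ b) : 0 ≤ z)] at h2
    rw [h1]
    refine (norm_add_le_of_le ((φ ∘L ρ a).le_opNorm _) ((φ ∘L ρ b).le_opNorm _)).trans
      (h2.trans (mul_le_mul_of_nonneg_left ?_ (by positivity)))
    rw [Real.rpow_inv_le_iff_of_pos (by positivity) (norm_nonneg _) hpq.pos]
    exact hlow

/-- Optimizing Young's inequality. -/
theorem le_rpow_mul_rpow_of_forall {x D R : ℝ} (hpq : p.HolderConjugate q) (hD : 0 ≤ D)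
    (hR : 0 ≤ R) (h : ∀ t > 0, x ≤ D * (t ^ p / p) + R * (t⁻¹ ^ q / q)) :
    x ≤ D ^ p⁻¹ * R ^ q⁻¹ := by
  -- Adding `ε` makes both constants positive, so that an optimal `t` exists; continuity of the
  -- powers removes it.
  have key : ∀ ε > 0, x ≤ (D + ε) ^ p⁻¹ * (R + ε) ^ q⁻¹ := by
    intro ε hε
    set D' := D + ε
    set R' := R + ε
    have hD' : 0 < D' := by positivity
    have hR' : 0 < R' := by positivity
    -- This `t` makes `D' t^p` and `R' t^(-q)` both equal to the desired product, and the weights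
    -- `1/p` and `1/q` sum to one.
    set t := (R' / D') ^ (p⁻¹ * q⁻¹)
    have ht : 0 < t := by positivity
    have hp := hpq.pos
    have hq := hpq.symm.pos
    have h1 : D' * t ^ p = D' ^ p⁻¹ * R' ^ q⁻¹ := by
      rw [← Real.rpow_mul (by positivity), mul_right_comm, inv_mul_cancel₀ hpq.ne_zero, one_mul,
        Real.div_rpow hR'.le hD'.le]
      have : D' ^ p⁻¹ = D' / D' ^ q⁻¹ := by
        rw [← hpq.symm.one_sub_inv, Real.rpow_sub hD', Real.rpow_one]
      rw [this]
      ring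
    have h2 : R' * t⁻¹ ^ q = D' ^ p⁻¹ * R' ^ q⁻¹ := by
      rw [Real.inv_rpow ht.le, ← Real.rpow_mul (by positivity), mul_assoc,
        inv_mul_cancel₀ hpq.symm.ne_zero, mul_one, ← Real.inv_rpow (by positivity), inv_div,
        Real.div_rpow hD'.le hR'.le]
      have : R' ^ q⁻¹ = R' / R' ^ p⁻¹ := by
        rw [← hpq.one_sub_inv, Real.rpow_sub hR', Real.rpow_one]
      rw [this]
      ring
    calc x ≤ D * (t ^ p / p) + R * (t⁻¹ ^ q / q) := h t ht
      _ ≤ D' * (t ^ p / p) + R' * (t⁻¹ ^ q / q) := by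
          gcongr
          · exact le_add_of_nonneg_right hε.le
          · exact le_add_of_nonneg_right hε.le
      _ = (D' * t ^ p) * p⁻¹ + (R' * t⁻¹ ^ q) * q⁻¹ := by ring
      _ = D' ^ p⁻¹ * R' ^ q⁻¹ := by
          rw [h1, h2, ← mul_add, hpq.inv_add_inv_eq_one, mul_one]
  have hc : Continuous fun ε : ℝ => (D + ε) ^ p⁻¹ * (R + ε) ^ q⁻¹ :=
    ((continuous_const.add continuous_id).rpow_const fun _ => Or.inr hpq.inv_nonneg).mul
      ((continuous_const.add continuous_id).rpow_const fun _ => Or.inr hpq.symm.inv_nonneg)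
  have ht := (hc.tendsto 0).mono_left (nhdsWithin_le_nhds (s := Set.Ioi 0))
  simp only [add_zero] at ht
  exact ge_of_tendsto ht (eventually_nhdsWithin_of_forall key)

end VectorMeasures

/-! ### Operator norm bounds from dominated coefficients. -/

section Bounds

universe u v w

variable {𝕜 : Type w} [RCLike 𝕜] {G : Type u} [TopologicalSpace G] {𝒢 : EtaleGroupoid G}
  {L : G → Type v} [∀ γ, NormedAddCommGroup (L γ)] [∀ γ, NormedSpace 𝕜 (L γ)]
  [TopologicalSpace (TotalSpace 𝕜 L)] {T : Twist 𝕜 L 𝒢} {S : 𝒢.CoveringSemigroup}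
  {E : Type*} [NormedAddCommGroup E] [NormedSpace 𝕜 E]

theorem dNorm_nonneg (f : ∀ γ, L γ) : 0 ≤ dNorm 𝒢 f :=
  Real.iSup_nonneg fun _ => tsum_nonneg fun _ => norm_nonneg _

theorem rNorm_nonneg (f : ∀ γ, L γ) : 0 ≤ rNorm 𝒢 f :=
  Real.iSup_nonneg fun _ => tsum_nonneg fun _ => norm_nonneg _

/-- A coefficient of `ψ` dominated on test functions by two measures. -/
theorem BanachRep.enorm_coefficient_le (ψ : BanachRep T S E) [MeasurableSpace (UnitSpace 𝒢)]
    [BorelSpace (UnitSpace 𝒢)] {m n : Measure (UnitSpace 𝒢)} [IsFiniteMeasure m]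
    [IsFiniteMeasure n] [m.Regular] [n.Regular] {ξ : E} {φ : E →L[𝕜] 𝕜}
    (h : ∀ a b, IsTest (domains S) a → IsTest (domains S) b →
      ENNReal.ofReal (‖φ ∘L ψ.unitAction b‖ * ‖ψ.unitAction a ξ‖) ≤
        m (tsupport a) + n (tsupport b)) (f : Cc T) :
    ‖φ (ψ.onCc f ξ)‖ₑ ≤ ENNReal.ofReal (dNorm 𝒢 f.1) * m Set.univ +
      ENNReal.ofReal (rNorm 𝒢 f.1) * n Set.univ := by
  let Θ₀ : Cc T →ₗ[𝕜] 𝕜 :=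
    { toFun := fun f => φ (ψ.onCc f ξ)
      map_add' := fun f g => by rw [ψ.onCc_add, add_apply, map_add]
      map_smul' := fun c f => by rw [ψ.onCc_smul, smul_apply, map_smul]; rfl }
  -- The integration results concern functionals on all sections, so the coefficient is extended
  -- linearly; the extension need not be bounded, as only its values on `Cc T` are used.
  obtain ⟨Θ, hΘ⟩ := Θ₀.exists_extend
  have hΘ' : ∀ f : Cc T, Θ f.1 = φ (ψ.onCc f ξ) := fun f => LinearMap.congr_fun hΘ f
  rw [← hΘ']
  refine IsSupportBounded.enorm_le (S := S) ?_ T f.2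
  intro U hU g hg c K hc hgc hKU hK hg0
  have hUb := S.isBisection U hU
  have hgm : g ∈ Cc T := CcOn.mem_Cc T hUb hg
  rw [hΘ' ⟨g, hgm⟩]
  refine le_of_forall_le_add_ofReal_mul (B := ENNReal.ofReal c * 2)
    (ENNReal.mul_ne_top ENNReal.ofReal_ne_top (by simp)) fun δ hδ => ?_
  have hδ0 : ENNReal.ofReal δ ≠ 0 := by simpa using hδ
  -- Outer regularity keeps the supports of the local units within `δ` of `d(K)` and `r(K)` in
  -- measure.
  obtain ⟨A, hKA, hA, hmA⟩ := (dUnit 𝒢 '' K).exists_isOpen_lt_add (measure_ne_top m _) hδ0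
  obtain ⟨B, hKB, hB, hnB⟩ := (rUnit 𝒢 '' K).exists_isOpen_lt_add (measure_ne_top n _) hδ0
  have hdU := image_dUnit_mem_domains hU
  have hrU := image_rUnit_mem_domains hU
  obtain ⟨a, ha0, ha1, ha, haK⟩ := exists_bump (hK.image continuous_dUnit)
    (hA.inter (isOpen_of_mem_domains _ hdU)) (Set.subset_inter hKA (Set.image_mono hKU))
  obtain ⟨b, hb0, hb1, hb, hbK⟩ := exists_bump (hK.image continuous_rUnit)
    (hB.inter (isOpen_of_mem_domains _ hrU)) (Set.subset_inter hKB (Set.image_mono hKU))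
  have hat : IsTest (domains S) a := ⟨ha0, ha1, _, hdU, ha.trans Set.inter_subset_right⟩
  have hbt : IsTest (domains S) b := ⟨hb0, hb1, _, hrU, hb.trans Set.inter_subset_right⟩
  have hnorm : ‖φ (ψ.onCc ⟨g, hgm⟩ ξ)‖ ≤ c * (‖φ ∘L ψ.unitAction b‖ * ‖ψ.unitAction a ξ‖) := by
    rw [ψ.onCc_eq_mul_mul (g := ⟨g, hgm⟩) hUb hg hg0 haK hbK]
    change ‖(φ ∘L ψ.unitAction b) (ψ.onCc ⟨g, hgm⟩ (ψ.unitAction a ξ))‖ ≤ _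
    refine ((φ ∘L ψ.unitAction b).le_opNorm _).trans ?_
    rw [mul_left_comm]
    refine mul_le_mul_of_nonneg_left ?_ (norm_nonneg _)
    exact (ψ.onCc ⟨g, hgm⟩).le_of_opNorm_le
      ((ψ.norm_onCc_le hU hg).trans (supNorm_le hc hgc)) _
  rw [← ofReal_norm]
  calc ENNReal.ofReal ‖φ (ψ.onCc ⟨g, hgm⟩ ξ)‖
      ≤ ENNReal.ofReal c * (m (tsupport a) + n (tsupport b)) := by
        refine (ENNReal.ofReal_le_ofReal hnorm).trans ?_
        rw [ENNReal.ofReal_mul hc]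
        exact mul_le_mul_right (h a b hat hbt) _
    _ ≤ ENNReal.ofReal c * ((m (dUnit 𝒢 '' K) + ENNReal.ofReal δ) +
          (n (rUnit 𝒢 '' K) + ENNReal.ofReal δ)) := by
        refine mul_le_mul_right (add_le_add ?_ ?_) _
        · exact (measure_mono (ha.trans Set.inter_subset_left)).trans hmA.le
        · exact (measure_mono (hb.trans Set.inter_subset_left)).trans hnB.le
    _ = _ := by ring

theorem norm_le_of_coefficients {A : E →L[𝕜] E} {C : ℝ} (hC : 0 ≤ C)
    (h : ∀ (ξ : E) (φ : E →L[𝕜] 𝕜), ‖φ (A ξ)‖ ≤ C * ‖φ‖ * ‖ξ‖) : ‖A‖ ≤ C := by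
  refine A.opNorm_le_bound hC fun ξ => ?_
  refine NormedSpace.norm_le_dual_bound 𝕜 (A ξ) (by positivity) fun φ => (h ξ φ).trans_eq ?_
  ring

/-- The case `p = 1`: on the functional side the bound `‖φ ∘ ρ(b)‖ ≤ ‖φ‖` suffices, so the range
measure is taken to be zero and `‖φ‖` is absorbed into `m`. -/
theorem BanachRep.norm_onCc_le_dNorm (ψ : BanachRep T S E)
    (hl : LowerEstimate (domains S) ψ.unitAction 1) (f : Cc T) : ‖ψ.onCc f‖ ≤ dNorm 𝒢 f.1 := by
  refine norm_le_of_coefficients (dNorm_nonneg _) fun ξ φ => ?_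
  let _ : MeasurableSpace (UnitSpace 𝒢) := borel _
  have : BorelSpace (UnitSpace 𝒢) := ⟨rfl⟩
  have hact := ψ.isTestAction
  obtain ⟨m, hm, hm1, hm2⟩ := hl.exists_measure (upperEstimate_one hact) hact le_rfl ξ
  simp only [Real.rpow_one] at hm1 hm2
  have : IsFiniteMeasure m := ⟨hm1.trans_lt ENNReal.ofReal_lt_top⟩
  have hreg := Measure.Regular.smul (μ := m) (x := ENNReal.ofReal ‖φ‖) ENNReal.ofReal_ne_top
  have hfin := Measure.smul_finite m (c := ENNReal.ofReal ‖φ‖) ENNReal.ofReal_ne_top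
  have hreg0 : (0 : Measure (UnitSpace 𝒢)).Regular := Measure.Regular.zero
  have h := ψ.enorm_coefficient_le (m := ENNReal.ofReal ‖φ‖ • m) (n := 0) (ξ := ξ) (φ := φ)
    (fun a b ha hb => by
      rw [Measure.coe_zero, Pi.zero_apply, add_zero, Measure.smul_apply, smul_eq_mul,
        ENNReal.ofReal_mul (norm_nonneg _)]
      refine mul_le_mul' (ENNReal.ofReal_le_ofReal ?_) (hm2 a ha)
      refine (φ.opNorm_comp_le _).trans ?_
      exact mul_le_of_le_one_right (norm_nonneg _) (hact.norm_le b hb)) f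
  rw [Measure.coe_zero, Pi.zero_apply, mul_zero, add_zero, Measure.smul_apply, smul_eq_mul,
    ← ofReal_norm] at h
  refine (ENNReal.ofReal_le_ofReal_iff (by have := dNorm_nonneg (𝒢 := 𝒢) f.1; positivity)).1 ?_
  refine h.trans ?_
  rw [mul_assoc, ENNReal.ofReal_mul (dNorm_nonneg _), ENNReal.ofReal_mul (norm_nonneg _)]
  gcongr

/-- The mirror image for the supremum norm: `‖ρ(a)ξ‖ ≤ ‖ξ‖` is enough on the vector side, and only
the measure of the functional is used. -/
theorem BanachRep.norm_onCc_le_rNorm (ψ : BanachRep T S E)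
    (hs : SupEstimate (domains S) ψ.unitAction) (f : Cc T) : ‖ψ.onCc f‖ ≤ rNorm 𝒢 f.1 := by
  refine norm_le_of_coefficients (rNorm_nonneg _) fun ξ φ => ?_
  let _ : MeasurableSpace (UnitSpace 𝒢) := borel _
  have : BorelSpace (UnitSpace 𝒢) := ⟨rfl⟩
  have hact := ψ.isTestAction
  obtain ⟨n, hn, hn1, hn2⟩ := hs.exists_measure φ
  have : IsFiniteMeasure n := ⟨hn1.trans_lt ENNReal.ofReal_lt_top⟩
  have hreg := Measure.Regular.smul (μ := n) (x := ENNReal.ofReal ‖ξ‖) ENNReal.ofReal_ne_top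
  have hfin := Measure.smul_finite n (c := ENNReal.ofReal ‖ξ‖) ENNReal.ofReal_ne_top
  have hreg0 : (0 : Measure (UnitSpace 𝒢)).Regular := Measure.Regular.zero
  have h := ψ.enorm_coefficient_le (m := 0) (n := ENNReal.ofReal ‖ξ‖ • n) (ξ := ξ) (φ := φ)
    (fun a b ha hb => by
      rw [Measure.coe_zero, Pi.zero_apply, zero_add, Measure.smul_apply, smul_eq_mul, mul_comm,
        ENNReal.ofReal_mul (norm_nonneg _)]
      exact mul_le_mul' (ENNReal.ofReal_le_ofReal (hact.apply_le ha ξ)) (hn2 b hb)) f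
  rw [Measure.coe_zero, Pi.zero_apply, mul_zero, zero_add, Measure.smul_apply, smul_eq_mul,
    ← ofReal_norm] at h
  refine (ENNReal.ofReal_le_ofReal_iff (by have := rNorm_nonneg (𝒢 := 𝒢) f.1; positivity)).1 ?_
  refine h.trans ?_
  rw [mul_assoc, ENNReal.ofReal_mul (rNorm_nonneg _), mul_comm ‖φ‖,
    ENNReal.ofReal_mul (norm_nonneg _)]
  gcongr

/-- Young's inequality splits the product of the two norms into a sum, at the price of an
inhomogeneous bound. Homogeneity is recovered by scaling the vector and the functional inversely. -/
theorem BanachRep.norm_onCc_le_rpow (ψ : BanachRep T S E) {p q : ℝ} (hpq : p.HolderConjugate q)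
    (hl : LowerEstimate (domains S) ψ.unitAction p)
    (hu : UpperEstimate (domains S) ψ.unitAction p) (f : Cc T) :
    ‖ψ.onCc f‖ ≤ dNorm 𝒢 f.1 ^ p⁻¹ * rNorm 𝒢 f.1 ^ q⁻¹ := by
  have hD := dNorm_nonneg (𝒢 := 𝒢) f.1
  have hR := rNorm_nonneg (𝒢 := 𝒢) f.1
  let _ : MeasurableSpace (UnitSpace 𝒢) := borel _
  have : BorelSpace (UnitSpace 𝒢) := ⟨rfl⟩
  have hact := ψ.isTestAction
  have key : ∀ (ξ : E) (φ : E →L[𝕜] 𝕜), ‖φ (ψ.onCc f ξ)‖ ≤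
      dNorm 𝒢 f.1 * (‖ξ‖ ^ p / p) + rNorm 𝒢 f.1 * (‖φ‖ ^ q / q) := by
    intro ξ φ
    obtain ⟨m, hm, hm1, hm2⟩ := hl.exists_measure hu hact hpq.lt.le ξ
    obtain ⟨n, hn, hn1, hn2⟩ := hu.exists_measure hl hact hpq φ
    have : IsFiniteMeasure m := ⟨hm1.trans_lt ENNReal.ofReal_lt_top⟩
    have : IsFiniteMeasure n := ⟨hn1.trans_lt ENNReal.ofReal_lt_top⟩
    have := Measure.Regular.smul (μ := m) (x := ENNReal.ofReal p⁻¹) ENNReal.ofReal_ne_top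
    have := Measure.smul_finite m (c := ENNReal.ofReal p⁻¹) ENNReal.ofReal_ne_top
    have := Measure.Regular.smul (μ := n) (x := ENNReal.ofReal q⁻¹) ENNReal.ofReal_ne_top
    have := Measure.smul_finite n (c := ENNReal.ofReal q⁻¹) ENNReal.ofReal_ne_top
    have hp := hpq.inv_nonneg
    have hq := hpq.symm.inv_nonneg
    have h := ψ.enorm_coefficient_le (m := ENNReal.ofReal p⁻¹ • m) (n := ENNReal.ofReal q⁻¹ • n)
      (ξ := ξ) (φ := φ) (fun a b ha hb => by
        have hy := Real.young_inequality_of_nonneg (norm_nonneg (ψ.unitAction a ξ))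
          (norm_nonneg (φ ∘L ψ.unitAction b)) hpq
        rw [mul_comm, div_eq_inv_mul, div_eq_inv_mul] at hy
        refine (ENNReal.ofReal_le_ofReal hy).trans ?_
        rw [ENNReal.ofReal_add (by positivity) (by positivity), ENNReal.ofReal_mul hp,
          ENNReal.ofReal_mul hq]
        exact add_le_add (mul_le_mul_right (hm2 a ha) _) (mul_le_mul_right (hn2 b hb) _)) f
    rw [Measure.smul_apply, smul_eq_mul, Measure.smul_apply, smul_eq_mul, ← ofReal_norm] at h
    rw [div_eq_inv_mul, div_eq_inv_mul]
    refine (ENNReal.ofReal_le_ofReal_iff (by positivity)).1 (h.trans ?_)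
    rw [ENNReal.ofReal_add (by positivity) (by positivity), ENNReal.ofReal_mul hD,
      ENNReal.ofReal_mul hR, ENNReal.ofReal_mul hp, ENNReal.ofReal_mul hq]
    gcongr
  refine ContinuousLinearMap.opNorm_le_of_unit_norm (by positivity) fun ξ hξ => ?_
  obtain ⟨φ, hφ, hφξ⟩ := exists_dual_vector'' 𝕜 (ψ.onCc f ξ)
  refine le_rpow_mul_rpow_of_forall hpq hD hR fun t ht => ?_
  -- The coefficient is unchanged by this scaling, whereas the two terms of the bound acquire the
  -- factors `t^p` and `t^(-q)`.
  have h := key ((t : 𝕜) • ξ) (((t⁻¹ : ℝ) : 𝕜) • φ)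
  rw [map_smul, smul_apply, map_smul, hφξ, smul_smul, ← RCLike.ofReal_mul,
    inv_mul_cancel₀ ht.ne', RCLike.ofReal_one, one_smul, RCLike.norm_ofReal, abs_norm, norm_smul,
    norm_smul, hξ, mul_one, RCLike.norm_ofReal, RCLike.norm_ofReal, abs_of_pos ht,
    abs_of_pos (inv_pos.2 ht)] at h
  refine h.trans ?_
  have hq := hpq.symm.nonneg
  gcongr
  exact mul_le_of_le_one_right (by positivity) hφ

end Bounds

/-! ### Assembly of the cases. -/

section Main

universe u v w

variable {𝕜 : Type w} [RCLike 𝕜] {G : Type u} [TopologicalSpace G] {𝒢 : EtaleGroupoid G}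
  {L : G → Type v} [∀ γ, NormedAddCommGroup (L γ)] [∀ γ, NormedSpace 𝕜 (L γ)]
  [TopologicalSpace (TotalSpace 𝕜 L)] {T : Twist 𝕜 L 𝒢} {S : 𝒢.CoveringSemigroup}

/-- The exponent `2` is treated first, whichever hypothesis holds, because the rotation argument
fails there; orthogonality covers it. -/
theorem BanachRep.lowerEstimate_and_upperEstimate {p : ℝ≥0∞} [Fact (1 ≤ p)] {Ω : Type*}
    [MeasurableSpace Ω] {μ : Measure Ω} (ψ : BanachRep T S (Lp 𝕜 p μ)) (hp : p ≠ ∞)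
    (h : (IsComplexField 𝕜 ∧ ψ.ContractiveOnUnits) ∨ p = 2 ∨ ψ.UnitsSatisfy IsLpMultiplication) :
    LowerEstimate (domains S) ψ.unitAction p.toReal ∧
      UpperEstimate (domains S) ψ.unitAction p.toReal := by
  have hact := ψ.isTestAction
  by_cases hp2 : p = 2
  · subst hp2
    rw [ENNReal.toReal_ofNat]
    exact ⟨hact.lowerEstimate_two, hact.upperEstimate_two⟩
  · rcases h with ⟨h𝕜, h⟩ | h | h
    · have hs := h.isSupContractive
      have hd := hs.hasDisjointRanges hact h𝕜 hp hp2
      exact ⟨hs.lowerEstimate hd hp, hd.upperEstimate hact hp⟩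
    · exact absurd h hp2
    · exact ⟨lowerEstimate_of_multiplication hact h.unitAction hp,
        (hasDisjointRanges_of_multiplication hact h.unitAction).upperEstimate hact hp⟩

theorem BanachRep.supEstimate_lpTop {Ω : Type*} [MeasurableSpace Ω] {μ : Measure Ω}
    (ψ : BanachRep T S (Lp 𝕜 ∞ μ))
    (h : (IsComplexField 𝕜 ∧ ψ.ContractiveOnUnits) ∨ ψ.UnitsSatisfy IsLpMultiplication) :
    SupEstimate (domains S) ψ.unitAction := by
  have hact := ψ.isTestAction
  rcases h with ⟨h𝕜, h⟩ | h
  · exact h.isSupContractive.supEstimate hact h𝕜 hasRotationCalculus_lpTop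
  · exact (hasDisjointRanges_of_multiplication hact h.unitAction).supEstimate hact

theorem BanachRep.supEstimate_c0 {Ω : Type*} [TopologicalSpace Ω]
    (ψ : BanachRep T S C₀(Ω, 𝕜))
    (h : (IsComplexField 𝕜 ∧ ψ.ContractiveOnUnits) ∨ ψ.UnitsSatisfy IsC0Multiplication) :
    SupEstimate (domains S) ψ.unitAction := by
  have hact := ψ.isTestAction
  rcases h with ⟨h𝕜, h⟩ | h
  · exact h.isSupContractive.supEstimate hact h𝕜 hasRotationCalculus_c0
  · exact supEstimate_of_c0Multiplication hact h.unitAction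

theorem toReal_one_div_add {p q : ℝ≥0∞} (h : 1 / p + 1 / q = 1) :
    (1 / p).toReal + (1 / q).toReal = 1 := by
  have h1 : 1 / p ≠ ∞ := ne_top_of_le_ne_top ENNReal.one_ne_top (le_self_add.trans_eq h)
  have h2 : 1 / q ≠ ∞ := ne_top_of_le_ne_top ENNReal.one_ne_top (le_add_self.trans_eq h)
  rw [← ENNReal.toReal_add h1 h2, h, ENNReal.toReal_one]

theorem rpow_mul_rpow_le_INorm (f : ∀ γ, L γ) {α β : ℝ} (hα : 0 ≤ α) (hβ : 0 ≤ β)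
    (h : α + β = 1) : dNorm 𝒢 f ^ α * rNorm 𝒢 f ^ β ≤ INorm 𝒢 f := by
  have hI : 0 ≤ INorm 𝒢 f := (dNorm_nonneg f).trans (le_max_left _ _)
  calc dNorm 𝒢 f ^ α * rNorm 𝒢 f ^ β ≤ INorm 𝒢 f ^ α * INorm 𝒢 f ^ β :=
        mul_le_mul (Real.rpow_le_rpow (dNorm_nonneg f) (le_max_left _ _) hα)
          (Real.rpow_le_rpow (rNorm_nonneg f) (le_max_right _ _) hβ)
          (Real.rpow_nonneg (rNorm_nonneg f) _) (Real.rpow_nonneg hI _)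
    _ = INorm 𝒢 f := by
        rw [← Real.rpow_add_of_nonneg hI hα hβ, h, Real.rpow_one]

theorem BanachRep.norm_onCc_le_of_lp {p q : ℝ≥0∞} [Fact (1 ≤ p)] (hpq : 1 / p + 1 / q = 1)
    {Ω : Type*} [MeasurableSpace Ω] {μ : Measure Ω} (ψ : BanachRep T S (Lp 𝕜 p μ))
    (h : (IsComplexField 𝕜 ∧ ψ.ContractiveOnUnits) ∨ p = 2 ∨ ψ.UnitsSatisfy IsLpMultiplication)
    (f : Cc T) :
    ‖ψ.onCc f‖ ≤ dNorm 𝒢 f.1 ^ (1 / p).toReal * rNorm 𝒢 f.1 ^ (1 / q).toReal := by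
  have hsum := toReal_one_div_add hpq
  by_cases hp : p = ∞
  · subst hp
    have hα : (1 / ∞ : ℝ≥0∞).toReal = 0 := by simp
    rw [hα, zero_add] at hsum
    rw [hα, hsum, Real.rpow_zero, one_mul, Real.rpow_one]
    exact ψ.norm_onCc_le_rNorm (ψ.supEstimate_lpTop (h.imp_right fun h =>
      h.resolve_left (by simp))) f
  · obtain ⟨hl, hu⟩ := ψ.lowerEstimate_and_upperEstimate hp h
    have hα : (1 / p).toReal = p.toReal⁻¹ := by rw [one_div, ENNReal.toReal_inv]
    have hp1 : 1 ≤ p.toReal := by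
      rw [← ENNReal.toReal_one]
      exact ENNReal.toReal_mono hp Fact.out
    rw [hα] at hsum ⊢
    rcases hp1.eq_or_lt with h1 | h1
    -- For `p = 1` the exponent of `rNorm` is zero, and the real power with exponent zero is `1`
    -- even at base zero, so only `dNorm` remains.
    · rw [← h1, inv_one] at hsum ⊢
      have hβ : (1 / q).toReal = 0 := by linarith
      rw [hβ, Real.rpow_zero, mul_one, Real.rpow_one]
      rw [← h1] at hl
      exact ψ.norm_onCc_le_dNorm hl f
    · have hβ : 0 < (1 / q).toReal := by
        have := inv_lt_one_of_one_lt₀ h1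
        linarith
      have hc := Real.HolderConjugate.inv_inv (inv_pos.2 (one_pos.trans h1)) hβ hsum
      rw [inv_inv] at hc
      have := ψ.norm_onCc_le_rpow hc hl hu f
      rwa [inv_inv] at this

end Main

end TwistedGroupoid

end

open TwistedGroupoid
theorem mainTheorem2 {𝕜 : Type*} [RCLike 𝕜] {G : Type*} [TopologicalSpace G]
    {𝒢 : EtaleGroupoid G} {L : G → Type*} [∀ γ, NormedAddCommGroup (L γ)]
    [∀ γ, NormedSpace 𝕜 (L γ)] [TopologicalSpace (TotalSpace 𝕜 L)]
    (T : Twist 𝕜 L 𝒢) (S : 𝒢.CoveringSemigroup) :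
    (∀ (p q : ℝ≥0∞) [Fact (1 ≤ p)] (_ : 1 / p + 1 / q = 1)
        {Ω : Type*} [MeasurableSpace Ω] (μ : Measure Ω) (ψ : BanachRep T S (Lp 𝕜 p μ)),
        (IsComplexField 𝕜 ∧ ψ.ContractiveOnUnits) ∨ p = 2 ∨
          ψ.UnitsSatisfy IsLpMultiplication →
        ∀ f : Cc T,
          ‖ψ.onCc f‖ ≤ dNorm 𝒢 f.1 ^ (1 / p).toReal * rNorm 𝒢 f.1 ^ (1 / q).toReal ∧
          dNorm 𝒢 f.1 ^ (1 / p).toReal * rNorm 𝒢 f.1 ^ (1 / q).toReal ≤ INorm 𝒢 f.1) ∧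
    (∀ {Ω : Type*} [TopologicalSpace Ω] [LocallyCompactSpace Ω] [T2Space Ω]
        (ψ : BanachRep T S C₀(Ω, 𝕜)),
        (IsComplexField 𝕜 ∧ ψ.ContractiveOnUnits) ∨ ψ.UnitsSatisfy IsC0Multiplication →
        ∀ f : Cc T, ‖ψ.onCc f‖ ≤ rNorm 𝒢 f.1) := by
  refine ⟨fun p q _ hpq Ω _ μ ψ h f => ⟨ψ.norm_onCc_le_of_lp hpq h f, ?_⟩,
    fun ψ h f => ψ.norm_onCc_le_rNorm (ψ.supEstimate_c0 h) f⟩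
  exact rpow_mul_rpow_le_INorm f.1 ENNReal.toReal_nonneg ENNReal.toReal_nonneg
    (toReal_one_div_add hpq)
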